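/- Conventions. A *-category is a $\mathbb C$-linear category with antilinear maps $*:\mathrm{Hom}(X,Y)\to \mathrm{Hom}(Y,X)$ satisfying $f^{**}=f$ and $(fg)^*=g^*f^*$. A W*-category is a *-category $C$ such that, for every formal finite direct sum $X=x_1\oplus\dots\oplus x_n$ of objects of $C$, the *-algebra $\mathrm{End}(X)$ of matrices $(f_{ij})$ with $f_{ij}:x_j\to x_i$ is a W*-algebra, i.e. is *-isomorphic to a von Neumann algebra on a Hilbert space. The norm of a morphism is defined by $\|f\|\le r\iff r^2-f^*f\ge 0$ (for $r\geq 0$). A functor $F:C\to D$ of W*-categories is a linear *-preserving functor such that for every such $X$ the induced homomorphism $\mathrm{End}(X)\to\mathrm{End}(F(X))$, $(f_{ij})\mapsto (F(f_{ij}))$, is normal, i.e. preserves suprema of bounded increasing nets of positive elements. A natural transformation $\alpha$ is bounded if $\sup_c\|\alpha_c\|<\infty$. $\mathrm{Func}(C,D)$ is the category of functors of W*-categories $C\to D$ and bounded natural transformations. An orthogonal direct sum of a family $(c_i)_{i\in I}$ of objects is an object $x$ with morphisms $\iota_i:c_i\to x$ such that $\iota_i^*\iota_j=\delta_{ij}\,\mathrm{id}_{c_i}$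 and $\sum_{i}\iota_i\iota_i^*=\mathrm{id}_x$, the sum being the supremum of its finite partial sums. A W*-category admits all direct sums if every family of objects indexed by a set has an orthogonal direct sum. It is idempotent complete if for every $p:x\to x$ with $p^2=p^*=p$ there is $\iota:y\to x$ with $\iota\iota^*=p$ and $\iota^*\iota=\mathrm{id}_y$. It is Cauchy complete if it admits all direct sums and is idempotent complete. The direct sum completion $C^{\bar\oplus}$ of a W*-category $C$ has as objects the formal direct sums $\bigoplus_{i\in I}x_i$ of objects of $C$ over arbitrary sets $I$. Its endomorphism algebras are the von Neumann algebras generated by the matrices $(f_{ij})$ with entries $f_{ij}\in\mathrm{Hom}(x_j,x_i)$, finitely many of them nonzero, and $\mathrm{Hom}(\bigoplus_{i\in I} x_i,\bigoplus_{j\in J} y_j)$ is the corresponding corner of $\mathrm{End}(\bigoplus_{i\in I} x_i\oplus\bigoplus_{j\in J} y_j)$. Concretely, the morphisms $\bigoplus_{i\in I} x_i\to\bigoplus_{j\in J} y_j$ are the matrices with entries in $\mathrm{Hom}(x_i,y_j)$ whose finite blocks are uniformly bounded in norm, with the adjoint matrix as adjoint, and they are composed by ultraweakly convergent matrix multiplication.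 There is an inclusion $C\to C^{\bar\oplus}$ given by the one-term sums. The idempotent completion $\hat C$ has as objects the pairs $(x,p)$ with $p:x\to x$, $p^2=p^*=p$, and morphisms $\mathrm{Hom}((x_1,p_1),(x_2,p_2))=p_2\,\mathrm{Hom}(x_1,x_2)\,p_1$. The Cauchy completion of $C$ is $C^{\hat\oplus}:=(\hat C)^{\bar\oplus}$, with the inclusion $C\to\hat C\to C^{\hat\oplus}$, where $x\mapsto (x,\mathrm{id}_x)$. Theorem. Let $C$ and $D$ be W*-categories. (1) If $D$ admits all direct sums, then the restriction functor $\mathrm{Func}(C^{\bar\oplus},D)\to\mathrm{Func}(C,D)$ along the inclusion $C\to C^{\bar\oplus}$ is an equivalence of categories. (2) If $D$ is Cauchy complete, then the restriction functor $\mathrm{Func}(C^{\hat\oplus},D)\to\mathrm{Func}(C,D)$ along the inclusion $C\to C^{\hat\oplus}$ is an equivalence of categories. -/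

import Mathlib

universe v u w

namespace WStar

open CategoryTheory Filter Topology
open scoped ComplexOrder

set_option linter.unusedSectionVars false

section Algebra

variable {A B : Type*}

/-- An element of a *-algebra is positive if it has the form `b* b`. -/
def IsPos [Mul A] [Star A] (a : A) : Prop := ∃ b : A, a = star b * b

/-- `a` is the supremum of `S` for the order `x ≤ y ↔ y - x` positive. -/
def IsSup [Mul A] [Star A] [Sub A] (S : Set A) (a : A) : Prop :=
  (∀ s ∈ S, IsPos (a - s)) ∧ ∀ b, (∀ s ∈ S, IsPos (b - s)) → IsPos (b - a)

/-- Normality: `f` preserves the suprema of all increasing families of positive elements, each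
family being given as a nonempty directed set (suprema are bounds, so such a set is bounded). -/
def PreservesSups [Mul A] [Star A] [Sub A] [Mul B] [Star B] [Sub B] (f : A → B) : Prop :=
  ∀ S : Set A, S.Nonempty → DirectedOn (fun s t => IsPos (t - s)) S → (∀ s ∈ S, IsPos s) →
    ∀ a, IsSup S a → IsSup (f '' S) (f a)

/-- A W*-algebra: a *-algebra that is *-isomorphic to a von Neumann algebra on a Hilbert space. -/
def IsWStarAlgebra (A : Type v) [Ring A] [StarRing A] [Algebra ℂ A] : Prop :=
  ∃ (H : Type v) (_ : NormedAddCommGroup H) (_ : InnerProductSpace ℂ H) (_ : CompleteSpace H)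
    (S : VonNeumannAlgebra H), Nonempty (A ≃⋆ₐ[ℂ] S.toStarSubalgebra)

/-- A normal positive linear functional. -/
structure IsNormalFunctional [Ring A] [StarRing A] [Algebra ℂ A] (ω : A →ₗ[ℂ] ℂ) : Prop where
  pos : ∀ a, IsPos a → IsPos (ω a)
  sups : PreservesSups ω

theorem isPos_complex {z : ℂ} : IsPos z ↔ 0 ≤ z := by
  constructor
  · rintro ⟨w, rfl⟩
    exact star_mul_self_nonneg w
  · intro h
    have h2 := Complex.nonneg_iff.1 h
    refine ⟨((Real.sqrt z.re : ℝ) : ℂ), ?_⟩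
    have : star ((Real.sqrt z.re : ℝ) : ℂ) = ((Real.sqrt z.re : ℝ) : ℂ) := Complex.conj_ofReal _
    rw [this, ← Complex.ofReal_mul, Real.mul_self_sqrt h2.1]
    apply Complex.ext <;> simp [← h2.2]

section Hilbert
open ContinuousLinearMap

variable {H : Type*} [NormedAddCommGroup H] [InnerProductSpace ℂ H] [CompleteSpace H]

/-- A bounded monotone net of positive operators converges weakly. -/
theorem exists_weak_limit {ι : Type*} [Preorder ι] [IsDirectedOrder ι] [Nonempty ι]
    (T : ι → H →L[ℂ] H) (hT : Monotone T) (h0 : ∀ i, 0 ≤ T i) (M : H →L[ℂ] H)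
    (hM : ∀ i, T i ≤ M) :
    ∃ L : H →L[ℂ] H, ∀ x y, Tendsto (fun i => inner ℂ (T i x) y) atTop (𝓝 (inner ℂ (L x) y)) := by
  have hpos : ∀ P : H →L[ℂ] H, 0 ≤ P → ∀ x, ((inner ℂ (P x) x).re : ℂ) = inner ℂ (P x) x ∧
      0 ≤ (inner ℂ (P x) x).re := fun P hP =>
    (isPositive_iff_complex P).1 ((nonneg_iff_isPositive P).1 hP)
  have hle : ∀ P Q : H →L[ℂ] H, P ≤ Q → ∀ x, (inner ℂ (P x) x).re ≤ (inner ℂ (Q x) x).re := by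
    intro P Q h x
    have := (hpos (Q - P) (sub_nonneg.2 h) x).2
    simp only [sub_apply, inner_sub_left, Complex.sub_re] at this
    linarith
  have hq : ∀ x, ∃ l : ℂ, Tendsto (fun i => inner ℂ (T i x) x) atTop (𝓝 l) := by
    intro x
    refine ⟨((⨆ i, (inner ℂ (T i x) x).re : ℝ) : ℂ), ?_⟩
    have h1 : Tendsto (fun i => (inner ℂ (T i x) x).re) atTop (𝓝 (⨆ i, (inner ℂ (T i x) x).re)) :=
      tendsto_atTop_ciSup (fun i j h => hle _ _ (hT h) x)
        ⟨(inner ℂ (M x) x).re, by rintro _ ⟨i, rfl⟩; exact hle _ _ (hM i) x⟩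
    have h2 := (Complex.continuous_ofReal.tendsto _).comp h1
    refine h2.congr fun i => ?_
    exact (hpos _ (h0 i) x).1
  have hb : ∀ x y, ∃ l : ℂ, Tendsto (fun i => inner ℂ (T i x) y) atTop (𝓝 l) := by
    intro x y
    obtain ⟨a, ha⟩ := hq (y + x)
    obtain ⟨b, hb⟩ := hq (y - x)
    obtain ⟨c, hc⟩ := hq (y + Complex.I • x)
    obtain ⟨d, hd⟩ := hq (y - Complex.I • x)
    refine ⟨(a - b + Complex.I * c - Complex.I * d) / 4, ?_⟩
    have := ((((ha.sub hb).add (hc.const_mul Complex.I)).sub (hd.const_mul Complex.I)).div_const 4)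
    refine this.congr fun i => ?_
    exact (inner_map_polarization (T i : H →ₗ[ℂ] H) y x).symm
  choose l hl using hb
  have hnorm : ∀ x y, ‖l x y‖ ≤ ‖M‖ * ‖x‖ * ‖y‖ := by
    intro x y
    refine le_of_tendsto (hl x y).norm (Eventually.of_forall fun i => ?_)
    refine (norm_inner_le_norm _ _).trans ?_
    gcongr
    refine ((T i).le_opNorm x).trans ?_
    gcongr
    exact CStarAlgebra.norm_le_norm_of_nonneg_of_le (h0 i) (hM i)
  let F : H →L⋆[ℂ] H →L[ℂ] ℂ := LinearMap.mkContinuous₂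
    (LinearMap.mk₂'ₛₗ (starRingEnd ℂ) (RingHom.id ℂ) l
      (fun x x' y => tendsto_nhds_unique (hl _ _) (by
        simpa [inner_add_left] using (hl x y).add (hl x' y)))
      (fun c x y => tendsto_nhds_unique (hl _ _) (by
        simpa [inner_smul_left, mul_comm] using (hl x y).const_mul ((starRingEnd ℂ) c)))
      (fun x y y' => tendsto_nhds_unique (hl _ _) (by
        simpa [inner_add_right] using (hl x y).add (hl x y')))
      (fun c x y => tendsto_nhds_unique (hl _ _) (by
        simpa [inner_smul_right] using (hl x y).const_mul c)))
    ‖M‖ hnorm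
  refine ⟨InnerProductSpace.continuousLinearMapOfBilin F, fun x y => ?_⟩
  rw [InnerProductSpace.continuousLinearMapOfBilin_apply]
  exact hl x y

end Hilbert

section Abstract
open ContinuousLinearMap
variable {A : Type v} [Ring A] [StarRing A] [Algebra ℂ A]

/-- Auxiliary: a faithful representation of a *-algebra whose image is its own bicommutant. -/
structure VNRep (A : Type v) [Ring A] [StarRing A] [Algebra ℂ A] where
  H : Type v
  [i1 : NormedAddCommGroup H]
  [i2 : InnerProductSpace ℂ H]
  [i3 : CompleteSpace H]
  π : A →⋆ₐ[ℂ] (H →L[ℂ] H)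
  inj : Function.Injective π
  bicomm : ∀ T : H →L[ℂ] H, (∀ R : H →L[ℂ] H, (∀ a, R * π a = π a * R) → R * T = T * R) →
    ∃ a, π a = T

attribute [instance] VNRep.i1 VNRep.i2 VNRep.i3

theorem IsWStarAlgebra.rep (h : IsWStarAlgebra A) : Nonempty (VNRep A) := by
  obtain ⟨H, _, _, _, S, ⟨e⟩⟩ := h
  let e' : A →⋆ₐ[ℂ] S.toStarSubalgebra := e
  refine ⟨{ H := H, π := S.toStarSubalgebra.subtype.comp e', inj := ?_, bicomm := ?_ }⟩
  · exact Subtype.val_injective.comp e.injective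
  · intro T hT
    have : T ∈ S.carrier := by
      rw [← S.centralizer_centralizer']
      intro R hR
      refine hT R fun a => ?_
      exact (hR _ (e a).2).symm
    refine ⟨e.symm ⟨T, this⟩, ?_⟩
    change ((e (e.symm ⟨T, this⟩) : S.toStarSubalgebra) : H →L[ℂ] H) = T
    rw [e.apply_symm_apply]

namespace VNRep
variable (R : VNRep A)

theorem isPos_iff {a : A} : IsPos a ↔ 0 ≤ R.π a := by
  constructor
  · rintro ⟨b, rfl⟩
    rw [map_mul, map_star]
    exact star_mul_self_nonneg _
  · intro h
    obtain ⟨b, hb⟩ := R.bicomm (CFC.sqrt (R.π a)) (fun T hT => by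
      have h1 : Commute (R.π a) T := (hT a).symm
      exact (h1.cfcₙ_nnreal NNReal.sqrt).symm)
    refine ⟨b, R.inj ?_⟩
    have hs : star (CFC.sqrt (R.π a)) = CFC.sqrt (R.π a) :=
      (IsSelfAdjoint.of_nonneg (CFC.sqrt_nonneg _)).star_eq
    rw [map_mul, map_star, hb, hs, CFC.sqrt_mul_sqrt_self _ h]

theorem isPos_sub_iff {a b : A} : IsPos (b - a) ↔ R.π a ≤ R.π b := by
  rw [R.isPos_iff, map_sub, sub_nonneg]

theorem net_lim {ι : Type*} [Preorder ι] [IsDirectedOrder ι] [Nonempty ι] (c : ι → A)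
    (hc : ∀ i j, i ≤ j → IsPos (c j - c i)) (h0 : ∀ i, IsPos (c i)) (b : A)
    (hb : ∀ i, IsPos (b - c i)) :
    ∃ a, IsSup (Set.range c) a ∧
      ∀ x y, Tendsto (fun i => inner ℂ (R.π (c i) x) y) atTop (𝓝 (inner ℂ (R.π a x) y)) := by
  obtain ⟨L, hL⟩ := exists_weak_limit (fun i => R.π (c i))
    (fun i j h => R.isPos_sub_iff.1 (hc i j h)) (fun i => R.isPos_iff.1 (h0 i)) (R.π b)
    (fun i => R.isPos_sub_iff.1 (hb i))
  obtain ⟨a, rfl⟩ := R.bicomm L (fun T hT => by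
    ext x
    refine ext_inner_right ℂ fun y => ?_
    simp only [mul_apply_eq_comp]
    have h1 := hL (T x) y
    have h2 := hL x (adjoint T y)
    simp only [adjoint_inner_right] at h2
    refine tendsto_nhds_unique (h2.congr fun i => ?_) h1
    have := congrArg (fun Z : R.H →L[ℂ] R.H => Z x) (hT (c i))
    simp only [mul_apply_eq_comp] at this
    rw [this])
  have key : ∀ P : R.H →L[ℂ] R.H, 0 ≤ P ↔ ∀ x, 0 ≤ inner ℂ (P x) x := by
    intro P
    rw [nonneg_iff_isPositive, isPositive_iff_complex]
    refine forall_congr' fun x => ?_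
    rw [Complex.nonneg_iff]
    constructor
    · rintro ⟨h1, h2⟩
      refine ⟨h2, ?_⟩
      rw [← h1]; simp
    · rintro ⟨h1, h2⟩
      refine ⟨Complex.ext (by simp) (by simpa using h2), h1⟩
  refine ⟨a, ⟨?_, ?_⟩, hL⟩
  · rintro _ ⟨i, rfl⟩
    rw [R.isPos_iff, key]
    intro x
    rw [map_sub, sub_apply, inner_sub_left]
    refine ge_of_tendsto ((hL x x).sub_const _) ?_
    filter_upwards [eventually_ge_atTop i] with j hj
    have := (key _).1 (R.isPos_iff.1 (hc i j hj)) x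
    rwa [map_sub, sub_apply, inner_sub_left] at this
  · intro d hd
    rw [R.isPos_iff, key]
    intro x
    rw [map_sub, sub_apply, inner_sub_left]
    refine ge_of_tendsto ((hL x x).const_sub _) (Eventually.of_forall fun i => ?_)
    have := (key _).1 (R.isPos_iff.1 (hd _ ⟨i, rfl⟩)) x
    rwa [map_sub, sub_apply, inner_sub_left] at this

theorem nonneg_iff_inner (R : VNRep A) {a : A} : IsPos a ↔ ∀ x, 0 ≤ inner ℂ x (R.π a x) := by
  rw [R.isPos_iff, nonneg_iff_isPositive, isPositive_iff_complex]
  refine forall_congr' fun x => ?_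
  have hz : inner ℂ x (R.π a x) = (starRingEnd ℂ) (inner ℂ (R.π a x) x) :=
    (inner_conj_symm _ _).symm
  rw [hz, Complex.nonneg_iff]
  generalize inner ℂ (R.π a x) x = z
  constructor
  · rintro ⟨h1, h2⟩
    refine ⟨by simpa using h2, ?_⟩
    rw [← h1]; simp
  · rintro ⟨h1, h2⟩
    have h3 : z.im = 0 := by simpa using h2
    refine ⟨Complex.ext (by simp) (by simp [h3]), by simpa using h1⟩

/-- The vector functional of a vector. -/
noncomputable def vec (R : VNRep A) (x : R.H) : A →ₗ[ℂ] ℂ where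
  toFun a := inner ℂ x (R.π a x)
  map_add' a b := by simp
  map_smul' c a := by simp

theorem vec_normal (R : VNRep A) (x : R.H) : IsNormalFunctional (R.vec x) where
  pos a ha := isPos_complex.2 (R.nonneg_iff_inner.1 ha x)
  sups := by
    rintro S ⟨s0, hs0⟩ hdir hpos a ha
    let _ : Preorder S :=
      { le := fun s t => IsPos ((t : A) - s)
        le_refl := fun s => ⟨0, by simp⟩
        le_trans := fun s t u h1 h2 => R.isPos_sub_iff.2
          ((R.isPos_sub_iff.1 h1).trans (R.isPos_sub_iff.1 h2)) }
    have : IsDirectedOrder S := ⟨fun s t => by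
      obtain ⟨u, hu, h1, h2⟩ := hdir s s.2 t t.2
      exact ⟨⟨u, hu⟩, h1, h2⟩⟩
    have : Nonempty S := ⟨⟨s0, hs0⟩⟩
    obtain ⟨a', ha', hl⟩ := R.net_lim (fun s : S => (s : A)) (fun i j h => h)
      (fun i => hpos i i.2) a (fun i => ha.1 i i.2)
    rw [Subtype.range_coe] at ha'
    have : a' = a := by
      apply R.inj
      exact le_antisymm (R.isPos_sub_iff.1 (ha'.2 a ha.1)) (R.isPos_sub_iff.1 (ha.2 a' ha'.1))
    subst this
    refine ⟨?_, ?_⟩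
    · rintro _ ⟨s, hs, rfl⟩
      rw [← map_sub]
      exact isPos_complex.2 (R.nonneg_iff_inner.1 (ha.1 s hs) x)
    · intro b hb
      rw [isPos_complex, sub_nonneg]
      have h1 : Tendsto (fun s : S => R.vec x s) atTop (𝓝 (R.vec x a')) := by
        have := (Complex.continuous_conj.tendsto _).comp (hl x x)
        rw [inner_conj_symm] at this
        exact this.congr fun s => inner_conj_symm _ _
      refine le_of_tendsto h1 (Eventually.of_forall fun s => ?_)
      have := isPos_complex.1 (hb _ ⟨s, s.2, rfl⟩)
      rwa [sub_nonneg] at this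

end VNRep

namespace IsWStarAlgebra

theorem isPos_of_normal (hA : IsWStarAlgebra A) {a : A} (h : ∀ ω : A →ₗ[ℂ] ℂ, IsNormalFunctional ω → 0 ≤ ω a) :
    IsPos a := by
  obtain ⟨R⟩ := hA.rep
  exact R.nonneg_iff_inner.2 fun x => h _ (R.vec_normal x)

theorem isPos_add (hA : IsWStarAlgebra A) {a b : A} (ha : IsPos a) (hb : IsPos b) : IsPos (a + b) := by
  obtain ⟨R⟩ := hA.rep
  rw [R.isPos_iff] at *
  rw [map_add]; exact add_nonneg ha hb

theorem eq_zero_of_isPos_neg (hA : IsWStarAlgebra A) {a : A} (ha : IsPos a) (hb : IsPos (-a)) : a = 0 := by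
  obtain ⟨R⟩ := hA.rep
  rw [R.isPos_iff] at *
  rw [map_neg, neg_nonneg] at hb
  apply R.inj
  rw [map_zero]; exact le_antisymm hb ha

theorem eq_zero_of_star_mul_self (hA : IsWStarAlgebra A) {a : A} (ha : star a * a = 0) : a = 0 := by
  obtain ⟨R⟩ := hA.rep
  apply R.inj
  rw [map_zero, ← CStarRing.star_mul_self_eq_zero_iff, ← map_star, ← map_mul, ha, map_zero]

theorem exists_sup (hA : IsWStarAlgebra A) {ι : Type*} [Preorder ι] [IsDirectedOrder ι] [Nonempty ι] (c : ι → A)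
    (hc : ∀ i j, i ≤ j → IsPos (c j - c i)) (h0 : ∀ i, IsPos (c i)) (b : A)
    (hb : ∀ i, IsPos (b - c i)) : ∃ a, IsSup (Set.range c) a := by
  obtain ⟨R⟩ := hA.rep
  obtain ⟨a, ha, -⟩ := R.net_lim c hc h0 b hb
  exact ⟨a, ha⟩

theorem exists_bound (hA : IsWStarAlgebra A) {a : A} (ha : star a = a) : ∃ r : ℝ, 0 ≤ r ∧ IsPos ((r : ℂ) • 1 - a) := by
  obtain ⟨R⟩ := hA.rep
  refine ⟨‖R.π a‖, norm_nonneg _, ?_⟩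
  rw [R.isPos_sub_iff]
  have hs : IsSelfAdjoint (R.π a) := by
    rw [isSelfAdjoint_iff, ← map_star, ha]
  refine hs.le_algebraMap_norm_self.trans (le_of_eq ?_)
  rw [map_smul, map_one, Algebra.algebraMap_eq_smul_one]
  rfl

theorem exists_neg_part (hA : IsWStarAlgebra A) {a : A} (ha : star a = a) :
    ∃ n t : A, star n = n ∧ star t = t ∧ n * a * n + t * t = 0 ∧ (t = 0 → IsPos a) := by
  obtain ⟨R⟩ := hA.rep
  have hs : IsSelfAdjoint (R.π a) := by
    rw [isSelfAdjoint_iff, ← map_star, ha]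
  set m := (R.π a)⁻ with hm
  have hm0 : 0 ≤ m := CFC.negPart_nonneg _
  have hms : IsSelfAdjoint m := .of_nonneg hm0
  have hcomm : ∀ T : R.H →L[ℂ] R.H, (∀ b, T * R.π b = R.π b * T) → Commute m T := by
    intro T hT
    have h1 : Commute (R.π a) T := (hT a).symm
    exact h1.cfcₙ_real _
  obtain ⟨n, hn⟩ := R.bicomm m fun T hT => (hcomm T hT).eq.symm
  have hm3 : 0 ≤ m * m * m := by
    have := hms.conjugate_nonneg hm0
    simpa using this
  obtain ⟨t, ht⟩ := R.bicomm (CFC.sqrt (m * m * m)) fun T hT => by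
    have h1 : Commute m T := hcomm T hT
    have h2 : Commute (m * m * m) T := (h1.mul_left h1).mul_left h1
    exact (h2.cfcₙ_nnreal NNReal.sqrt).symm
  have hma : m * R.π a * m = - (m * m * m) := by
    have h1 : R.π a = (R.π a)⁺ - m := (CFC.posPart_sub_negPart _ hs).symm
    have h2 : m * (R.π a)⁺ = 0 := CFC.negPart_mul_posPart _
    rw [h1, mul_sub, h2, zero_sub, neg_mul]
  refine ⟨n, t, R.inj ?_, R.inj ?_, R.inj ?_, ?_⟩
  · rw [map_star, hn, hms.star_eq]
  · rw [map_star, ht, (IsSelfAdjoint.of_nonneg (CFC.sqrt_nonneg _)).star_eq]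
  · rw [map_add, map_mul, map_mul, map_mul, hn, ht, CFC.sqrt_mul_sqrt_self _ hm3, hma, map_zero,
      neg_add_cancel]
  · rintro rfl
    rw [map_zero] at ht
    have h3 : m * m * m = 0 := by
      rw [← CFC.sqrt_mul_sqrt_self _ hm3, ← ht, mul_zero]
    have h4 : m * m = 0 := by
      rw [← CStarRing.star_mul_self_eq_zero_iff, star_mul, hms.star_eq]
      rw [← mul_assoc, h3, zero_mul]
    have h5 : m = 0 := by
      rw [← CStarRing.star_mul_self_eq_zero_iff, hms.star_eq, h4]
    rw [R.isPos_iff, ← CFC.posPart_sub_negPart _ hs, ← hm, h5, sub_zero]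
    exact CFC.posPart_nonneg _

end IsWStarAlgebra

theorem IsNormalFunctional.tendsto {ω : A →ₗ[ℂ] ℂ} (hω : IsNormalFunctional ω)
    {ι : Type*} [Preorder ι] [IsDirectedOrder ι] [Nonempty ι] {c : ι → A}
    (hc : ∀ i j, i ≤ j → IsPos (c j - c i)) (h0 : ∀ i, IsPos (c i)) {a : A}
    (ha : IsSup (Set.range c) a) : Tendsto (fun i => ω (c i)) atTop (𝓝 (ω a)) := by
  have h := hω.sups (Set.range c) (Set.range_nonempty c)
    (by
      rintro _ ⟨i, rfl⟩ _ ⟨j, rfl⟩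
      obtain ⟨k, hi, hj⟩ := exists_ge_ge i j
      exact ⟨c k, ⟨k, rfl⟩, hc _ _ hi, hc _ _ hj⟩)
    (by rintro _ ⟨i, rfl⟩; exact h0 i) a ha
  have hp : ∀ i, ((ω (c i)).re : ℂ) = ω (c i) := fun i => by
    have := Complex.nonneg_iff.1 (isPos_complex.1 (hω.pos _ (h0 i)))
    exact Complex.ext (by simp) (by simpa using this.2)
  have hd : ∀ i, 0 ≤ ω a - ω (c i) := fun i =>
    isPos_complex.1 (h.1 _ ⟨c i, ⟨i, rfl⟩, rfl⟩)
  have hpa : ((ω a).re : ℂ) = ω a := by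
    obtain ⟨i⟩ := ‹Nonempty ι›
    have h1 := (Complex.nonneg_iff.1 (hd i)).2
    have h2 := (Complex.nonneg_iff.1 (isPos_complex.1 (hω.pos _ (h0 i)))).2
    rw [Complex.sub_im] at h1
    exact Complex.ext (by simp) (by simp; linarith)
  have hl : IsLUB (Set.range fun i => (ω (c i)).re) (ω a).re := by
    constructor
    · rintro _ ⟨i, rfl⟩
      have h1 := (Complex.nonneg_iff.1 (hd i)).1
      rw [Complex.sub_re] at h1
      simpa using h1
    · intro b hb
      have := isPos_complex.1 (h.2 (b : ℂ) (by
        rintro _ ⟨_, ⟨i, rfl⟩, rfl⟩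
        rw [isPos_complex, ← hp i, sub_nonneg]
        exact_mod_cast hb ⟨i, rfl⟩))
      rw [← hpa, sub_nonneg] at this
      exact_mod_cast this
  have hmono : Monotone fun i => (ω (c i)).re := by
    intro i j hij
    have := Complex.nonneg_iff.1 (isPos_complex.1 (hω.pos _ (hc i j hij)))
    rw [map_sub, Complex.sub_re] at this
    simpa using this.1
  have := (Complex.continuous_ofReal.tendsto _).comp (tendsto_atTop_isLUB hmono hl)
  rw [← hpa]
  exact this.congr hp

theorem IsWStarAlgebra.isSup_conj (hA : IsWStarAlgebra A)
    {ι : Type*} [Preorder ι] [IsDirectedOrder ι] [Nonempty ι] {c : ι → A}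
    (hc : ∀ i j, i ≤ j → IsPos (c j - c i)) (h0 : ∀ i, IsPos (c i)) {a : A}
    (ha : IsSup (Set.range c) a) (w : A) :
    IsSup (Set.range fun i => star w * c i * w) (star w * a * w) := by
  obtain ⟨R⟩ := hA.rep
  have hv : ∀ x b, R.vec x (star w * b * w) = R.vec (R.π w x) b := by
    intro x b
    simp only [VNRep.vec, LinearMap.coe_mk, AddHom.coe_mk, map_mul, map_star, mul_apply_eq_comp,
      star_eq_adjoint, adjoint_inner_right]
  refine ⟨?_, ?_⟩
  · rintro _ ⟨i, rfl⟩
    obtain ⟨b, hb⟩ := ha.1 _ ⟨i, rfl⟩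
    refine ⟨b * w, ?_⟩
    have e : star (b * w) * (b * w) = star w * (star b * b) * w := by
      rw [star_mul]; noncomm_ring
    rw [e, ← hb, mul_sub, sub_mul]
  · intro u hu
    rw [R.nonneg_iff_inner]
    intro x
    change 0 ≤ R.vec x (u - star w * a * w)
    rw [map_sub, hv]
    refine ge_of_tendsto (((R.vec_normal (R.π w x)).tendsto hc h0 ha).const_sub _)
      (Eventually.of_forall fun i => ?_)
    rw [← hv, ← map_sub]
    exact R.nonneg_iff_inner.1 (hu _ ⟨i, rfl⟩) x

end Abstract
end Algebra

section StarCat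

/-- The dagger of a *-category: an antilinear involution `Hom(X, Y) → Hom(Y, X)` on the morphisms
of a `ℂ`-linear category, which reverses compositions. Compositions are written in diagrammatic
order, so that `f ≫ f†` is the endomorphism `f* f` of the source of `f`. -/
class StarCategory (C : Type u) [Category.{v} C] [Preadditive C] [Linear ℂ C] where
  dag : ∀ {X Y : C}, (X ⟶ Y) → (Y ⟶ X)
  dag_dag : ∀ {X Y : C} (f : X ⟶ Y), dag (dag f) = f
  dag_comp : ∀ {X Y Z : C} (f : X ⟶ Y) (g : Y ⟶ Z), dag (f ≫ g) = dag g ≫ dag f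
  dag_add : ∀ {X Y : C} (f g : X ⟶ Y), dag (f + g) = dag f + dag g
  dag_smul : ∀ {X Y : C} (c : ℂ) (f : X ⟶ Y), dag (c • f) = (starRingEnd ℂ) c • dag f

postfix:max "†" => StarCategory.dag

attribute [simp] StarCategory.dag_dag StarCategory.dag_comp StarCategory.dag_add
  StarCategory.dag_smul

variable {C : Type u} [Category.{v} C] [Preadditive C] [Linear ℂ C] [StarCategory C]

@[simp] theorem dag_zero {X Y : C} : (0 : X ⟶ Y)† = 0 := by
  have := StarCategory.dag_add (0 : X ⟶ Y) 0
  simpa using this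

@[simp] theorem dag_id (X : C) : (𝟙 X)† = 𝟙 X := by
  have := StarCategory.dag_comp (𝟙 X) ((𝟙 X)†)
  simpa using this.symm

@[simp] theorem dag_neg {X Y : C} (f : X ⟶ Y) : (-f)† = -f† := by
  rw [eq_neg_iff_add_eq_zero, ← StarCategory.dag_add]; simp

@[simp] theorem dag_sub {X Y : C} (f g : X ⟶ Y) : (f - g)† = f† - g† := by
  rw [sub_eq_add_neg, StarCategory.dag_add, dag_neg, sub_eq_add_neg]

theorem dag_sum {X Y : C} {ι : Type*} (s : Finset ι) (f : ι → (X ⟶ Y)) :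
    (∑ i ∈ s, f i)† = ∑ i ∈ s, (f i)† := by
  classical
  induction s using Finset.induction_on with
  | empty => simp
  | insert a s ha ih => rw [Finset.sum_insert ha, Finset.sum_insert ha, StarCategory.dag_add, ih]

instance (X : C) : StarRing (End X) where
  star f := StarCategory.dag f
  star_involutive f := StarCategory.dag_dag f
  star_mul f g := StarCategory.dag_comp g f
  star_add f g := StarCategory.dag_add f g

instance (X : C) : StarModule ℂ (End X) where
  star_smul c f := StarCategory.dag_smul c f

theorem star_end {X : C} (f : End X) : star f = StarCategory.dag f := rfl

/-- An endomorphism is positive if it is positive in the endomorphism algebra. -/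
def Pos {X : C} (a : X ⟶ X) : Prop := IsPos (A := End X) a

theorem pos_iff {X : C} {a : X ⟶ X} : Pos a ↔ ∃ b : X ⟶ X, a = b ≫ b† := Iff.rfl

/-- The norm of the morphism `f` is at most `r`, that is `f* f ≤ r²` (and `0 ≤ r`). -/
def NormLE {X Y : C} (f : X ⟶ Y) (r : ℝ) : Prop :=
  0 ≤ r ∧ Pos (((r ^ 2 : ℝ) : ℂ) • 𝟙 X - f ≫ f†)

theorem Pos.dag_eq {X : C} {a : X ⟶ X} (h : Pos a) : a† = a := by
  obtain ⟨b, rfl⟩ := pos_iff.1 h; simp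

theorem Pos.smul {X : C} {a : X ⟶ X} (h : Pos a) {r : ℝ} (hr : 0 ≤ r) : Pos ((r : ℂ) • a) := by
  obtain ⟨b, rfl⟩ := pos_iff.1 h
  refine pos_iff.2 ⟨((Real.sqrt r : ℝ) : ℂ) • b, ?_⟩
  rw [StarCategory.dag_smul, Linear.smul_comp, Linear.comp_smul, smul_smul, Complex.conj_ofReal,
    ← Complex.ofReal_mul, Real.mul_self_sqrt hr]

theorem pos_one (X : C) : Pos (𝟙 X) := pos_iff.2 ⟨𝟙 X, by simp⟩

theorem pos_zero (X : C) : Pos (0 : X ⟶ X) := pos_iff.2 ⟨0, by simp⟩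

theorem NormLE.smul {X Y : C} {f : X ⟶ Y} {r : ℝ} (hf : NormLE f r) (c : ℂ) :
    NormLE (c • f) (‖c‖ * r) := by
  refine ⟨mul_nonneg (norm_nonneg _) hf.1, ?_⟩
  convert hf.2.smul (sq_nonneg ‖c‖) using 1
  simp only [Linear.smul_comp, Linear.comp_smul, StarCategory.dag_smul, smul_sub, smul_smul]
  congr 2
  · push_cast; ring
  · rw [mul_comm, Complex.mul_conj, Complex.normSq_eq_norm_sq]

/-- Auxiliary: a star category in which all endomorphism algebras are W*-algebras and any two
objects have an orthogonal sum. -/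
class IsWStarAdditive (M : Type u) [Category.{v} M] [Preadditive M] [Linear ℂ M]
    [StarCategory M] : Prop where
  wstar : ∀ X : M, IsWStarAlgebra (End X)
  sum : ∀ X Y : M, ∃ (Z : M) (i : X ⟶ Z) (j : Y ⟶ Z),
    i ≫ i† = 𝟙 X ∧ j ≫ j† = 𝟙 Y ∧ i ≫ j† = 0 ∧ i† ≫ i + j† ≫ j = 𝟙 Z

section Additive
variable {M : Type u} [Category.{v} M] [Preadditive M] [Linear ℂ M] [StarCategory M]
  [IsWStarAdditive M]

theorem Pos.add {X : M} {a b : X ⟶ X} (ha : Pos a) (hb : Pos b) : Pos (a + b) :=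
  (IsWStarAdditive.wstar X).isPos_add ha hb

theorem Pos.eq_zero {X : M} {a : X ⟶ X} (ha : Pos a) (hb : Pos (-a)) : a = 0 :=
  (IsWStarAdditive.wstar X).eq_zero_of_isPos_neg ha hb

theorem eq_zero_of_comp_dag_end {X : M} {a : X ⟶ X} (ha : a ≫ a† = 0) : a = 0 :=
  (IsWStarAdditive.wstar X).eq_zero_of_star_mul_self ha

theorem eq_zero_of_comp_dag {X Y : M} {f : X ⟶ Y} (hf : f ≫ f† = 0) : f = 0 := by
  obtain ⟨Z, i, j, hi, hj, hij, -⟩ := IsWStarAdditive.sum X Y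
  have h : i† ≫ f ≫ j = 0 := by
    apply eq_zero_of_comp_dag_end
    have : (i† ≫ f ≫ j) ≫ (i† ≫ f ≫ j)† = i† ≫ f ≫ (j ≫ j†) ≫ f† ≫ i := by simp
    rw [this, hj, Category.id_comp, reassoc_of% hf]; simp
  have h2 : i ≫ (i† ≫ f ≫ j) ≫ j† = f := by
    have : i ≫ (i† ≫ f ≫ j) ≫ j† = (i ≫ i†) ≫ f ≫ (j ≫ j†) := by simp
    rw [this, hi, hj]; simp
  rw [← h2, h]; simp

theorem pos_sum {X : M} {ι : Type*} (s : Finset ι) (a : ι → (X ⟶ X)) (h : ∀ i ∈ s, Pos (a i)) :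
    Pos (∑ i ∈ s, a i) := by
  classical
  induction s using Finset.induction_on with
  | empty => simpa using pos_zero X
  | insert i s hi ih =>
    rw [Finset.sum_insert hi]
    exact (h i (by simp)).add (ih fun j hj => h j (by simp [hj]))

/-- `f*f` is positive for every morphism `f`. -/
theorem pos_comp_dag {X Y : M} (k : X ⟶ Y) : Pos (k ≫ k†) := by
  have hs : star (show End X from k ≫ k†) = k ≫ k† := by rw [star_end]; simp
  obtain ⟨n, t, hn, ht, h1, h2⟩ := (IsWStarAdditive.wstar X).exists_neg_part hs
  apply h2
  obtain ⟨Z, i, j, hi, hj, hij, -⟩ := IsWStarAdditive.sum X Y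
  have hn' : (n : X ⟶ X)† = n := hn
  have ht' : (t : X ⟶ X)† = t := ht
  have h1' : (n : X ⟶ X) ≫ (k ≫ k†) ≫ (n : X ⟶ X) + (t : X ⟶ X) ≫ t = 0 := h1
  have e1 : Pos (i† ≫ (n : X ⟶ X) ≫ k ≫ k† ≫ (n : X ⟶ X) ≫ i) := by
    refine pos_iff.2 ⟨i† ≫ (n : X ⟶ X) ≫ k ≫ j, ?_⟩
    have : (i† ≫ (n : X ⟶ X) ≫ k ≫ j) ≫ (i† ≫ (n : X ⟶ X) ≫ k ≫ j)† =
      i† ≫ (n : X ⟶ X) ≫ k ≫ (j ≫ j†) ≫ k† ≫ (n : X ⟶ X)† ≫ i := by simp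
    rw [this, hj, Category.id_comp, hn']
  have e2 : i† ≫ (t : X ⟶ X) ≫ (t : X ⟶ X) ≫ i =
      (i† ≫ (t : X ⟶ X) ≫ i) ≫ (i† ≫ (t : X ⟶ X) ≫ i)† := by
    have : (i† ≫ (t : X ⟶ X) ≫ i) ≫ (i† ≫ (t : X ⟶ X) ≫ i)† =
      i† ≫ (t : X ⟶ X) ≫ (i ≫ i†) ≫ (t : X ⟶ X)† ≫ i := by simp
    rw [this, hi, Category.id_comp, ht']
  have e3 : i† ≫ (n : X ⟶ X) ≫ k ≫ k† ≫ (n : X ⟶ X) ≫ i =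
      -(i† ≫ (t : X ⟶ X) ≫ (t : X ⟶ X) ≫ i) := by
    rw [eq_neg_iff_add_eq_zero]
    have : i† ≫ ((n : X ⟶ X) ≫ (k ≫ k†) ≫ (n : X ⟶ X) + (t : X ⟶ X) ≫ t) ≫ i = 0 := by
      rw [h1']; simp
    simpa using this
  have e4 : i† ≫ (t : X ⟶ X) ≫ (t : X ⟶ X) ≫ i = 0 := by
    refine Pos.eq_zero ?_ (e3 ▸ e1)
    exact pos_iff.2 ⟨_, e2⟩
  rw [e2] at e4
  have e5 := eq_zero_of_comp_dag_end e4
  have e6 : i ≫ (i† ≫ (t : X ⟶ X) ≫ i) ≫ i† = t := by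
    have : i ≫ (i† ≫ (t : X ⟶ X) ≫ i) ≫ i† = (i ≫ i†) ≫ (t : X ⟶ X) ≫ (i ≫ i†) := by simp
    rw [this, hi]; simp
  rw [← e6, e5]; simp

theorem Pos.conj {X Y : M} {a : Y ⟶ Y} (ha : Pos a) (k : X ⟶ Y) : Pos (k ≫ a ≫ k†) := by
  obtain ⟨b, rfl⟩ := pos_iff.1 ha
  simpa using pos_comp_dag (k ≫ b)

theorem exists_normLE {X Y : M} (f : X ⟶ Y) : ∃ r, NormLE f r := by
  obtain ⟨r, hr, h⟩ := (IsWStarAdditive.wstar X).exists_bound (a := f ≫ f†)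
    (by rw [star_end]; simp)
  refine ⟨Real.sqrt r, Real.sqrt_nonneg _, ?_⟩
  rw [Real.sq_sqrt hr]
  exact h

theorem NormLE.comp {X Y Z : M} {f : X ⟶ Y} {g : Y ⟶ Z} {r s : ℝ} (hf : NormLE f r)
    (hg : NormLE g s) : NormLE (f ≫ g) (r * s) := by
  refine ⟨mul_nonneg hf.1 hg.1, ?_⟩
  have h1 := hg.2.conj f
  have h2 := hf.2.smul (sq_nonneg s)
  have := h1.add h2
  convert this using 1
  simp only [Preadditive.comp_sub, Preadditive.sub_comp, Linear.comp_smul, Linear.smul_comp,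
    smul_sub, smul_smul, Category.id_comp, Category.assoc, StarCategory.dag_comp]
  rw [mul_pow, mul_comm, Complex.ofReal_mul]
  abel

theorem NormLE.dag {X Y : M} {f : X ⟶ Y} {r : ℝ} (hf : NormLE f r) : NormLE f† r := by
  refine ⟨hf.1, ?_⟩
  rcases hf.1.eq_or_lt with h | h
  · have h0 : f = 0 := by
      apply eq_zero_of_comp_dag
      apply (pos_comp_dag f).eq_zero
      have := hf.2
      rw [← h] at this
      simpa using this
    subst h0
    simpa using (pos_one Y).smul (sq_nonneg r)
  · have h1 := hf.2.conj (f†)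
    set a := ((r ^ 2 : ℝ) : ℂ) • 𝟙 Y - f† ≫ (f†)† with ha
    have has : a† = a := by simp [ha]
    have h2 : Pos (a ≫ a) := by
      have := pos_comp_dag a
      rwa [has] at this
    have h3 := (h2.add h1).smul (r := (r ^ 2)⁻¹) (by positivity)
    have hr : ((r ^ 2 : ℝ) : ℂ) ≠ 0 := by
      exact_mod_cast (by positivity : r ^ 2 ≠ 0)
    convert h3 using 1
    rw [Complex.ofReal_inv, eq_inv_smul_iff₀ hr, ha]
    simp only [Preadditive.comp_sub, Preadditive.sub_comp, Linear.comp_smul, Linear.smul_comp,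
      smul_sub, smul_smul, Category.comp_id, Category.id_comp, Category.assoc,
      StarCategory.dag_dag]
    abel

theorem NormLE.mono {X Y : M} {f : X ⟶ Y} {r s : ℝ} (hf : NormLE f r) (h : r ≤ s) :
    NormLE f s := by
  refine ⟨hf.1.trans h, ?_⟩
  have : 0 ≤ s ^ 2 - r ^ 2 := by nlinarith [hf.1]
  convert hf.2.add ((pos_one X).smul this) using 1
  rw [Complex.ofReal_sub, sub_smul]
  abel

theorem NormLE.add {X Y : M} {f g : X ⟶ Y} {r s : ℝ} (hf : NormLE f r) (hg : NormLE g s) :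
    NormLE (f + g) (2 * (r + s)) := by
  have hr := hf.1
  have hs := hg.1
  refine ⟨by positivity, ?_⟩
  have h1 := (hf.2.smul zero_le_two).add (hg.2.smul zero_le_two)
  have h2 := h1.add (pos_comp_dag (f - g))
  have h3 : 0 ≤ (2 * (r + s)) ^ 2 - (2 * r ^ 2 + 2 * s ^ 2) := by nlinarith [mul_nonneg hr hs]
  have h4 := h2.add ((pos_one X).smul h3)
  convert h4 using 1
  simp only [Preadditive.comp_sub, Preadditive.sub_comp, Preadditive.comp_add, Preadditive.add_comp,
    smul_sub, smul_smul, StarCategory.dag_add, dag_sub]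
  push_cast
  module

theorem isSup_conj {X Z : M} {ι : Type*} [Preorder ι] [IsDirectedOrder ι] [Nonempty ι]
    {c : ι → (Z ⟶ Z)} (hc : ∀ i j, i ≤ j → Pos (c j - c i)) (h0 : ∀ i, Pos (c i)) {a : Z ⟶ Z}
    (ha : IsSup (A := End Z) (Set.range c) a) (v : X ⟶ Z) :
    IsSup (A := End X) (Set.range fun i => v ≫ c i ≫ v†) (v ≫ a ≫ v†) := by
  obtain ⟨N, p, q, hp, hq, hpq, hsum⟩ := IsWStarAdditive.sum X Z
  have hqp : q ≫ p† = 0 := by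
    have := congrArg StarCategory.dag hpq
    simpa using this
  have hd : ∀ i j, i ≤ j → Pos (q† ≫ c j ≫ q - q† ≫ c i ≫ q) := by
    intro i j hij
    have := (hc i j hij).conj (q†)
    simpa using this
  have hd0 : ∀ i, Pos (q† ≫ c i ≫ q) := fun i => by simpa using (h0 i).conj (q†)
  have hub : ∀ i, Pos (q† ≫ a ≫ q - q† ≫ c i ≫ q) := fun i => by
    have : Pos (a - c i) := ha.1 _ ⟨i, rfl⟩
    simpa using this.conj (q†)
  obtain ⟨d, hdS⟩ : ∃ d : N ⟶ N, IsSup (A := End N) (Set.range fun i => q† ≫ c i ≫ q) d :=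
    (IsWStarAdditive.wstar N).exists_sup (fun i => q† ≫ c i ≫ q) hd hd0 _ hub
  have h1 : Pos (q† ≫ a ≫ q - d) := hdS.2 (q† ≫ a ≫ q) (by rintro _ ⟨i, rfl⟩; exact hub i)
  -- the `Z`-corner of `d` is `a`
  have h2 : Pos (q ≫ d ≫ q† - a) := ha.2 (q ≫ d ≫ q†) (by
    rintro _ ⟨i, rfl⟩
    have : Pos (d - q† ≫ c i ≫ q) := hdS.1 _ ⟨i, rfl⟩
    have := this.conj q
    have e : q ≫ (d - q† ≫ c i ≫ q) ≫ q† = q ≫ d ≫ q† - (q ≫ q†) ≫ c i ≫ (q ≫ q†) := by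
      simp
    rw [e, hq, Category.id_comp, Category.comp_id] at this
    exact this)
  have h3 : q ≫ (q† ≫ a ≫ q - d) ≫ q† = -(q ≫ d ≫ q† - a) := by
    have e : q ≫ (q† ≫ a ≫ q - d) ≫ q† = (q ≫ q†) ≫ a ≫ (q ≫ q†) - q ≫ d ≫ q† := by simp
    rw [e, hq, Category.id_comp, Category.comp_id, neg_sub]
  have h4 : q ≫ (q† ≫ a ≫ q - d) ≫ q† = 0 := by
    refine (h1.conj q).eq_zero ?_
    rw [h3, neg_neg]; exact h2
  have h5 : p ≫ (q† ≫ a ≫ q - d) ≫ p† = 0 := by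
    refine (h1.conj p).eq_zero ?_
    obtain ⟨i⟩ := ‹Nonempty ι›
    have e1 : Pos (d - q† ≫ c i ≫ q) := hdS.1 _ ⟨i, rfl⟩
    have e2 := e1.conj p
    have e3 : p ≫ (d - q† ≫ c i ≫ q) ≫ p† = p ≫ d ≫ p† := by
      simp [reassoc_of% hpq]
    have e4 : p ≫ (q† ≫ a ≫ q - d) ≫ p† = -(p ≫ d ≫ p†) := by
      simp [reassoc_of% hpq]
    rw [e4, neg_neg, ← e3]; exact e2
  have h6 : d = q† ≫ a ≫ q := by
    obtain ⟨t, ht⟩ := pos_iff.1 h1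
    rw [ht] at h4 h5
    have hqt : q ≫ t = 0 := eq_zero_of_comp_dag (by simpa using h4)
    have hpt : p ≫ t = 0 := eq_zero_of_comp_dag (by simpa using h5)
    have : t = 0 := by
      rw [← Category.id_comp t, ← hsum]
      simp [hqt, hpt]
    rw [this] at ht
    simp only [Limits.zero_comp] at ht
    exact (sub_eq_zero.1 ht).symm
  subst h6
  have h7 := (IsWStarAdditive.wstar N).isSup_conj hd hd0 hdS (show End N from p† ≫ v ≫ q)
  have e : ∀ b : Z ⟶ Z, (p† ≫ v ≫ q) ≫ (q† ≫ b ≫ q) ≫ (p† ≫ v ≫ q)† =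
      p† ≫ (v ≫ b ≫ v†) ≫ p := by
    intro b
    have : (p† ≫ v ≫ q) ≫ (q† ≫ b ≫ q) ≫ (p† ≫ v ≫ q)† =
      p† ≫ v ≫ (q ≫ q†) ≫ b ≫ (q ≫ q†) ≫ v† ≫ p := by simp
    rw [this, hq]; simp
  have h8 : IsSup (A := End N) (Set.range fun i => p† ≫ (v ≫ c i ≫ v†) ≫ p)
      (p† ≫ (v ≫ a ≫ v†) ≫ p) := by
    have h9 : IsSup (A := End N)
        (Set.range fun i => (p† ≫ v ≫ q) ≫ (q† ≫ c i ≫ q) ≫ (p† ≫ v ≫ q)†)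
        ((p† ≫ v ≫ q) ≫ (q† ≫ a ≫ q) ≫ (p† ≫ v ≫ q)†) := by
      simpa only [star_end, End.mul_def, Category.assoc] using h7
    simpa only [e] using h9
  have e2 : ∀ b : X ⟶ X, p ≫ (p† ≫ b ≫ p) ≫ p† = b := by
    intro b
    have : p ≫ (p† ≫ b ≫ p) ≫ p† = (p ≫ p†) ≫ b ≫ (p ≫ p†) := by simp
    rw [this, hp]; simp
  refine ⟨?_, ?_⟩
  · rintro _ ⟨i, rfl⟩
    have : Pos (a - c i) := ha.1 _ ⟨i, rfl⟩
    have := this.conj v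
    rw [Preadditive.sub_comp, Preadditive.comp_sub] at this
    exact this
  · intro (u : X ⟶ X) hu
    have h9 : Pos (p† ≫ u ≫ p - p† ≫ (v ≫ a ≫ v†) ≫ p) := h8.2 (p† ≫ u ≫ p) (by
      rintro _ ⟨i, rfl⟩
      have : Pos (u - v ≫ c i ≫ v†) := hu _ ⟨i, rfl⟩
      have := this.conj (p†)
      change Pos _
      simpa using this)
    have h10 := h9.conj p
    rw [Preadditive.sub_comp, Preadditive.comp_sub, e2, e2] at h10
    exact h10

end Additive

/-- The sum of a family of morphisms converges ultraweakly (unconditionally) to `h`: it does so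
after composition with arbitrary morphisms to obtain endomorphisms, and evaluation of an arbitrary
normal functional. -/
def HasUWSum {C : Type u} [Category.{v} C] [Preadditive C] [Linear ℂ C] [StarCategory C]
    {X Y : C} {ι : Type*} (a : ι → (X ⟶ Y)) (h : X ⟶ Y) : Prop :=
  ∀ (W : C) (u : W ⟶ X) (w : Y ⟶ W) (ω : End W →ₗ[ℂ] ℂ), IsNormalFunctional ω →
    HasSum (fun i => ω (u ≫ a i ≫ w)) (ω (u ≫ h ≫ w))

section Functional
variable {W : C} (ω : End W →ₗ[ℂ] ℂ)
theorem fun_add (a b : W ⟶ W) : ω (a + b) = ω a + ω b := map_add ω _ _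
theorem fun_sub (a b : W ⟶ W) : ω (a - b) = ω a - ω b := map_sub ω _ _
theorem fun_smul (c : ℂ) (a : W ⟶ W) : ω (c • a) = c * ω a := map_smul ω _ _
theorem fun_zero : ω (0 : W ⟶ W) = 0 := map_zero ω
theorem fun_sum {ι : Type*} (s : Finset ι) (a : ι → (W ⟶ W)) :
    ω (∑ i ∈ s, a i) = ∑ i ∈ s, ω (a i) := map_sum ω _ _
end Functional

namespace HasUWSum
variable {ι : Type*} {X Y Z : C}

theorem comp_right {a : ι → (X ⟶ Y)} {h : X ⟶ Y} (H : HasUWSum a h) (g : Y ⟶ Z) :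
    HasUWSum (fun i => a i ≫ g) (h ≫ g) := fun W u w ω hω => by
  simpa using H W u (g ≫ w) ω hω

theorem comp_left {a : ι → (Y ⟶ Z)} {h : Y ⟶ Z} (H : HasUWSum a h) (g : X ⟶ Y) :
    HasUWSum (fun i => g ≫ a i) (g ≫ h) := fun W u w ω hω => by
  simpa using H W (u ≫ g) w ω hω

theorem add {a b : ι → (X ⟶ Y)} {h k : X ⟶ Y} (H : HasUWSum a h) (K : HasUWSum b k) :
    HasUWSum (fun i => a i + b i) (h + k) := fun W u w ω hω => by
  simpa only [Preadditive.comp_add, Preadditive.add_comp, fun_add] using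
    (H W u w ω hω).add (K W u w ω hω)

theorem smul {a : ι → (X ⟶ Y)} {h : X ⟶ Y} (H : HasUWSum a h) (c : ℂ) :
    HasUWSum (fun i => c • a i) (c • h) := fun W u w ω hω => by
  simpa only [Linear.comp_smul, Linear.smul_comp, fun_smul] using (H W u w ω hω).mul_left c

theorem sum {κ : Type*} (s : Finset κ) {a : κ → ι → (X ⟶ Y)} {h : κ → (X ⟶ Y)}
    (H : ∀ k ∈ s, HasUWSum (a k) (h k)) :
    HasUWSum (fun i => ∑ k ∈ s, a k i) (∑ k ∈ s, h k) := fun W u w ω hω => by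
  have := hasSum_sum fun k hk => H k hk W u w ω hω
  convert this using 1
  · funext i
    rw [Preadditive.sum_comp, Preadditive.comp_sum, fun_sum]
  · rw [Preadditive.sum_comp, Preadditive.comp_sum, fun_sum]

theorem single (i : ι) {a : ι → (X ⟶ Y)} (h : ∀ j, j ≠ i → a j = 0) :
    HasUWSum a (a i) := fun W u w ω hω => by
  refine hasSum_single i fun j hj => ?_
  rw [h j hj]
  simp only [Limits.comp_zero, Limits.zero_comp]
  exact map_zero ω

end HasUWSum

theorem normal_nonneg {W : C} {ω : End W →ₗ[ℂ] ℂ} (hω : IsNormalFunctional ω) {a : W ⟶ W}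
    (ha : Pos a) : 0 ≤ ω a := isPos_complex.1 (hω.pos a ha)

section Additive2
variable {M : Type u} [Category.{v} M] [Preadditive M] [Linear ℂ M] [StarCategory M]
  [IsWStarAdditive M]

theorem pos_of_normal {W : M} {a : W ⟶ W}
    (h : ∀ ω : End W →ₗ[ℂ] ℂ, IsNormalFunctional ω → 0 ≤ ω a) : Pos a :=
  (IsWStarAdditive.wstar W).isPos_of_normal h

theorem normal_dag {W : M} {ω : End W →ₗ[ℂ] ℂ} (hω : IsNormalFunctional ω) (a : W ⟶ W) :
    ω (a†) = (starRingEnd ℂ) (ω a) := by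
  have hs : ∀ a : W ⟶ W, a† = a → (ω a).im = 0 := by
    intro a ha
    obtain ⟨r, hr, h⟩ := (IsWStarAdditive.wstar W).exists_bound (a := a) ha
    have h1 := (Complex.nonneg_iff.1 (normal_nonneg hω h)).2
    have h2 := (Complex.nonneg_iff.1 (normal_nonneg hω ((pos_one W).smul hr))).2
    have h3 : ω ((r : ℂ) • 𝟙 W - a) = ω ((r : ℂ) • 𝟙 W) - ω a := map_sub ω _ _
    have h4 : (0 : ℝ) = (ω ((r : ℂ) • 𝟙 W - a)).im := h1
    rw [h3, Complex.sub_im] at h4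
    linarith
  have h1 := hs (a + a†) (by simp [add_comm])
  have h2 := hs (Complex.I • (a - a†)) (by simp [smul_sub, ← sub_eq_neg_add])
  rw [fun_add] at h1
  rw [fun_smul, fun_sub] at h2
  simp at h1 h2
  apply Complex.ext
  · simp; linarith
  · simp; linarith

theorem HasUWSum.dag {ι : Type*} {X Y : M} {a : ι → (X ⟶ Y)} {h : X ⟶ Y} (H : HasUWSum a h) :
    HasUWSum (fun i => (a i)†) (h†) := fun W u w ω hω => by
  have := (H W (w†) (u†) ω hω).map (starRingEnd ℂ) Complex.continuous_conj
  convert this using 1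
  · funext i
    simp only [Function.comp_apply]
    rw [← normal_dag hω]; simp
  · rw [← normal_dag hω]; simp

theorem eq_of_normal {X Y : M} {h k : X ⟶ Y}
    (H : ∀ (W : M) (u : W ⟶ X) (w : Y ⟶ W) (ω : End W →ₗ[ℂ] ℂ), IsNormalFunctional ω →
      ω (u ≫ h ≫ w) = ω (u ≫ k ≫ w)) : h = k := by
  rw [← sub_eq_zero]
  apply eq_zero_of_comp_dag
  have : ∀ ω : End X →ₗ[ℂ] ℂ, IsNormalFunctional ω → ω ((h - k) ≫ (h - k)†) = 0 := by
    intro ω hω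
    have := H X (𝟙 X) ((h - k)†) ω hω
    rw [Category.id_comp, Category.id_comp] at this
    rw [Preadditive.sub_comp, fun_sub, this, sub_self]
  refine (pos_comp_dag _).eq_zero (pos_of_normal fun ω hω => ?_)
  have e : ω (-((h - k) ≫ (h - k)†)) = - ω ((h - k) ≫ (h - k)†) := map_neg ω _
  rw [e, this ω hω, neg_zero]

theorem HasUWSum.unique {ι : Type*} {X Y : M} {a : ι → (X ⟶ Y)} {h k : X ⟶ Y}
    (H : HasUWSum a h) (K : HasUWSum a k) : h = k :=
  eq_of_normal fun W u w ω hω => (H W u w ω hω).unique (K W u w ω hω)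

theorem cauchy_schwarz {W Y : M} {ω : End W →ₗ[ℂ] ℂ} (hω : IsNormalFunctional ω) (α : W ⟶ Y)
    (β : Y ⟶ W) : ‖ω (α ≫ β)‖ ≤ √(ω (α ≫ α†)).re * √(ω (β† ≫ β)).re := by
  let c : PreInnerProductSpace.Core ℂ (W ⟶ Y) :=
    { inner := fun x y => ω (y ≫ x†)
      conj_inner_symm := fun x y => by
        rw [← normal_dag hω]; simp
      re_inner_nonneg := fun x => (Complex.nonneg_iff.1 (normal_nonneg hω (pos_comp_dag x))).1
      add_left := fun x y z => by
        rw [StarCategory.dag_add, Preadditive.comp_add]; exact map_add ω _ _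
      smul_left := fun x y c => by
        rw [StarCategory.dag_smul, Linear.comp_smul]; exact map_smul ω _ _ }
  let _ : Inner ℂ (W ⟶ Y) := c.toInner
  have h1 := InnerProductSpace.Core.inner_mul_inner_self_le (𝕜 := ℂ) (c := c) (β†) α
  have e1 : inner ℂ (β†) α = ω (α ≫ β) := by
    change ω (α ≫ (β†)†) = _
    rw [StarCategory.dag_dag]
  have e2 : inner ℂ α (β†) = (starRingEnd ℂ) (ω (α ≫ β)) := by
    change ω (β† ≫ α†) = _
    rw [← normal_dag hω]; simp
  have e3 : inner ℂ (β†) (β†) = ω (β† ≫ β) := by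
    change ω (β† ≫ (β†)†) = _
    rw [StarCategory.dag_dag]
  have e4 : inner ℂ α α = ω (α ≫ α†) := rfl
  rw [e1, e2, e3, e4, RCLike.norm_conj] at h1
  have p1 := (Complex.nonneg_iff.1 (normal_nonneg hω (pos_comp_dag α))).1
  have p2 : 0 ≤ (ω (β† ≫ β)).re := by
    rw [← e3]; exact (Complex.nonneg_iff.1 (normal_nonneg hω (pos_comp_dag (β†)))).1
  rw [← Real.sqrt_mul p1]
  apply Real.le_sqrt_of_sq_le
  rw [sq, mul_comm (ω (α ≫ α†)).re]
  exact h1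

/-- A column bounded above and a row bounded above have an ultraweakly convergent product. -/
theorem exists_uwSum {κ : Type*} {X Z : M} {Y : κ → M} (f : ∀ j, X ⟶ Y j) (g : ∀ j, Y j ⟶ Z)
    {r s : ℝ} (hf : ∀ J : Finset κ, Pos ((r : ℂ) • 𝟙 X - ∑ j ∈ J, f j ≫ (f j)†))
    (hg : ∀ J : Finset κ, Pos ((s : ℂ) • 𝟙 Z - ∑ j ∈ J, (g j)† ≫ g j)) :
    ∃ h : X ⟶ Z, HasUWSum (fun j => f j ≫ g j) h := by
  classical
  obtain ⟨N, p, q, hp, hq, hpq, hsum⟩ := IsWStarAdditive.sum X Z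
  have hqp : q ≫ p† = 0 := by
    have := congrArg StarCategory.dag hpq
    simpa using this
  let t : ∀ j, N ⟶ Y j := fun j => p† ≫ f j + q† ≫ (g j)†
  let c : Finset κ → (N ⟶ N) := fun J => ∑ j ∈ J, t j ≫ (t j)†
  have hc : ∀ I J, I ≤ J → Pos (c J - c I) := by
    intro I J hIJ
    have : c J - c I = ∑ j ∈ J \ I, t j ≫ (t j)† := by
      rw [sub_eq_iff_eq_add]; exact (Finset.sum_sdiff hIJ).symm
    rw [this]
    exact pos_sum _ _ fun j _ => pos_comp_dag _
  have hc0 : ∀ J, Pos (c J) := fun J => pos_sum _ _ fun j _ => pos_comp_dag _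
  have hb : ∀ J, Pos (((2 : ℝ) : ℂ) • (p† ≫ ((r : ℂ) • 𝟙 X) ≫ p + q† ≫ ((s : ℂ) • 𝟙 Z) ≫ q) - c J) := by
    intro J
    have h1 := ((hf J).conj (p†)).add ((hg J).conj (q†))
    have h2 := h1.smul (zero_le_two (α := ℝ))
    have h3 : Pos (∑ j ∈ J, (p† ≫ f j - q† ≫ (g j)†) ≫ (p† ≫ f j - q† ≫ (g j)†)†) :=
      pos_sum _ _ fun j _ => pos_comp_dag _
    convert h2.add h3 using 1
    simp only [c, t, Preadditive.comp_sub, Preadditive.sub_comp, Preadditive.comp_sum,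
      Preadditive.sum_comp, StarCategory.dag_dag, StarCategory.dag_add, dag_sub,
      StarCategory.dag_comp, Preadditive.add_comp, Preadditive.comp_add, Finset.sum_add_distrib,
      Finset.sum_sub_distrib, Category.assoc, Complex.ofReal_ofNat]
    module
  obtain ⟨a, ha⟩ : ∃ a : N ⟶ N, IsSup (A := End N) (Set.range c) a :=
    (IsWStarAdditive.wstar N).exists_sup c hc hc0 _ hb
  refine ⟨p ≫ a ≫ q†, fun W u w ω hω => ?_⟩
  have key : ∀ x : W ⟶ N, Tendsto (fun J => ω (x ≫ c J ≫ x†)) atTop (𝓝 (ω (x ≫ a ≫ x†))) := by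
    intro x
    exact hω.tendsto (c := fun J => (x ≫ c J ≫ x† : W ⟶ W))
      (fun I J h => by
        have := (hc I J h).conj x
        rw [Preadditive.sub_comp, Preadditive.comp_sub] at this
        exact this)
      (fun J => (hc0 J).conj x) (isSup_conj hc hc0 ha x)
  have pol : ∀ (b : N ⟶ N) (x y : W ⟶ N), ω (x ≫ b ≫ y†) =
      (ω ((x + y) ≫ b ≫ (x + y)†) - ω ((x - y) ≫ b ≫ (x - y)†)
        + Complex.I * ω ((x + Complex.I • y) ≫ b ≫ (x + Complex.I • y)†)
        - Complex.I * ω ((x - Complex.I • y) ≫ b ≫ (x - Complex.I • y)†)) / 4 := by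
    intro b x y
    have a1 : ∀ x y : W ⟶ N, ω ((x + y) ≫ b ≫ (x + y)†) =
        ω (x ≫ b ≫ x†) + ω (x ≫ b ≫ y†) + (ω (y ≫ b ≫ x†) + ω (y ≫ b ≫ y†)) := by
      intro x y
      rw [← fun_add, ← fun_add, ← fun_add]
      congr 1
      simp only [StarCategory.dag_add, Preadditive.add_comp, Preadditive.comp_add]
      abel
    have a2 : ∀ x y : W ⟶ N, ω ((x - y) ≫ b ≫ (x - y)†) =
        ω (x ≫ b ≫ x†) - ω (x ≫ b ≫ y†) - (ω (y ≫ b ≫ x†) - ω (y ≫ b ≫ y†)) := by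
      intro x y
      rw [← fun_sub, ← fun_sub, ← fun_sub]
      congr 1
      simp only [dag_sub, Preadditive.sub_comp, Preadditive.comp_sub]
      abel
    have a3 : ∀ x : W ⟶ N, ω (x ≫ b ≫ (Complex.I • y)†) = -Complex.I * ω (x ≫ b ≫ y†) := by
      intro x
      rw [StarCategory.dag_smul, Linear.comp_smul, Linear.comp_smul, fun_smul, Complex.conj_I]
    have a4 : ∀ y' : N ⟶ W, ω ((Complex.I • y) ≫ b ≫ y') = Complex.I * ω (y ≫ b ≫ y') := by
      intro y'
      rw [Linear.smul_comp, fun_smul]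
    rw [a1, a2, a1, a2]
    rw [a3, a4, a3, a4]
    linear_combination (norm := ring_nf) (ω (x ≫ b ≫ y†) / 2 - ω (y ≫ b ≫ x†) / 2) * Complex.I_sq
  have key2 : ∀ x y : W ⟶ N, Tendsto (fun J => ω (x ≫ c J ≫ y†)) atTop (𝓝 (ω (x ≫ a ≫ y†))) := by
    intro x y
    rw [pol a x y]
    exact (((((key _).sub (key _)).add ((key _).const_mul _)).sub
      ((key _).const_mul _)).div_const 4).congr fun J => (pol _ _ _).symm
  have := key2 (u ≫ p) (w† ≫ q)
  have e : ∀ j, (u ≫ p) ≫ (t j ≫ (t j)†) ≫ (w† ≫ q)† = u ≫ (f j ≫ g j) ≫ w := by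
    intro j
    have e1 : p ≫ t j = f j := by simp [t, reassoc_of% hp, reassoc_of% hpq]
    have e2 : (t j)† ≫ q† = g j := by
      have : q ≫ t j = (g j)† := by simp [t, reassoc_of% hq, reassoc_of% hqp]
      rw [← StarCategory.dag_comp, this, StarCategory.dag_dag]
    have : (u ≫ p) ≫ (t j ≫ (t j)†) ≫ (w† ≫ q)† = u ≫ (p ≫ t j) ≫ ((t j)† ≫ q†) ≫ w := by
      simp
    rw [this, e1, e2]; simp
  rw [HasSum, SummationFilter.unconditional_filter]
  convert this using 2 with J
  · rw [← fun_sum]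
    simp only [c, Preadditive.comp_sum, Preadditive.sum_comp, e]
  · simp

theorem normLE_of_uwSum {κ : Type*} {X Z : M} {a : κ → (X ⟶ Z)} {h : X ⟶ Z}
    (H : HasUWSum a h) {r : ℝ} (hr : ∀ J : Finset κ, NormLE (∑ j ∈ J, a j) r) : NormLE h r := by
  have hr0 : 0 ≤ r := (hr ∅).1
  refine ⟨hr0, pos_of_normal fun ω hω => ?_⟩
  rw [fun_sub, fun_smul]
  have h1 := normal_nonneg hω (pos_one X)
  have h2 := normal_nonneg hω (pos_comp_dag h)
  obtain ⟨x, hx, e1⟩ : ∃ x : ℝ, 0 ≤ x ∧ ω (𝟙 X) = x :=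
    ⟨_, (Complex.nonneg_iff.1 h1).1, Complex.ext rfl (by simpa using (Complex.nonneg_iff.1 h1).2.symm)⟩
  obtain ⟨y, hy, e2⟩ : ∃ y : ℝ, 0 ≤ y ∧ ω (h ≫ h†) = y :=
    ⟨_, (Complex.nonneg_iff.1 h2).1, Complex.ext rfl (by simpa using (Complex.nonneg_iff.1 h2).2.symm)⟩
  have hs := H X (𝟙 X) (h†) ω hω
  simp only [Category.id_comp] at hs
  have hb : ‖ω (h ≫ h†)‖ ≤ r * √x * √y := by
    refine le_of_tendsto hs.norm (Eventually.of_forall fun J => ?_)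
    rw [← fun_sum, ← Preadditive.sum_comp]
    refine (cauchy_schwarz hω _ _).trans ?_
    rw [StarCategory.dag_dag, e2, Complex.ofReal_re]
    gcongr
    have h3 := normal_nonneg hω (hr J).2
    rw [fun_sub, fun_smul, e1, ← Complex.ofReal_mul] at h3
    have h4 := (Complex.nonneg_iff.1 h3).1
    rw [Complex.sub_re, Complex.ofReal_re] at h4
    rw [Real.sqrt_le_iff]
    refine ⟨by positivity, ?_⟩
    rw [mul_pow, Real.sq_sqrt hx]
    linarith
  rw [e2, Complex.norm_real, Real.norm_of_nonneg hy] at hb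
  rw [e1, e2, ← Complex.ofReal_mul, ← Complex.ofReal_sub]
  have : y ≤ r ^ 2 * x := by
    rcases hy.eq_or_lt with h0 | h0
    · rw [← h0]; positivity
    · have hsy : 0 < √y := Real.sqrt_pos.2 h0
      have h5 : √y ≤ r * √x := by
        have : √y * √y ≤ r * √x * √y := by rwa [Real.mul_self_sqrt hy]
        exact le_of_mul_le_mul_right this hsy
      calc y = √y ^ 2 := (Real.sq_sqrt hy).symm
        _ ≤ (r * √x) ^ 2 := by gcongr
        _ = r ^ 2 * x := by rw [mul_pow, Real.sq_sqrt hx]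
  exact_mod_cast sub_nonneg.2 this

/-- Interchange of iterated sums under a tail estimate. -/
theorem iterated_sum_eq {ι κ : Type*} {a : ι → κ → ℂ} {P : κ → ℂ} {Q : ι → ℂ} {α β : ℂ}
    (hP : ∀ k, HasSum (fun j => a j k) (P k)) (hQ : ∀ j, HasSum (fun k => a j k) (Q j))
    (hα : HasSum P α) (hβ : HasSum Q β) {q : ι → ℝ} (hq : Summable q) {c : ℝ} (hc : 0 ≤ c)
    (hq0 : ∀ j, 0 ≤ q j)
    (hb : ∀ (J : Finset ι) (K : Finset κ), ‖∑ j ∈ J, ∑ k ∈ K, a j k‖ ≤ c * √(∑ j ∈ J, q j)) :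
    α = β := by
  classical
  have key : ∀ J0 : Finset ι, ‖α - ∑ j ∈ J0, Q j‖ ≤ c * √(∑' j, q j - ∑ j ∈ J0, q j) := by
    intro J0
    have h1 : ∀ K : Finset κ, ‖∑ k ∈ K, P k - ∑ j ∈ J0, ∑ k ∈ K, a j k‖ ≤
        c * √(∑' j, q j - ∑ j ∈ J0, q j) := by
      intro K
      have hs : HasSum (fun j => ∑ k ∈ K, a j k) (∑ k ∈ K, P k) := hasSum_sum fun k _ => hP k
      rw [HasSum, SummationFilter.unconditional_filter] at hs
      refine le_of_tendsto (hs.sub_const _).norm ?_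
      filter_upwards [eventually_ge_atTop J0] with J hJ
      have e : ∑ j ∈ J, ∑ k ∈ K, a j k - ∑ j ∈ J0, ∑ k ∈ K, a j k =
          ∑ j ∈ J \ J0, ∑ k ∈ K, a j k := by
        rw [sub_eq_iff_eq_add]; exact (Finset.sum_sdiff hJ).symm
      rw [e]
      refine (hb _ _).trans ?_
      gcongr
      have e2 : ∑ j ∈ J \ J0, q j + ∑ j ∈ J0, q j = ∑ j ∈ J, q j := Finset.sum_sdiff hJ
      have e3 : ∑ j ∈ J, q j ≤ ∑' j, q j := hq.sum_le_tsum _ fun j _ => hq0 j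
      linarith
    have hs2 : Tendsto (fun K => ∑ j ∈ J0, ∑ k ∈ K, a j k) atTop (𝓝 (∑ j ∈ J0, Q j)) := by
      refine tendsto_finsetSum _ fun j _ => ?_
      have := hQ j
      rwa [HasSum, SummationFilter.unconditional_filter] at this
    rw [HasSum, SummationFilter.unconditional_filter] at hα
    exact le_of_tendsto (hα.sub hs2).norm (Eventually.of_forall h1)
  rw [HasSum, SummationFilter.unconditional_filter] at hβ
  have hqs := hq.hasSum
  rw [HasSum, SummationFilter.unconditional_filter] at hqs
  have h3 : Tendsto (fun J => c * √(∑' j, q j - ∑ j ∈ J, q j)) atTop (𝓝 0) := by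
    have := ((Real.continuous_sqrt.tendsto _).comp (hqs.const_sub (∑' j, q j))).const_mul c
    simpa using this
  have h4 : Tendsto (fun J => α - ∑ j ∈ J, Q j) atTop (𝓝 0) := squeeze_zero_norm key h3
  have h5 := tendsto_nhds_unique h4 (hβ.const_sub α)
  exact (sub_eq_zero.1 h5.symm)

/-- Associativity of products of infinite matrices, entrywise. -/
theorem uwSum_assoc {ι κ : Type*} {X W : M} {Y : ι → M} {Z : κ → M} (f : ∀ j, X ⟶ Y j)
    (g : ∀ j k, Y j ⟶ Z k) (h : ∀ k, Z k ⟶ W) {P : ∀ k, X ⟶ Z k} {Q : ∀ j, Y j ⟶ W}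
    {A B : X ⟶ W} (hP : ∀ k, HasUWSum (fun j => f j ≫ g j k) (P k))
    (hQ : ∀ j, HasUWSum (fun k => g j k ≫ h k) (Q j))
    (hA : HasUWSum (fun k => P k ≫ h k) A) (hB : HasUWSum (fun j => f j ≫ Q j) B)
    {r s : ℝ} (hf : ∀ J : Finset ι, Pos ((r : ℂ) • 𝟙 X - ∑ j ∈ J, f j ≫ (f j)†))
    (hgh : ∀ (J : Finset ι) (K : Finset κ),
      Pos ((s : ℂ) • 𝟙 W - ∑ j ∈ J, (∑ k ∈ K, g j k ≫ h k)† ≫ (∑ k ∈ K, g j k ≫ h k))) :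
    A = B := by
  refine eq_of_normal fun V u w ω hω => ?_
  have hre : ∀ {x : V ⟶ V}, Pos x → 0 ≤ (ω x).re := fun hx =>
    (Complex.nonneg_iff.1 (normal_nonneg hω hx)).1
  have hqb : ∀ J : Finset ι, ∑ j ∈ J, (ω ((u ≫ f j) ≫ (u ≫ f j)†)).re ≤
      (ω (u ≫ ((r : ℂ) • 𝟙 X) ≫ u†)).re := by
    intro J
    have := hre ((hf J).conj u)
    rw [Preadditive.sub_comp, Preadditive.comp_sub, fun_sub, Complex.sub_re, sub_nonneg,
      Preadditive.sum_comp, Preadditive.comp_sum, fun_sum, Complex.re_sum] at this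
    simpa using this
  have hq0 : ∀ j, 0 ≤ (ω ((u ≫ f j) ≫ (u ≫ f j)†)).re := fun j => hre (pos_comp_dag _)
  have hq : Summable fun j => (ω ((u ≫ f j) ≫ (u ≫ f j)†)).re :=
    summable_of_sum_le hq0 hqb
  refine iterated_sum_eq (a := fun j k => ω (u ≫ (f j ≫ g j k) ≫ h k ≫ w))
    (fun k => hP k V u (h k ≫ w) ω hω) (fun j => ?_) ?_ (hB V u w ω hω) hq
    (c := √(ω (w† ≫ ((s : ℂ) • 𝟙 W) ≫ w)).re) (Real.sqrt_nonneg _) hq0 ?_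
  · have := hQ j V (u ≫ f j) w ω hω
    simpa using this
  · have := hA V u w ω hω
    simpa using this
  · intro J K
    have e : ∀ j, ∑ k ∈ K, ω (u ≫ (f j ≫ g j k) ≫ h k ≫ w) =
        ω ((u ≫ f j) ≫ ((∑ k ∈ K, g j k ≫ h k) ≫ w)) := by
      intro j
      rw [← fun_sum]
      simp [Preadditive.comp_sum, Preadditive.sum_comp]
    simp only [e]
    refine (norm_sum_le _ _).trans ?_
    refine (Finset.sum_le_sum fun j _ => cauchy_schwarz hω _ _).trans ?_
    have hn0 : ∀ j, 0 ≤ (ω (((∑ k ∈ K, g j k ≫ h k) ≫ w)† ≫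
        ((∑ k ∈ K, g j k ≫ h k) ≫ w))).re := fun j => by
      have := hre (pos_comp_dag (((∑ k ∈ K, g j k ≫ h k) ≫ w)†))
      rwa [StarCategory.dag_dag] at this
    refine (Real.sum_sqrt_mul_sqrt_le J hq0 hn0).trans ?_
    rw [mul_comm]
    gcongr
    have := hre ((hgh J K).conj (w†))
    rw [Preadditive.sub_comp, Preadditive.comp_sub, fun_sub, Complex.sub_re, sub_nonneg,
      Preadditive.sum_comp, Preadditive.comp_sum, fun_sum, Complex.re_sum,
      StarCategory.dag_dag] at this
    simpa only [StarCategory.dag_comp, Category.assoc] using this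

end Additive2
end StarCat

section MatCat
variable {C : Type u} [Category.{v} C] [Preadditive C]

/-- A matrix of morphisms, as a morphism between formal finite sums. -/
def matOf {X Y : Mat_ C} (f : ∀ (i : X.ι) (j : Y.ι), X.X i ⟶ Y.X j) : X ⟶ Y := f

@[simp] theorem matOf_apply {X Y : Mat_ C} (f : ∀ (i : X.ι) (j : Y.ι), X.X i ⟶ Y.X j)
    (i : X.ι) (j : Y.ι) : matOf f i j = f i j := rfl

variable [Linear ℂ C]

instance (X Y : Mat_ C) : Module ℂ (X ⟶ Y) :=
  inferInstanceAs (Module ℂ (∀ (i : X.ι) (j : Y.ι), X.X i ⟶ Y.X j))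

@[simp] theorem mat_smul_apply {X Y : Mat_ C} (c : ℂ) (f : X ⟶ Y) (i : X.ι) (j : Y.ι) :
    (c • f) i j = c • f i j := rfl

instance : Linear ℂ (Mat_ C) where
  smul_comp _ _ _ c f g := by ext; simp [Finset.smul_sum]
  comp_smul _ _ _ f c g := by ext; simp [Finset.smul_sum]

variable [StarCategory C]

instance : StarCategory (Mat_ C) where
  dag f := matOf fun i j => (f j i)†
  dag_dag f := by ext; simp
  dag_comp f g := by ext; simp [dag_sum]
  dag_add f g := by ext; simp
  dag_smul c f := by ext; simp

@[simp] theorem mat_dag_apply {X Y : Mat_ C} (f : X ⟶ Y) (i : Y.ι) (j : X.ι) :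
    f† i j = (f j i)† := rfl

end MatCat

section
variable (C : Type u) [Category.{v} C] [Preadditive C] [Linear ℂ C] [StarCategory C]

/-- A W*-category: a *-category such that the endomorphisms of every formal finite direct sum of
objects form a W*-algebra. Mathlib's `Mat_ C` is the category of formal finite direct sums, with
matrices of morphisms as its morphisms. -/
class WStarCategory : Prop where
  isWStarAlgebra_end : ∀ X : Mat_ C, IsWStarAlgebra (End X)

instance [WStarCategory C] : IsWStarAdditive (Mat_ C) where
  wstar := WStarCategory.isWStarAlgebra_end
  sum X Y := by
    classical
    let Z : Mat_ C := ⟨X.ι ⊕ Y.ι, Sum.elim X.X Y.X⟩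
    let i : X ⟶ Z := matOf fun a b => match b with
      | Sum.inl b => (𝟙 X : X ⟶ X) a b
      | Sum.inr _ => 0
    let j : Y ⟶ Z := matOf fun a b => match b with
      | Sum.inl _ => 0
      | Sum.inr b => (𝟙 Y : Y ⟶ Y) a b
    have sX : ∀ a b : X.ι, ∑ x, (𝟙 X : X ⟶ X) a x ≫ ((𝟙 X : X ⟶ X) b x)† = (𝟙 X : X ⟶ X) a b := by
      intro a b
      have : (𝟙 X ≫ (𝟙 X)† : X ⟶ X) a b = (𝟙 X : X ⟶ X) a b := by rw [dag_id, Category.id_comp]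
      exact this
    have sY : ∀ a b : Y.ι, ∑ x, (𝟙 Y : Y ⟶ Y) a x ≫ ((𝟙 Y : Y ⟶ Y) b x)† = (𝟙 Y : Y ⟶ Y) a b := by
      intro a b
      have : (𝟙 Y ≫ (𝟙 Y)† : Y ⟶ Y) a b = (𝟙 Y : Y ⟶ Y) a b := by rw [dag_id, Category.id_comp]
      exact this
    have tX : ∀ a b : X.ι, ∑ x, ((𝟙 X : X ⟶ X) x a)† ≫ (𝟙 X : X ⟶ X) x b = (𝟙 X : X ⟶ X) a b := by
      intro a b
      have : ((𝟙 X)† ≫ 𝟙 X : X ⟶ X) a b = (𝟙 X : X ⟶ X) a b := by rw [dag_id, Category.id_comp]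
      exact this
    have tY : ∀ a b : Y.ι, ∑ x, ((𝟙 Y : Y ⟶ Y) x a)† ≫ (𝟙 Y : Y ⟶ Y) x b = (𝟙 Y : Y ⟶ Y) a b := by
      intro a b
      have : ((𝟙 Y)† ≫ 𝟙 Y : Y ⟶ Y) a b = (𝟙 Y : Y ⟶ Y) a b := by rw [dag_id, Category.id_comp]
      exact this
    refine ⟨Z, i, j, ?_, ?_, ?_, ?_⟩
    · ext a b
      rw [Mat_.comp_apply]
      refine (Fintype.sum_sum_type _).trans ?_
      change (∑ x : X.ι, (𝟙 X : X ⟶ X) a x ≫ ((𝟙 X : X ⟶ X) b x)†) +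
        (∑ y : Y.ι, (0 : X.X a ⟶ Y.X y) ≫ (0 : X.X b ⟶ Y.X y)†) = _
      rw [sX]; simp
    · ext a b
      rw [Mat_.comp_apply]
      refine (Fintype.sum_sum_type _).trans ?_
      change (∑ x : X.ι, (0 : Y.X a ⟶ X.X x) ≫ (0 : Y.X b ⟶ X.X x)†) +
        (∑ x : Y.ι, (𝟙 Y : Y ⟶ Y) a x ≫ ((𝟙 Y : Y ⟶ Y) b x)†) = _
      rw [sY]; simp
    · ext a b
      rw [Mat_.comp_apply]
      refine (Fintype.sum_sum_type _).trans ?_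
      change (∑ x : X.ι, (𝟙 X : X ⟶ X) a x ≫ (0 : Y.X b ⟶ X.X x)†) +
        (∑ x : Y.ι, (0 : X.X a ⟶ Y.X x) ≫ ((𝟙 Y : Y ⟶ Y) b x)†) = 0
      simp
    · have z1 : ∀ a b : X.ι, (𝟙 Z : Z ⟶ Z) (Sum.inl a) (Sum.inl b) = (𝟙 X : X ⟶ X) a b := by
        intro a b
        by_cases h : a = b
        · subst h; rw [Mat_.id_apply_self, Mat_.id_apply_self]; rfl
        · rw [Mat_.id_apply_of_ne _ _ _ h, Mat_.id_apply_of_ne _ _ _ (fun h' => h (Sum.inl.inj h'))]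
          rfl
      have z2 : ∀ a b : Y.ι, (𝟙 Z : Z ⟶ Z) (Sum.inr a) (Sum.inr b) = (𝟙 Y : Y ⟶ Y) a b := by
        intro a b
        by_cases h : a = b
        · subst h; rw [Mat_.id_apply_self, Mat_.id_apply_self]; rfl
        · rw [Mat_.id_apply_of_ne _ _ _ h, Mat_.id_apply_of_ne _ _ _ (fun h' => h (Sum.inr.inj h'))]
          rfl
      ext a b
      rw [Mat_.add_apply, Mat_.comp_apply, Mat_.comp_apply]
      rcases a with a | a <;> rcases b with b | b
      · refine Eq.trans ?_ (z1 a b).symm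
        change (∑ x : X.ι, ((𝟙 X : X ⟶ X) x a)† ≫ (𝟙 X : X ⟶ X) x b) +
          (∑ y : Y.ι, (0 : Y.X y ⟶ X.X a)† ≫ (0 : Y.X y ⟶ X.X b)) = _
        rw [tX]; simp
      · rw [Mat_.id_apply_of_ne _ _ _ (fun h => by cases h)]
        change (∑ x : X.ι, ((𝟙 X : X ⟶ X) x a)† ≫ (0 : X.X x ⟶ Y.X b)) +
          (∑ y : Y.ι, (0 : Y.X y ⟶ X.X a)† ≫ (𝟙 Y : Y ⟶ Y) y b) = 0
        simp
      · rw [Mat_.id_apply_of_ne _ _ _ (fun h => by cases h)]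
        change (∑ x : X.ι, (0 : X.X x ⟶ Y.X a)† ≫ (𝟙 X : X ⟶ X) x b) +
          (∑ y : Y.ι, ((𝟙 Y : Y ⟶ Y) y a)† ≫ (0 : Y.X y ⟶ X.X b)) = 0
        simp
      · refine Eq.trans ?_ (z2 a b).symm
        change (∑ x : X.ι, (0 : X.X x ⟶ Y.X a)† ≫ (0 : X.X x ⟶ Y.X b)) +
          (∑ y : Y.ι, ((𝟙 Y : Y ⟶ Y) y a)† ≫ (𝟙 Y : Y ⟶ Y) y b) = _
        rw [tY]; simp

end

section Blocks
variable {C : Type u} [Category.{v} C] [Preadditive C] [Linear ℂ C] [StarCategory C]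

theorem mat_sum_apply {X Y : Mat_ C} {κ : Type*} (s : Finset κ) (f : κ → (X ⟶ Y)) (i : X.ι)
    (j : Y.ι) : (∑ k ∈ s, f k) i j = ∑ k ∈ s, f k i j := by
  classical
  induction s using Finset.induction_on with
  | empty => rfl
  | insert a s ha ih => rw [Finset.sum_insert ha, Finset.sum_insert ha, Mat_.add_apply, ih]

/-- The inclusion of a summand of a formal finite sum. -/
noncomputable def matInc (X : Mat_ C) (i : X.ι) : (Mat_.embedding C).obj (X.X i) ⟶ X :=
  matOf fun _ j => (𝟙 X : X ⟶ X) i j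

theorem embedding_comp_apply {W Z : Mat_ C} {x : C} (f : W ⟶ (Mat_.embedding C).obj x)
    (g : (Mat_.embedding C).obj x ⟶ Z) (i : W.ι) (k : Z.ι) :
    (f ≫ g) i k = f i PUnit.unit ≫ g PUnit.unit k := by
  change ∑ j : PUnit.{1}, f i j ≫ g j k = _
  simp

theorem mat_decomp {X Y : Mat_ C} (h : X ⟶ Y) :
    h = ∑ i, ∑ j, (matInc X i)† ≫ (Mat_.embedding C).map (h i j) ≫ matInc Y j := by
  classical
  ext a b
  have e : ∀ i j, ((matInc X i)† ≫ (Mat_.embedding C).map (h i j) ≫ matInc Y j) a b =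
      ((𝟙 X : X ⟶ X) i a)† ≫ h i j ≫ (𝟙 Y : Y ⟶ Y) j b := by
    intro i j
    refine (embedding_comp_apply (C := C) _ _ a b).trans ?_
    exact congrArg _ (embedding_comp_apply (C := C) (W := (Mat_.embedding C).obj (X.X i)) _ _ _ b)
  simp only [mat_sum_apply, e]
  rw [Finset.sum_eq_single a, Finset.sum_eq_single b]
  · simp
  · intro j _ hj
    simp [Mat_.id_apply_of_ne _ _ _ hj]
  · simp
  · intro i _ hi
    simp [Mat_.id_apply_of_ne _ _ _ hi]
  · simp

variable {ι κ μ : Type*} {X : ι → C} {Y : κ → C} {Z : μ → C}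

/-- The finite block of a matrix of morphisms. -/
def block (f : ∀ i j, X i ⟶ Y j) {α β : Type} [Fintype α] [Fintype β] (p : α → ι) (q : β → κ) :
    Mat_.mk α (fun a => X (p a)) ⟶ Mat_.mk β (fun b => Y (q b)) :=
  matOf fun a b => f (p a) (q b)

@[simp] theorem block_apply (f : ∀ i j, X i ⟶ Y j) {α β : Type} [Fintype α] [Fintype β]
    (p : α → ι) (q : β → κ) (a : α) (b : β) : block f p q a b = f (p a) (q b) := rfl

/-- A possibly infinite matrix of morphisms is bounded if its finite blocks are bounded in norm by a
common constant. -/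
def IsBoundedMatrix (f : ∀ i j, X i ⟶ Y j) : Prop :=
  ∃ r : ℝ, ∀ (α β : Type) [Fintype α] [Fintype β] (p : α ↪ ι) (q : β ↪ κ), NormLE (block f p q) r

/-- `h` is the product of the matrices `f` and `g`: its entries are the ultraweak sums of the
products of the entries. -/
def IsMatrixProduct (f : ∀ i j, X i ⟶ Y j) (g : ∀ j k, Y j ⟶ Z k) (h : ∀ i k, X i ⟶ Z k) : Prop :=
  ∀ i k, HasUWSum (fun j => (Mat_.embedding C).map (f i j ≫ g j k)) ((Mat_.embedding C).map (h i k))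

/-- An enumeration of a finite set. -/
noncomputable def finEnum (J : Finset κ) : Fin J.card ↪ κ :=
  J.equivFin.symm.toEmbedding.trans (Function.Embedding.subtype _)

theorem sum_finEnum {A : Type*} [AddCommMonoid A] (J : Finset κ) (F : κ → A) :
    ∑ b : Fin J.card, F (finEnum J b) = ∑ j ∈ J, F j := by
  rw [← Finset.sum_coe_sort J]
  exact Equiv.sum_comp J.equivFin.symm (fun j : J => F j)

/-- The map from a one-point type. -/
def ptEmb (i : ι) : PUnit.{1} ↪ ι := ⟨fun _ => i, fun _ _ _ => rfl⟩

variable [WStarCategory C]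

namespace IsBoundedMatrix

theorem add {f g : ∀ i j, X i ⟶ Y j} (hf : IsBoundedMatrix f) (hg : IsBoundedMatrix g) :
    IsBoundedMatrix (fun i j => f i j + g i j) := by
  obtain ⟨r, hr⟩ := hf
  obtain ⟨s, hs⟩ := hg
  exact ⟨2 * (r + s), fun α β _ _ p q => (hr α β p q).add (hs α β p q)⟩

theorem smul {f : ∀ i j, X i ⟶ Y j} (hf : IsBoundedMatrix f) (c : ℂ) :
    IsBoundedMatrix (fun i j => c • f i j) := by
  obtain ⟨r, hr⟩ := hf
  exact ⟨‖c‖ * r, fun α β _ _ p q => (hr α β p q).smul c⟩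

theorem dag {f : ∀ i j, X i ⟶ Y j} (hf : IsBoundedMatrix f) :
    IsBoundedMatrix (fun j i => (f i j)†) := by
  obtain ⟨r, hr⟩ := hf
  exact ⟨r, fun α β _ _ p q => (hr β α q p).dag⟩

theorem column {f : ∀ i j, X i ⟶ Y j} {r : ℝ} (hr : ∀ (α β : Type) [Fintype α] [Fintype β]
      (p : α ↪ ι) (q : β ↪ κ), NormLE (block f p q) r) (i : ι) (J : Finset κ) :
    Pos (((r ^ 2 : ℝ) : ℂ) • 𝟙 ((Mat_.embedding C).obj (X i)) -
      ∑ j ∈ J, (Mat_.embedding C).map (f i j) ≫ ((Mat_.embedding C).map (f i j))†) := by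
  have h := (hr PUnit (Fin J.card) (ptEmb i) (finEnum J)).2
  have e : block f (ptEmb i) (finEnum J) ≫ (block f (ptEmb i) (finEnum J))† =
      ∑ j ∈ J, (Mat_.embedding C).map (f i j) ≫ ((Mat_.embedding C).map (f i j))† := by
    refine Mat_.hom_ext (M := (Mat_.embedding C).obj (X i)) (N := (Mat_.embedding C).obj (X i))
      _ _ fun a b => ?_
    rw [mat_sum_apply]
    refine (sum_finEnum J fun j => f i j ≫ (f i j)†).trans (Finset.sum_congr rfl fun j _ => ?_)
    exact (embedding_comp_apply (C := C) (W := (Mat_.embedding C).obj (X i))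
      (Z := (Mat_.embedding C).obj (X i)) ((Mat_.embedding C).map (f i j))
      (((Mat_.embedding C).map (f i j))†) a b).symm
  exact e ▸ h

theorem exists_product {f : ∀ i j, X i ⟶ Y j} {g : ∀ j k, Y j ⟶ Z k} (hf : IsBoundedMatrix f)
    (hg : IsBoundedMatrix g) : ∃ h : ∀ i k, X i ⟶ Z k, IsMatrixProduct f g h := by
  have : ∀ i k, ∃ h : X i ⟶ Z k, HasUWSum (fun j => (Mat_.embedding C).map (f i j ≫ g j k))
      ((Mat_.embedding C).map h) := by
    intro i k
    obtain ⟨r, hr⟩ := hf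
    obtain ⟨s, hs⟩ := hg.dag
    obtain ⟨h, hh⟩ := exists_uwSum (fun j => (Mat_.embedding C).map (f i j))
      (fun j => (Mat_.embedding C).map (g j k)) (column hr i) (s := s ^ 2) (fun J => by
        have e : ∀ j, ((Mat_.embedding C).map ((g j k)†))† = (Mat_.embedding C).map (g j k) := by
          intro j
          ext a b
          exact StarCategory.dag_dag _
        have e' : ∀ j, (Mat_.embedding C).map ((g j k)†) = ((Mat_.embedding C).map (g j k))† :=
          fun j => by rw [← e j, StarCategory.dag_dag]
        have := column hs k J
        simp only [e'] at this
        simpa only [StarCategory.dag_dag] using this)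
    obtain ⟨h', rfl⟩ := (Mat_.embedding C).map_surjective h
    exact ⟨h', by simpa only [Functor.map_comp] using hh⟩
  choose h hh using this
  exact ⟨h, hh⟩

end IsBoundedMatrix

theorem IsMatrixProduct.unique {f : ∀ i j, X i ⟶ Y j} {g : ∀ j k, Y j ⟶ Z k}
    {h h' : ∀ i k, X i ⟶ Z k} (H : IsMatrixProduct f g h) (H' : IsMatrixProduct f g h') :
    h = h' := by
  funext i k
  exact (Mat_.embedding C).map_injective ((H i k).unique (H' i k))

theorem IsMatrixProduct.bounded {f : ∀ i j, X i ⟶ Y j} {g : ∀ j k, Y j ⟶ Z k}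
    {h : ∀ i k, X i ⟶ Z k} (H : IsMatrixProduct f g h) (hf : IsBoundedMatrix f)
    (hg : IsBoundedMatrix g) : IsBoundedMatrix h := by
  obtain ⟨r, hr⟩ := hf
  obtain ⟨s, hs⟩ := hg
  refine ⟨r * s, fun α β _ _ p q => ?_⟩
  let a : κ → (Mat_.mk α (fun a => X (p a)) ⟶ Mat_.mk β (fun b => Z (q b))) :=
    fun j => matOf fun a b => f (p a) j ≫ g j (q b)
  refine normLE_of_uwSum (a := a) ?_ fun J => ?_
  · rw [mat_decomp (block h p q)]
    have e : ∀ j, a j = _ := fun j => mat_decomp (a j)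
    have e' : a = fun j => _ := funext e
    rw [e']
    refine HasUWSum.sum _ fun i _ => HasUWSum.sum _ fun k _ => ?_
    exact ((H (p i) (q k)).comp_right _).comp_left _
  · have e : ∑ j ∈ J, a j = block f p (finEnum J) ≫ block g (finEnum J) q := by
      ext i k
      rw [mat_sum_apply, Mat_.comp_apply]
      exact (sum_finEnum J fun j => f (p i) j ≫ g j (q k)).symm
    rw [e]
    exact (hr _ _ p (finEnum J)).comp (hs _ _ (finEnum J) q)

theorem IsMatrixProduct.dag {f : ∀ i j, X i ⟶ Y j} {g : ∀ j k, Y j ⟶ Z k}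
    {h : ∀ i k, X i ⟶ Z k} (H : IsMatrixProduct f g h) :
    IsMatrixProduct (fun k j => (g j k)†) (fun j i => (f i j)†) (fun k i => (h i k)†) := by
  intro k i
  have := (H i k).dag
  convert this using 1
  · funext j
    ext a b
    exact (StarCategory.dag_comp _ _).symm
  · ext a b
    rfl

theorem IsMatrixProduct.assoc {ν : Type*} {W : ν → C} {f : ∀ i j, X i ⟶ Y j}
    {g : ∀ j k, Y j ⟶ Z k} {h : ∀ k l, Z k ⟶ W l} {P : ∀ i k, X i ⟶ Z k} {Q : ∀ j l, Y j ⟶ W l}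
    {A B : ∀ i l, X i ⟶ W l} (hf : IsBoundedMatrix f) (hg : IsBoundedMatrix g)
    (hh : IsBoundedMatrix h) (hP : IsMatrixProduct f g P) (hQ : IsMatrixProduct g h Q)
    (hA : IsMatrixProduct P h A) (hB : IsMatrixProduct f Q B) : A = B := by
  obtain ⟨r, hr⟩ := hf
  obtain ⟨s, hs⟩ := hg
  obtain ⟨t, ht⟩ := hh
  funext i l
  apply (Mat_.embedding C).map_injective
  let E := Mat_.embedding C
  refine uwSum_assoc (fun j => E.map (f i j)) (fun j k => E.map (g j k)) (fun k => E.map (h k l))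
    (P := fun k => E.map (P i k)) (Q := fun j => E.map (Q j l)) (s := (s * t) ^ 2)
    (fun k => ?_) (fun j => ?_) ?_ ?_ (IsBoundedMatrix.column hr i) fun J K => ?_
  · simpa only [E, Functor.map_comp] using hP i k
  · simpa only [E, Functor.map_comp] using hQ j l
  · simpa only [E, Functor.map_comp] using hA i l
  · simpa only [E, Functor.map_comp] using hB i l
  · have h1 := ((hs _ _ (finEnum J) (finEnum K)).comp (ht _ _ (finEnum K) (ptEmb l))).dag.2
    have e : (block g (finEnum J) (finEnum K) ≫ block h (finEnum K) (ptEmb l))† ≫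
        ((block g (finEnum J) (finEnum K) ≫ block h (finEnum K) (ptEmb l))†)† =
        ∑ j ∈ J, (∑ k ∈ K, E.map (g j k) ≫ E.map (h k l))† ≫
          (∑ k ∈ K, E.map (g j k) ≫ E.map (h k l)) := by
      rw [StarCategory.dag_dag]
      let T : ∀ j, E.obj (Y j) ⟶ E.obj (W l) := fun j => ∑ k ∈ K, E.map (g j k) ≫ E.map (h k l)
      refine Mat_.hom_ext (M := E.obj (W l)) (N := E.obj (W l)) _ _ fun a b => ?_
      rw [mat_sum_apply]
      have e1 : ∀ j, ((T j)† ≫ T j) a b = (T j PUnit.unit a)† ≫ T j PUnit.unit b := fun j =>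
        embedding_comp_apply (C := C) (W := E.obj (W l)) (Z := E.obj (W l)) ((T j)†) (T j) a b
      have e2 : ∀ j b, T (finEnum J j) PUnit.unit b =
          (block g (finEnum J) (finEnum K) ≫ block h (finEnum K) (ptEmb l)) j b := by
        intro j b
        refine (mat_sum_apply (X := E.obj _) (Y := E.obj (W l)) K _ _ b).trans ?_
        refine Eq.trans (Finset.sum_congr rfl fun k _ => embedding_comp_apply (C := C)
          (W := E.obj _) (Z := E.obj (W l)) (E.map _) (E.map (h k l)) PUnit.unit b) ?_
        exact (sum_finEnum K fun k => g (finEnum J j) k ≫ h k l).symm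
      refine Eq.trans ?_ (Finset.sum_congr rfl fun j _ => (e1 j).symm)
      refine Eq.trans ?_ (sum_finEnum (A := (E.obj (W l)).X a ⟶ (E.obj (W l)).X b) J
        fun j => (T j PUnit.unit a)† ≫ T j PUnit.unit b)
      simp only [e2]
      rfl
    rw [← e]
    exact h1

section Identity
open scoped Classical in
/-- The identity matrix. -/
noncomputable def idMatrix (X : ι → C) (i j : ι) : X i ⟶ X j :=
  if h : i = j then eqToHom (congrArg X h) else 0

theorem idMatrix_self (X : ι → C) (i : ι) : idMatrix X i i = 𝟙 (X i) := by simp [idMatrix]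

theorem idMatrix_ne (X : ι → C) {i j : ι} (h : i ≠ j) : idMatrix X i j = 0 := by
  simp [idMatrix, h]

theorem idMatrix_dag (X : ι → C) (i j : ι) : (idMatrix X i j)† = idMatrix X j i := by
  by_cases h : i = j
  · subst h; simp [idMatrix_self]
  · rw [idMatrix_ne X h, idMatrix_ne X (Ne.symm h), dag_zero]

theorem idMatrix_mul3 (X : ι → C) (i j : ι) :
    idMatrix X i j ≫ (idMatrix X i j)† ≫ idMatrix X i j = idMatrix X i j := by
  by_cases h : i = j
  · subst h; simp [idMatrix_self]
  · rw [idMatrix_ne X h]; simp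

theorem idMatrix_bounded (X : ι → C) : IsBoundedMatrix (idMatrix X) := by
  refine ⟨1, fun α β _ _ p q => ⟨zero_le_one, ?_⟩⟩
  set b := block (idMatrix X) p q with hb
  have key : b ≫ b† ≫ b = b := by
    ext i j
    have e : (b ≫ b† ≫ b) i j = ∑ j1, ∑ i1, idMatrix X (p i) (q j1) ≫
        (idMatrix X (p i1) (q j1))† ≫ idMatrix X (p i1) (q j) := by
      simp only [Mat_.comp_apply, mat_dag_apply, hb, block_apply, Preadditive.comp_sum]
    rw [e, Finset.sum_eq_single j, Finset.sum_eq_single i]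
    · rw [hb, block_apply]
      exact idMatrix_mul3 X _ _
    · intro i1 _ h1
      by_cases h : p i = q j
      · have : p i1 ≠ q j := fun h' => h1 (p.injective (h'.trans h.symm))
        rw [idMatrix_ne X this]; simp
      · rw [idMatrix_ne X h]; simp
    · simp
    · intro j1 _ h1
      refine Finset.sum_eq_zero fun i1 _ => ?_
      by_cases h : p i1 = q j
      · have : p i1 ≠ q j1 := fun h' => h1 (q.injective (h'.symm.trans h))
        rw [idMatrix_ne X this]; simp
      · rw [idMatrix_ne X h]; simp
    · simp
  refine pos_iff.2 ⟨𝟙 _ - b ≫ b†, ?_⟩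
  simp only [one_pow, Complex.ofReal_one, one_smul, dag_sub, dag_id, StarCategory.dag_comp,
    StarCategory.dag_dag, Preadditive.sub_comp, Preadditive.comp_sub, Category.id_comp,
    Category.comp_id, Category.assoc]
  have key' : b ≫ b† ≫ b ≫ b† = b ≫ b† := by
    have := congrArg (· ≫ b†) key
    simpa using this
  rw [key']
  abel

theorem idMatrix_mul (f : ∀ i j, X i ⟶ Y j) : IsMatrixProduct (idMatrix X) f f := by
  intro i k
  have := HasUWSum.single i
    (a := fun j => (Mat_.embedding C).map (idMatrix X i j ≫ f j k)) (fun j hj => by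
      rw [idMatrix_ne X (Ne.symm hj), Limits.zero_comp, Functor.map_zero])
  simpa only [idMatrix_self, Category.id_comp] using this

theorem mul_idMatrix (f : ∀ i j, X i ⟶ Y j) : IsMatrixProduct f (idMatrix Y) f := by
  intro i k
  have := HasUWSum.single k
    (a := fun j => (Mat_.embedding C).map (f i j ≫ idMatrix Y j k)) (fun j hj => by
      rw [idMatrix_ne Y hj, Limits.comp_zero, Functor.map_zero])
  simpa only [idMatrix_self, Category.comp_id] using this

end Identity

end Blocks

section Completion
variable (C : Type u) [Category.{v} C] [Preadditive C] [Linear ℂ C] [StarCategory C]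

/-- The direct sum completion of a W*-category. Its objects are the formal direct sums of arbitrary
families of objects, and its morphisms are the bounded matrices of morphisms. In a faithful normal
representation of `C` on Hilbert spaces `H x` such that the operators in `Hom(x, y)` are ultraweakly
closed, these are exactly the bounded operators between Hilbert sums `⨁ H (x i) → ⨁ H (y j)` all of
whose entries are morphisms of `C`. For `y = x` this is the von Neumann algebra that is generated by
the matrices with finitely many nonzero entries: every bounded operator `T` is the limit of its
finite blocks `e T e`, and conversely `e T e` is a matrix of morphisms for `T` in that algebra.
Morphisms between different sums are the corresponding corner of the endomorphisms of a joint sum. -/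
structure DirectSumCompletion : Type (max u (v + 1)) where
  ι : Type v
  X : ι → C

variable {C}
namespace DirectSumCompletion
variable [WStarCategory C]

/-- The space of bounded matrices between two formal direct sums. -/
def boundedMatrices (X Y : DirectSumCompletion C) : Submodule ℂ (∀ i j, X.X i ⟶ Y.X j) where
  carrier := {f | IsBoundedMatrix f}
  add_mem' hf hg := IsBoundedMatrix.add hf hg
  zero_mem' := by
    refine ⟨0, fun α β _ _ p q => ⟨le_rfl, ?_⟩⟩
    have e : block (fun i j => (0 : X.X i ⟶ Y.X j)) p q = 0 := rfl
    refine pos_iff.2 ⟨0, ?_⟩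
    change _ - block (fun i j => (0 : X.X i ⟶ Y.X j)) p q ≫ _ = _
    rw [e]; simp
  smul_mem' c _ hf := IsBoundedMatrix.smul hf c

/-- The product of two bounded matrices. -/
noncomputable def mul {X Y Z : DirectSumCompletion C} (f : boundedMatrices X Y)
    (g : boundedMatrices Y Z) : boundedMatrices X Z :=
  ⟨(IsBoundedMatrix.exists_product f.2 g.2).choose,
    (IsBoundedMatrix.exists_product f.2 g.2).choose_spec.bounded f.2 g.2⟩

theorem mul_spec {X Y Z : DirectSumCompletion C} (f : boundedMatrices X Y)
    (g : boundedMatrices Y Z) : IsMatrixProduct f.1 g.1 (mul f g).1 :=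
  (IsBoundedMatrix.exists_product f.2 g.2).choose_spec

theorem mul_eq {X Y Z : DirectSumCompletion C} {f : boundedMatrices X Y}
    {g : boundedMatrices Y Z} {h : boundedMatrices X Z} (H : IsMatrixProduct f.1 g.1 h.1) :
    mul f g = h := Subtype.ext ((mul_spec f g).unique H)

theorem map_smul_embedding {x y : C} (c : ℂ) (f : x ⟶ y) :
    (Mat_.embedding C).map (c • f) = c • (Mat_.embedding C).map f := rfl

theorem add_mul {X Y Z : DirectSumCompletion C} (f f' : boundedMatrices X Y)
    (g : boundedMatrices Y Z) : mul (f + f') g = mul f g + mul f' g := mul_eq fun i k => by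
  have := (mul_spec f g i k).add (mul_spec f' g i k)
  simp only [← Functor.map_add, ← Preadditive.add_comp] at this
  exact this

theorem mul_add {X Y Z : DirectSumCompletion C} (f : boundedMatrices X Y)
    (g g' : boundedMatrices Y Z) : mul f (g + g') = mul f g + mul f g' := mul_eq fun i k => by
  have := (mul_spec f g i k).add (mul_spec f g' i k)
  simp only [← Functor.map_add, ← Preadditive.comp_add] at this
  exact this

theorem smul_mul {X Y Z : DirectSumCompletion C} (c : ℂ) (f : boundedMatrices X Y)
    (g : boundedMatrices Y Z) : mul (c • f) g = c • mul f g := mul_eq fun i k => by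
  have := (mul_spec f g i k).smul c
  simp only [← map_smul_embedding, ← Linear.smul_comp] at this
  exact this

theorem mul_smul {X Y Z : DirectSumCompletion C} (c : ℂ) (f : boundedMatrices X Y)
    (g : boundedMatrices Y Z) : mul f (c • g) = c • mul f g := mul_eq fun i k => by
  have := (mul_spec f g i k).smul c
  simp only [← map_smul_embedding, ← Linear.comp_smul] at this
  exact this

/-- The adjoint of a bounded matrix. -/
def adj {X Y : DirectSumCompletion C} (f : boundedMatrices X Y) : boundedMatrices Y X :=
  ⟨fun i j => (f.1 j i)†, IsBoundedMatrix.dag f.2⟩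

theorem adj_adj {X Y : DirectSumCompletion C} (f : boundedMatrices X Y) : adj (adj f) = f :=
  Subtype.ext (by funext i j; exact StarCategory.dag_dag _)

theorem adj_mul {X Y Z : DirectSumCompletion C} (f : boundedMatrices X Y)
    (g : boundedMatrices Y Z) : adj (mul f g) = mul (adj g) (adj f) :=
  (mul_eq (f := adj g) (g := adj f) (h := adj (mul f g)) (mul_spec f g).dag).symm

theorem adj_add {X Y : DirectSumCompletion C} (f g : boundedMatrices X Y) :
    adj (f + g) = adj f + adj g :=
  Subtype.ext (by funext i j; exact StarCategory.dag_add _ _)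

theorem adj_smul {X Y : DirectSumCompletion C} (c : ℂ) (f : boundedMatrices X Y) :
    adj (c • f) = (starRingEnd ℂ) c • adj f :=
  Subtype.ext (by funext i j; exact StarCategory.dag_smul _ _)

noncomputable instance : Category.{v} (DirectSumCompletion C) where
  Hom X Y := boundedMatrices X Y
  id X := ⟨idMatrix X.X, idMatrix_bounded X.X⟩
  comp f g := mul f g
  id_comp f := mul_eq (idMatrix_mul f.1)
  comp_id f := mul_eq (mul_idMatrix f.1)
  assoc f g h := Subtype.ext (IsMatrixProduct.assoc f.2 g.2 h.2 (mul_spec f g) (mul_spec g h)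
    (mul_spec _ _) (mul_spec _ _))

noncomputable instance : Preadditive (DirectSumCompletion C) where
  homGroup X Y := inferInstanceAs (AddCommGroup (boundedMatrices X Y))
  add_comp _ _ _ f f' g := add_mul f f' g
  comp_add _ _ _ f g g' := mul_add f g g'

noncomputable instance : Linear ℂ (DirectSumCompletion C) where
  homModule X Y := inferInstanceAs (Module ℂ (boundedMatrices X Y))
  smul_comp _ _ _ c f g := smul_mul c f g
  comp_smul _ _ _ f c g := mul_smul c f g

noncomputable instance : StarCategory (DirectSumCompletion C) where
  dag f := adj f
  dag_dag f := adj_adj f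
  dag_comp f g := adj_mul f g
  dag_add f g := adj_add f g
  dag_smul c f := adj_smul c f

end DirectSumCompletion
end Completion

section Functors

theorem PreservesSups.of_bijective {A B : Type*} [Ring A] [StarRing A] [Ring B] [StarRing B]
    (f : A → B) (hf : Function.Bijective f) (hsub : ∀ a b, f (a - b) = f a - f b)
    (hstar : ∀ a, f (star a * a) = star (f a) * f a) : PreservesSups f := by
  have key : ∀ a, IsPos (f a) ↔ IsPos a := by
    intro a
    constructor
    · rintro ⟨b, hb⟩
      obtain ⟨b, rfl⟩ := hf.2 b
      exact ⟨b, hf.1 (by rw [hb, hstar])⟩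
    · rintro ⟨b, rfl⟩
      exact ⟨f b, hstar b⟩
  intro S _ _ _ a ha
  refine ⟨?_, ?_⟩
  · rintro _ ⟨s, hs, rfl⟩
    rw [← hsub, key]
    exact ha.1 s hs
  · intro b hb
    obtain ⟨b, rfl⟩ := hf.2 b
    rw [← hsub, key]
    refine ha.2 b fun s hs => ?_
    have := hb _ ⟨s, hs, rfl⟩
    rwa [← hsub, key] at this

universe u₁ u₂ u₃
variable {C : Type u₁} [Category.{v} C] [Preadditive C] [Linear ℂ C] [StarCategory C]
variable {D : Type u₂} [Category.{v} D] [Preadditive D] [Linear ℂ D] [StarCategory D]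
variable {E : Type u₃} [Category.{v} E] [Preadditive E] [Linear ℂ E] [StarCategory E]

/-- The effect of a functor on formal finite sums of objects. -/
def matObj (F : C ⥤ D) (X : Mat_ C) : Mat_ D := ⟨X.ι, fun i => F.obj (X.X i)⟩

/-- The effect of a functor on matrices of morphisms, entry by entry. -/
def matMap (F : C ⥤ D) {X Y : Mat_ C} (f : X ⟶ Y) : matObj F X ⟶ matObj F Y :=
  matOf fun i j => F.map (f i j)

/-- The map of endomorphism algebras induced by a functor. -/
def endMap (F : C ⥤ D) (X : Mat_ C) : End X → End (matObj F X) := fun f => matMap F f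

/-- A linear functor that preserves the dagger. -/
structure IsStarFunctor (F : C ⥤ D) : Prop where
  map_add : ∀ {X Y : C} (f g : X ⟶ Y), F.map (f + g) = F.map f + F.map g
  map_smul : ∀ {X Y : C} (c : ℂ) (f : X ⟶ Y), F.map (c • f) = c • F.map f
  map_dag : ∀ {X Y : C} (f : X ⟶ Y), F.map (f†) = (F.map f)†

/-- A functor between W*-categories: a *-functor that induces normal homomorphisms
`End X → End (F X)` for all formal finite direct sums `X` of objects. -/
structure IsWStarFunctor (F : C ⥤ D) : Prop extends IsStarFunctor F where
  normal : ∀ X : Mat_ C, PreservesSups (endMap F X)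

namespace IsStarFunctor
variable {F : C ⥤ D} {G : D ⥤ E}

theorem map_sub (hF : IsStarFunctor F) {X Y : C} (f g : X ⟶ Y) :
    F.map (f - g) = F.map f - F.map g := by
  have := hF.map_add (f - g) g
  rw [sub_add_cancel] at this
  rw [this, add_sub_cancel_right]

theorem map_zero (hF : IsStarFunctor F) (X Y : C) : F.map (0 : X ⟶ Y) = 0 := by
  have := hF.map_sub (0 : X ⟶ Y) 0
  simpa using this

theorem map_sum (hF : IsStarFunctor F) {X Y : C} {ι : Type*} (s : Finset ι) (f : ι → (X ⟶ Y)) :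
    F.map (∑ i ∈ s, f i) = ∑ i ∈ s, F.map (f i) := by
  classical
  induction s using Finset.induction_on with
  | empty => exact hF.map_zero X Y
  | insert a s ha ih => rw [Finset.sum_insert ha, Finset.sum_insert ha, hF.map_add, ih]

theorem matMap_comp (hF : IsStarFunctor F) {X Y Z : Mat_ C} (f : X ⟶ Y) (g : Y ⟶ Z) :
    matMap F (f ≫ g) = matMap F f ≫ matMap F g := by
  ext i j
  change F.map ((f ≫ g) i j) = _
  refine (congrArg F.map (Mat_.comp_apply f g i j)).trans ((hF.map_sum _ _).trans ?_)
  exact Finset.sum_congr rfl fun k _ => F.map_comp _ _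

theorem matMap_dag (hF : IsStarFunctor F) {X Y : Mat_ C} (f : X ⟶ Y) :
    matMap F (f†) = (matMap F f)† := by
  ext i j
  exact hF.map_dag _

theorem matMap_sub (hF : IsStarFunctor F) {X Y : Mat_ C} (f g : X ⟶ Y) :
    matMap F (f - g) = matMap F f - matMap F g := by
  have e : ∀ f g : X ⟶ Y, matMap F (f + g) = matMap F f + matMap F g := by
    intro f g
    ext i j
    exact hF.map_add _ _
  have := e (f - g) g
  rw [sub_add_cancel] at this
  rw [this, add_sub_cancel_right]

theorem matMap_star_mul (hF : IsStarFunctor F) {X : Mat_ C} (f : End X) :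
    endMap F X (star f * f) = star (endMap F X f) * endMap F X f := by
  change matMap F (f ≫ StarCategory.dag f) = matMap F f ≫ (matMap F f)†
  rw [hF.matMap_comp, hF.matMap_dag]

theorem isWStarFunctor (hF : IsStarFunctor F) [F.Full] [F.Faithful] : IsWStarFunctor F where
  toIsStarFunctor := hF
  normal X := by
    refine PreservesSups.of_bijective _ ⟨?_, ?_⟩ (fun f g => hF.matMap_sub f g)
      fun f => hF.matMap_star_mul f
    · intro f g h
      refine Mat_.hom_ext (M := X) (N := X) _ _ fun i j => F.map_injective ?_
      exact congrFun (congrFun h i) j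
    · intro g
      refine ⟨matOf fun i j => F.preimage (X := X.X i) (Y := X.X j) (g i j), ?_⟩
      refine Mat_.hom_ext (M := matObj F X) (N := matObj F X) _ _ fun i j => ?_
      exact F.map_preimage _

theorem comp (hF : IsStarFunctor F) (hG : IsStarFunctor G) : IsStarFunctor (F ⋙ G) where
  map_add f g := by simp [hF.map_add, hG.map_add]
  map_smul c f := by simp [hF.map_smul, hG.map_smul]
  map_dag f := by simp [hF.map_dag, hG.map_dag]

end IsStarFunctor

theorem IsWStarFunctor.comp {F : C ⥤ D} {G : D ⥤ E} (hF : IsWStarFunctor F)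
    (hG : IsWStarFunctor G) : IsWStarFunctor (F ⋙ G) where
  toIsStarFunctor := hF.toIsStarFunctor.comp hG.toIsStarFunctor
  normal X := by
    intro S hS hdir hpos a ha
    have pos : ∀ f : End X, IsPos f → IsPos (endMap F X f) := by
      rintro _ ⟨b, rfl⟩
      exact ⟨endMap F X b, hF.matMap_star_mul b⟩
    have h1 := hF.normal X S hS hdir hpos a ha
    have h2 := hG.normal (matObj F X) _ (hS.image _) (by
      rintro _ ⟨s, hs, rfl⟩ _ ⟨t, ht, rfl⟩
      obtain ⟨w, hw, h1, h2⟩ := hdir s hs t ht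
      refine ⟨_, ⟨w, hw, rfl⟩, ?_, ?_⟩
      · have := pos _ h1
        rwa [show endMap F X (w - s) = _ from hF.matMap_sub w s] at this
      · have := pos _ h2
        rwa [show endMap F X (w - t) = _ from hF.matMap_sub w t] at this)
      (by rintro _ ⟨s, hs, rfl⟩; exact pos _ (hpos s hs)) _ h1
    rw [Set.image_image] at h2
    exact h2

theorem NormLE.of_map {F : C ⥤ D} (hF : IsStarFunctor F) [F.Full] [F.Faithful] {X Y : C}
    {f : X ⟶ Y} {r : ℝ} (h : NormLE (F.map f) r) : NormLE f r := by
  refine ⟨h.1, ?_⟩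
  obtain ⟨b, hb⟩ := pos_iff.1 h.2
  obtain ⟨b, rfl⟩ := F.map_surjective b
  refine pos_iff.2 ⟨b, F.map_injective ?_⟩
  rw [hF.map_sub, hF.map_smul, F.map_id, F.map_comp, F.map_comp, hF.map_dag, hF.map_dag, hb]

theorem NormLE.map {F : C ⥤ D} (hF : IsStarFunctor F) {X Y : C}
    {f : X ⟶ Y} {r : ℝ} (h : NormLE f r) : NormLE (F.map f) r := by
  refine ⟨h.1, ?_⟩
  obtain ⟨b, hb⟩ := pos_iff.1 h.2
  refine pos_iff.2 ⟨F.map b, ?_⟩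
  rw [← hF.map_dag, ← hF.map_dag, ← F.map_comp, ← F.map_comp, ← hb, hF.map_sub, hF.map_smul,
    F.map_id]

theorem isStarFunctor_embedding : IsStarFunctor (Mat_.embedding C) where
  map_add _ _ := Functor.map_add _
  map_smul _ _ := rfl
  map_dag _ := rfl

section Func
variable (C D)
variable [WStarCategory D]

theorem NormLE.comp' {X Y Z : D} {f : X ⟶ Y} {g : Y ⟶ Z} {r s : ℝ} (hf : NormLE f r)
    (hg : NormLE g s) : NormLE (f ≫ g) (r * s) := by
  refine NormLE.of_map isStarFunctor_embedding ?_
  rw [Functor.map_comp]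
  exact (hf.map isStarFunctor_embedding).comp (hg.map isStarFunctor_embedding)

theorem normLE_id (X : D) : NormLE (𝟙 X) 1 :=
  ⟨zero_le_one, pos_iff.2 ⟨0, by simp⟩⟩

/-- The objects of the category of functors between two W*-categories. -/
structure Func where
  functor : C ⥤ D
  isWStarFunctor : IsWStarFunctor functor

variable {C D}

/-- A natural transformation is bounded if its components are bounded in norm by a constant. -/
def IsBoundedTrans {F G : C ⥤ D} (α : F ⟶ G) : Prop := ∃ r : ℝ, ∀ c, NormLE (α.app c) r

/-- The category `Func(C, D)` of functors and bounded natural transformations. -/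
instance : Category (Func C D) where
  Hom F G := { α : F.functor ⟶ G.functor // IsBoundedTrans α }
  id F := ⟨𝟙 F.functor, 1, fun c => normLE_id D (F.functor.obj c)⟩
  comp α β := ⟨α.1 ≫ β.1, by
    obtain ⟨r, hr⟩ := α.2
    obtain ⟨s, hs⟩ := β.2
    exact ⟨r * s, fun c => (hr c).comp' D (hs c)⟩⟩
  id_comp α := Subtype.ext (Category.id_comp α.1)
  comp_id α := Subtype.ext (Category.comp_id α.1)
  assoc α β γ := Subtype.ext (Category.assoc α.1 β.1 γ.1)

variable (D) in
/-- The restriction functor `Func(E, D) → Func(C, D)` along a functor `J : C → E`. -/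
def restriction (J : C ⥤ E) (hJ : IsWStarFunctor J) : Func E D ⥤ Func C D where
  obj F := ⟨J ⋙ F.functor, hJ.comp F.isWStarFunctor⟩
  map α := ⟨Functor.whiskerLeft J α.1, by
    obtain ⟨r, hr⟩ := α.2
    exact ⟨r, fun c => hr (J.obj c)⟩⟩
  map_id F := rfl
  map_comp α β := rfl

end Func

section DirectSums

/-- `x` is the orthogonal direct sum of the `c i`, with inclusions `inc i`: one has
`(inc i)* (inc j) = δ i j`, and the identity of `x` is the supremum of the finite partial sums of
`∑ i, (inc i) (inc i)*`. -/
structure IsOrthogonalDirectSum {ι : Type*} (c : ι → D) (x : D) (inc : ∀ i, c i ⟶ x) : Prop where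
  isometry : ∀ i, inc i ≫ (inc i)† = 𝟙 (c i)
  orthogonal : ∀ i j, i ≠ j → inc i ≫ (inc j)† = 0
  sum_eq : IsSup (A := End x)
    (Set.range fun s : Finset ι => (∑ i ∈ s, (inc i)† ≫ inc i : x ⟶ x)) (𝟙 x)

variable (D)

/-- Every family of objects that is indexed by a set has an orthogonal direct sum. -/
def AdmitsAllDirectSums : Prop :=
  ∀ (ι : Type v) (c : ι → D), ∃ (x : D) (inc : ∀ i, c i ⟶ x), IsOrthogonalDirectSum c x inc

/-- Every projection `p = p² = p*` splits as `p = i i*` with `i* i = 1`. -/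
def IsIdempotentComplete : Prop :=
  ∀ (x : D) (p : x ⟶ x), p ≫ p = p → p† = p →
    ∃ (y : D) (i : y ⟶ x), i† ≫ i = p ∧ i ≫ i† = 𝟙 y

/-- Cauchy complete: all orthogonal direct sums exist and all projections split. -/
def IsCauchyComplete : Prop := AdmitsAllDirectSums D ∧ IsIdempotentComplete D

end DirectSums

end Functors

section Corner
open ContinuousLinearMap

theorem VNRep.isWStarAlgebra {A : Type v} [Ring A] [StarRing A] [Algebra ℂ A] (R : VNRep A) :
    IsWStarAlgebra A := by
  let S : StarSubalgebra ℂ (R.H →L[ℂ] R.H) := R.π.range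
  have hS : Set.centralizer (Set.centralizer S.carrier) = S.carrier := by
    apply Set.Subset.antisymm
    · intro T hT
      obtain ⟨a, ha⟩ := R.bicomm T fun Q hQ => hT Q (by
        rintro _ ⟨a, rfl⟩
        exact (hQ a).symm)
      exact ⟨a, ha⟩
    · intro T hT Q hQ
      exact (hQ T hT).symm
  let V : VonNeumannAlgebra R.H := { S with centralizer_centralizer' := hS }
  exact ⟨R.H, inferInstance, inferInstance, inferInstance, V,
    ⟨StarAlgEquiv.ofInjective R.π R.inj⟩⟩

/-- A corner of a W*-algebra is a W*-algebra. -/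
theorem IsWStarAlgebra.corner {A B : Type v} [Ring A] [StarRing A] [Algebra ℂ A]
    [Ring B] [StarRing B] [Algebra ℂ B] [StarModule ℂ B] (hA : IsWStarAlgebra A) (φ : B → A)
    (hinj : Function.Injective φ) (hadd : ∀ a b, φ (a + b) = φ a + φ b)
    (hsmul : ∀ (c : ℂ) a, φ (c • a) = c • φ a) (hmul : ∀ a b, φ (a * b) = φ a * φ b)
    (hstar : ∀ a, φ (star a) = star (φ a))
    (hrange : ∀ a, φ 1 * a * φ 1 = a → ∃ b, φ b = a) : IsWStarAlgebra B := by
  obtain ⟨R⟩ := hA.rep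
  set p := φ 1 with hp
  have hpp : p * p = p := by rw [hp, ← hmul, one_mul]
  have hps : star p = p := by rw [hp, ← hstar, star_one]
  have hpl : ∀ b, p * φ b = φ b := fun b => by rw [hp, ← hmul, one_mul]
  have hpr : ∀ b, φ b * p = φ b := fun b => by rw [hp, ← hmul, mul_one]
  let P : R.H →L[ℂ] R.H := R.π p
  have hPP : ∀ x, P (P x) = P x := fun x => by
    change (R.π p * R.π p) x = R.π p x
    rw [← map_mul, hpp]
  have hPs : adjoint P = P := by
    change star (R.π p) = R.π p
    rw [← map_star, hps]
  let K : Submodule ℂ R.H := LinearMap.ker ((1 - P : R.H →L[ℂ] R.H) : R.H →ₗ[ℂ] R.H)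
  have hK : ∀ x, x ∈ K ↔ P x = x := fun x => by
    change x - P x = 0 ↔ _
    rw [sub_eq_zero, eq_comm]
  have hKc : IsClosed (K : Set R.H) := (1 - P : R.H →L[ℂ] R.H).isClosed_ker
  have : CompleteSpace K := hKc.completeSpace_coe
  let i : K →L[ℂ] R.H := K.subtypeL
  let q : R.H →L[ℂ] K := P.codRestrict K fun x => (hK _).2 (hPP x)
  have hiq : ∀ x, i (q x) = P x := fun x => rfl
  have hqi : ∀ x, q (i x) = x := fun x => Subtype.ext ((hK _).1 x.2)
  have hadj : adjoint i = q := by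
    refine (eq_adjoint_iff q i |>.2 fun x y => ?_).symm
    change inner ℂ (P x) (y : R.H) = inner ℂ x (y : R.H)
    rw [← adjoint_inner_right, hPs, (hK _).1 y.2]
  have hadj' : adjoint q = i := by rw [← hadj, adjoint_adjoint]
  have hPl : ∀ b x, P (R.π (φ b) x) = R.π (φ b) x := fun b x => by
    change (R.π p * R.π (φ b)) x = _
    rw [← map_mul, hpl]
  have hPr : ∀ b x, R.π (φ b) (P x) = R.π (φ b) x := fun b x => by
    change (R.π (φ b) * R.π p) x = _
    rw [← map_mul, hpr]
  let ρ : B → (K →L[ℂ] K) := fun b => q ∘L R.π (φ b) ∘L i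
  have hρ : ∀ b x, i (ρ b x) = R.π (φ b) (i x) := fun b x => by
    change P (R.π (φ b) (i x)) = _
    rw [hPl]
  have hi : Function.Injective i := Subtype.val_injective
  have hφ0 : φ 0 = 0 := by simpa using hadd 0 0
  let π' : B →⋆ₐ[ℂ] (K →L[ℂ] K) :=
    { toFun := ρ
      map_one' := by
        ext1 x; apply hi
        rw [hρ]; exact (hK _).1 x.2
      map_mul' := fun a b => by
        ext1 x; apply hi
        rw [hρ, hmul, map_mul, mul_apply_eq_comp, mul_apply_eq_comp, hρ, hρ]
      map_zero' := by
        ext1 x; apply hi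
        rw [hρ, hφ0, map_zero]; simp
      map_add' := fun a b => by
        ext1 x; apply hi
        rw [hρ, hadd, map_add, add_apply, add_apply, map_add, hρ, hρ]
      commutes' := fun c => by
        ext1 x; apply hi
        rw [hρ, Algebra.algebraMap_eq_smul_one, hsmul, map_smul, smul_apply,
          Algebra.algebraMap_eq_smul_one, smul_apply, map_smul]
        congr 1
        exact (hK _).1 x.2
      map_star' := fun a => by
        change q ∘L R.π (φ (star a)) ∘L i = adjoint (q ∘L R.π (φ a) ∘L i)
        rw [adjoint_comp, adjoint_comp, hadj, hadj', hstar, map_star]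
        rfl }
  refine VNRep.isWStarAlgebra { H := K, π := π', inj := ?_, bicomm := ?_ }
  · intro a b hab
    apply hinj
    apply R.inj
    ext x
    have h1 : i (ρ a (q x)) = i (ρ b (q x)) :=
      congrArg (fun T : K →L[ℂ] K => i (T (q x))) hab
    rw [hρ, hρ, hiq, hPr, hPr] at h1
    exact h1
  · intro T hT
    obtain ⟨a, ha⟩ := R.bicomm (i ∘L T ∘L q) fun Q hQ => by
      have hQP : ∀ x, Q (P x) = P (Q x) := fun x =>
        congrArg (fun Z : R.H →L[ℂ] R.H => Z x) (hQ p)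
      have hQi : ∀ x, i (q (Q (i x))) = Q (i x) := fun x => by
        rw [hiq, ← hQP]
        exact congrArg Q ((hK _).1 x.2)
      have hc := hT (q ∘L Q ∘L i) fun b => by
        ext1 x; apply hi
        change i (q (Q (i (ρ b x)))) = i (ρ b (q (Q (i x))))
        rw [hρ, hρ, hQi, hiq, ← hQP, hPl]
        exact congrArg (fun Z : R.H →L[ℂ] R.H => Z (i x)) (hQ (φ b))
      ext x
      have h1 := congrArg (fun Z : K →L[ℂ] K => i (Z (q x))) hc
      change i (q (Q (i (T (q x))))) = i (T (q (Q (i (q x))))) at h1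
      change Q (i (T (q x))) = i (T (q (Q x)))
      rw [hQi] at h1
      rw [h1]
      congr 2
      apply hi
      rw [hiq, hiq, hiq, hQP, hPP]
    obtain ⟨b, rfl⟩ := hrange a (by
      apply R.inj
      rw [map_mul, map_mul, ha]
      ext x
      change P (i (T (q (P x)))) = i (T (q x))
      rw [show q (P x) = q x from hi (hPP x)]
      exact (hK _).1 (T (q x)).2)
    refine ⟨b, ?_⟩
    ext1 x; apply hi
    change i (ρ b x) = _
    rw [hρ, ha]
    change i (T (q (i x))) = _
    rw [hqi]

end Corner

section IdempotentCompletion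
variable (C : Type u) [Category.{v} C] [Preadditive C] [Linear ℂ C] [StarCategory C]

/-- The idempotent completion: its objects are the pairs of an object and a projection on it. -/
structure IdempotentCompletion where
  X : C
  p : X ⟶ X
  idem : p ≫ p = p
  dag_eq : p† = p

variable {C}
namespace IdempotentCompletion

/-- The morphisms from `(x, p)` to `(y, q)` are the morphisms `q f p` from `x` to `y`. -/
def homs (P Q : IdempotentCompletion C) : Submodule ℂ (P.X ⟶ Q.X) where
  carrier := {f | P.p ≫ f ≫ Q.p = f}
  add_mem' {f g} hf hg := by
    change P.p ≫ (f + g) ≫ Q.p = f + g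
    rw [Preadditive.add_comp, Preadditive.comp_add]
    exact congrArg₂ _ hf hg
  zero_mem' := by
    change P.p ≫ 0 ≫ Q.p = 0
    simp
  smul_mem' c f hf := by
    change P.p ≫ (c • f) ≫ Q.p = c • f
    rw [Linear.smul_comp, Linear.comp_smul]
    exact congrArg _ hf

theorem p_comp {P Q : IdempotentCompletion C} {f : P.X ⟶ Q.X} (hf : f ∈ homs P Q) :
    P.p ≫ f = f := by
  have h : P.p ≫ f ≫ Q.p = f := hf
  rw [← h, ← Category.assoc P.p P.p, P.idem]

theorem comp_p {P Q : IdempotentCompletion C} {f : P.X ⟶ Q.X} (hf : f ∈ homs P Q) :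
    f ≫ Q.p = f := by
  have h : P.p ≫ f ≫ Q.p = f := hf
  rw [← h]
  simp [Q.idem]

theorem mem_homs {P Q : IdempotentCompletion C} {f : P.X ⟶ Q.X} (h1 : P.p ≫ f = f)
    (h2 : f ≫ Q.p = f) : f ∈ homs P Q := by
  change P.p ≫ f ≫ Q.p = f
  rw [h2, h1]

instance : Category.{v} (IdempotentCompletion C) where
  Hom P Q := homs P Q
  id P := ⟨P.p, mem_homs P.idem P.idem⟩
  comp f g := ⟨f.1 ≫ g.1, mem_homs (by rw [← Category.assoc, p_comp f.2])
    (by rw [Category.assoc, comp_p g.2])⟩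
  id_comp f := Subtype.ext (p_comp f.2)
  comp_id f := Subtype.ext (comp_p f.2)
  assoc f g h := Subtype.ext (Category.assoc f.1 g.1 h.1)

instance : Preadditive (IdempotentCompletion C) where
  homGroup P Q := inferInstanceAs (AddCommGroup (homs P Q))
  add_comp _ _ _ f f' g := Subtype.ext (Preadditive.add_comp _ _ _ f.1 f'.1 g.1)
  comp_add _ _ _ f g g' := Subtype.ext (Preadditive.comp_add _ _ _ f.1 g.1 g'.1)

instance : Linear ℂ (IdempotentCompletion C) where
  homModule P Q := inferInstanceAs (Module ℂ (homs P Q))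
  smul_comp _ _ _ c f g := Subtype.ext (Linear.smul_comp _ _ _ c f.1 g.1)
  comp_smul _ _ _ f c g := Subtype.ext (Linear.comp_smul _ _ _ f.1 c g.1)

instance : StarCategory (IdempotentCompletion C) where
  dag {P Q} f := ⟨f.1†, mem_homs
    (by rw [← Q.dag_eq, ← StarCategory.dag_comp, comp_p f.2])
    (by rw [← P.dag_eq, ← StarCategory.dag_comp, p_comp f.2])⟩
  dag_dag f := Subtype.ext (StarCategory.dag_dag f.1)
  dag_comp f g := Subtype.ext (StarCategory.dag_comp f.1 g.1)
  dag_add f g := Subtype.ext (StarCategory.dag_add f.1 g.1)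
  dag_smul c f := Subtype.ext (StarCategory.dag_smul c f.1)

/-- The underlying morphism. -/
def val {P Q : IdempotentCompletion C} (f : P ⟶ Q) : P.X ⟶ Q.X := f.1

theorem val_sum {P Q : IdempotentCompletion C} {κ : Type*} (s : Finset κ) (f : κ → (P ⟶ Q)) :
    val (∑ i ∈ s, f i) = ∑ i ∈ s, val (f i) := by
  classical
  induction s using Finset.induction_on with
  | empty => rfl
  | insert a s ha ih =>
    rw [Finset.sum_insert ha, Finset.sum_insert ha, ← ih]
    rfl

variable (C) in
/-- The inclusion `x ↦ (x, id)` of a category in its idempotent completion. -/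
def inclusion : C ⥤ IdempotentCompletion C where
  obj x := ⟨x, 𝟙 x, Category.id_comp _, dag_id x⟩
  map f := ⟨f, mem_homs (Category.id_comp _) (Category.comp_id _)⟩
  map_id _ := rfl
  map_comp _ _ := rfl

instance : (inclusion C).Full where
  map_surjective f := ⟨f.1, rfl⟩

instance : (inclusion C).Faithful where
  map_injective h := congrArg Subtype.val h

theorem inclusion_isStarFunctor : IsStarFunctor (inclusion C) where
  map_add _ _ := rfl
  map_smul _ _ := rfl
  map_dag _ := rfl

instance [WStarCategory C] : WStarCategory (IdempotentCompletion C) where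
  isWStarAlgebra_end X := by
    classical
    let Y : Mat_ C := ⟨X.ι, fun i => (X.X i).X⟩
    let φ : End X → End Y := fun f => matOf (X := Y) (Y := Y) fun i j => val (f i j)
    have hφ : ∀ (f : End X) (i j : X.ι), φ f i j = val (f i j) := fun f i j => rfl
    have h1 : ∀ i, φ (𝟙 X) i i = (X.X i).p := fun i =>
      congrArg val (Mat_.id_apply_self X i)
    have h2 : ∀ i j, i ≠ j → φ (𝟙 X) i j = 0 := fun i j h =>
      congrArg val (Mat_.id_apply_of_ne X i j h)
    refine (WStarCategory.isWStarAlgebra_end Y).corner φ ?_ ?_ ?_ ?_ ?_ ?_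
    · intro f g h
      refine Mat_.hom_ext (M := X) (N := X) _ _ fun i j => Subtype.ext ?_
      exact congrFun (congrFun h i) j
    · intro f g; rfl
    · intro c f; rfl
    · intro f g
      refine Mat_.hom_ext (M := Y) (N := Y) _ _ fun i j => ?_
      refine (congrArg val (Mat_.comp_apply (M := X) (N := X) (K := X) g f i j)).trans ?_
      refine (val_sum _ _).trans ?_
      exact (Mat_.comp_apply (M := Y) (N := Y) (K := Y) (φ g) (φ f) i j).symm
    · intro f; rfl
    · intro a ha
      have ha' : (φ (𝟙 X) ≫ (a : Y ⟶ Y) ≫ φ (𝟙 X) : Y ⟶ Y) = a := ha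
      have e : ∀ i j : Y.ι, (X.X i).p ≫ (a : Y ⟶ Y) i j ≫ (X.X j).p = (a : Y ⟶ Y) i j := by
        intro i j
        have h3 := congrFun (congrFun ha' i) j
        have h4 : (φ (𝟙 X) ≫ (a : Y ⟶ Y) ≫ φ (𝟙 X) : Y ⟶ Y) i j =
            ∑ k, φ (𝟙 X) i k ≫ ∑ l, (a : Y ⟶ Y) k l ≫ φ (𝟙 X) l j := by
          refine (Mat_.comp_apply (M := Y) (N := Y) (K := Y) _ _ i j).trans ?_
          exact Finset.sum_congr rfl fun k _ => congrArg _
            (Mat_.comp_apply (M := Y) (N := Y) (K := Y) _ _ k j)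
        rw [h4, Finset.sum_eq_single i, Finset.sum_eq_single j, h1, h1] at h3
        · exact h3
        · intro l _ hl
          rw [h2 l j hl, Limits.comp_zero]
        · simp
        · intro k _ hk
          rw [h2 i k (Ne.symm hk), Limits.zero_comp]
        · simp
      exact ⟨matOf (X := X) (Y := X) fun i j => ⟨(a : Y ⟶ Y) i j, e i j⟩, rfl⟩

end IdempotentCompletion
end IdempotentCompletion

section Inclusion
variable {C : Type u} [Category.{v} C] [Preadditive C] [Linear ℂ C] [StarCategory C]

theorem normLE_zero {X Y : C} {r : ℝ} (hr : 0 ≤ r) : NormLE (0 : X ⟶ Y) r :=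
  ⟨hr, by simpa using (pos_one X).smul (sq_nonneg r)⟩

variable [WStarCategory C]

/-- A single morphism is a bounded matrix. -/
theorem isBoundedMatrix_single {x y : C} (f : x ⟶ y) :
    IsBoundedMatrix (X := fun _ : PUnit.{v + 1} => x) (Y := fun _ : PUnit.{v + 1} => y)
      (fun _ _ => f) := by
  obtain ⟨r, hr⟩ := exists_normLE ((Mat_.embedding C).map f)
  refine ⟨r, fun α β _ _ p q => ?_⟩
  rcases isEmpty_or_nonempty α with hα | ⟨⟨a⟩⟩
  · have : block (X := fun _ : PUnit.{v + 1} => x) (Y := fun _ : PUnit.{v + 1} => y)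
        (fun _ _ => f) p q = 0 := by
      ext i; exact isEmptyElim (α := α) i
    rw [this]
    exact normLE_zero hr.1
  rcases isEmpty_or_nonempty β with hβ | ⟨⟨b⟩⟩
  · have : block (X := fun _ : PUnit.{v + 1} => x) (Y := fun _ : PUnit.{v + 1} => y)
        (fun _ _ => f) p q = 0 := by
      ext i j; exact isEmptyElim (α := β) j
    rw [this]
    exact normLE_zero hr.1
  have ha : ∀ i, i = a := fun i => p.injective rfl
  have hb : ∀ i, i = b := fun i => q.injective rfl
  obtain ⟨c, hc⟩ := pos_iff.1 hr.2
  refine ⟨hr.1, pos_iff.2 ⟨matOf fun _ _ => c PUnit.unit PUnit.unit, ?_⟩⟩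
  have hs : ∀ (c : ℂ) (Z : Mat_ C) (u : Z ⟶ Z) (i : Z.ι),
      (c • 𝟙 Z - u) i i = c • 𝟙 (Z.X i) - u i i := by
    intro c Z u i
    rw [← Mat_.id_apply_self]
    rfl
  have h1 : ((r ^ 2 : ℝ) : ℂ) • 𝟙 x - f ≫ f† =
      c PUnit.unit PUnit.unit ≫ (c PUnit.unit PUnit.unit)† := by
    have := congrFun (congrFun hc PUnit.unit) PUnit.unit
    refine Eq.trans (Eq.trans ?_ this) (embedding_comp_apply (C := C)
      (W := (Mat_.embedding C).obj x) (Z := (Mat_.embedding C).obj x) c (c†)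
      PUnit.unit PUnit.unit)
    refine Eq.trans ?_ (hs _ ((Mat_.embedding C).obj x) _ PUnit.unit).symm
    congr 1
    · exact (embedding_comp_apply (C := C)
        (W := (Mat_.embedding C).obj x) (Z := (Mat_.embedding C).obj x)
        ((Mat_.embedding C).map f) (((Mat_.embedding C).map f)†) PUnit.unit PUnit.unit).symm
  ext i j
  obtain rfl := ha i
  obtain rfl := ha j
  refine (hs _ _ _ _).trans ?_
  rw [Mat_.comp_apply, Mat_.comp_apply]
  refine Eq.trans ?_ (h1.trans ?_)
  · congr 1
    refine (Finset.sum_eq_single b (fun k _ hk => (hk (hb k)).elim) (by simp)).trans ?_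
    rfl
  · symm
    refine (Finset.sum_eq_single j ?_ ?_).trans ?_
    · exact fun k _ hk => (hk (ha k)).elim
    · exact fun h => (h (Finset.mem_univ (α := α) j)).elim
    · rfl

namespace DirectSumCompletion

variable (C) in
/-- The inclusion of a category in its direct sum completion, as the one-term formal sums. -/
noncomputable def inclusion : C ⥤ DirectSumCompletion C where
  obj x := ⟨PUnit, fun _ => x⟩
  map f := ⟨fun _ _ => f, isBoundedMatrix_single f⟩
  map_id x := Subtype.ext (by
    funext i j; exact (idMatrix_self (fun _ : PUnit.{v + 1} => x) _).symm)
  map_comp {x y z} f g := (mul_eq (X := ⟨PUnit, fun _ => x⟩) (Y := ⟨PUnit, fun _ => y⟩)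
    (Z := ⟨PUnit, fun _ => z⟩) (f := ⟨fun _ _ => f, isBoundedMatrix_single f⟩)
    (g := ⟨fun _ _ => g, isBoundedMatrix_single g⟩)
    (h := ⟨fun _ _ => f ≫ g, isBoundedMatrix_single (f ≫ g)⟩)
    fun _ _ => HasUWSum.single PUnit.unit
      (a := fun _ : PUnit.{v + 1} => (Mat_.embedding C).map (f ≫ g))
      fun _ hj => (hj rfl).elim).symm

instance : (inclusion C).Full where
  map_surjective f := ⟨f.1 PUnit.unit PUnit.unit, rfl⟩

instance : (inclusion C).Faithful where
  map_injective h := congrFun (congrFun (congrArg Subtype.val h) PUnit.unit) PUnit.unit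

theorem inclusion_isStarFunctor : IsStarFunctor (inclusion C) where
  map_add _ _ := rfl
  map_smul _ _ := rfl
  map_dag _ := rfl

end DirectSumCompletion

variable (C) in
/-- The Cauchy completion: the direct sum completion of the idempotent completion. -/
abbrev CauchyCompletion : Type (max (max u v) (v + 1)) :=
  DirectSumCompletion.{v, max u v} (IdempotentCompletion C)

variable (C) in
/-- The composite inclusion of a category in its Cauchy completion. -/
noncomputable def CauchyCompletion.inclusion : C ⥤ CauchyCompletion C :=
  IdempotentCompletion.inclusion C ⋙ DirectSumCompletion.inclusion (IdempotentCompletion C)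

theorem DirectSumCompletion.inclusion_isWStarFunctor :
    IsWStarFunctor (DirectSumCompletion.inclusion C) :=
  DirectSumCompletion.inclusion_isStarFunctor.isWStarFunctor

theorem CauchyCompletion.inclusion_isWStarFunctor :
    IsWStarFunctor (CauchyCompletion.inclusion C) :=
  IdempotentCompletion.inclusion_isStarFunctor.isWStarFunctor.comp
    DirectSumCompletion.inclusion_isWStarFunctor

end Inclusion

end WStar

/-!
The restriction functors are shown to be faithful, full and essentially surjective, separately for
the direct sum completion and for the idempotent completion; the Cauchy completion is the composite
of the two.

*Direct sums.* Every formal direct sum `Y` is the orthogonal direct sum of its terms in the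
completion (`DirectSumCompletion.isOrthogonalDirectSum_inc`), and functors of W*-categories preserve
orthogonal direct sums (`IsOrthogonalDirectSum.map`). A morphism out of an orthogonal direct sum is
determined by its restrictions to the terms, which gives faithfulness. For fullness, a bounded
natural transformation `β` between the restrictions of `F` and `G` is extended to `Y` by the
diagonal morphism with entries `β (Y.X i)`; the uniform bound on `β` makes the sum of its entries
converge ultraweakly with the same bound (`IsOrthogonalDirectSum.exists_diagonal`). For essential
surjectivity, a functor `F` on `C` is first extended entrywise to `C^⊕ → D^⊕`
(`DirectSumCompletion.mapFunctor`) and then composed with the functor `D^⊕ → D` that sends a formal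
direct sum to a chosen orthogonal direct sum of its terms (`sumFunctor`).

The analytic content is in the existence of these two functors. The entrywise extension is
multiplicative because a functor that is normal on all finite matrix algebras is ultraweakly
continuous (`IsWStarFunctor.hasUWSum`), and it is normal because both positivity and suprema in the
direct sum completion are detected by finite principal blocks
(`DirectSumCompletion.isPos_of_blocks`, `DirectSumCompletion.isSup_block`). The first of these
holds because a bounded matrix whose principal blocks are positive has a square root, formed in the
C*-algebra of bounded matrices. The summation functor is fully faithful, since every bounded matrix
between the terms is the matrix of a unique morphism between the sums
(`IsOrthogonalDirectSum.exists_hom`), and so it is normal.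

*Idempotents.* The object `(x, p)` is the range of the projection `p` on `(x, 1)`, by an isometry
which determines and bounds the extension of a natural transformation. A functor is extended by
splitting the projections `F p` in `D` (`IdempotentCompletion.lift`). The extension is normal since
the passages between an endomorphism algebra and its corners preserve suprema.
-/

namespace WStar

open CategoryTheory Filter Topology
open scoped ComplexOrder

set_option linter.unusedSectionVars false

/-! ### Ultraweak limits of nets -/

section Limits
variable {C : Type u} [Category.{v} C] [Preadditive C] [Linear ℂ C] [StarCategory C]

/-- Ultraweak convergence of a family of morphisms along a filter, tested as in `HasUWSum`. -/
def UWTendsto {X Y : C} {ι : Type*} (l : Filter ι) (a : ι → (X ⟶ Y)) (h : X ⟶ Y) : Prop :=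
  ∀ (W : C) (u : W ⟶ X) (w : Y ⟶ W) (ω : End W →ₗ[ℂ] ℂ), IsNormalFunctional ω →
    Tendsto (fun i => ω (u ≫ a i ≫ w)) l (𝓝 (ω (u ≫ h ≫ w)))

namespace UWTendsto
variable {ι : Type*} {l : Filter ι} {X Y Z : C}

theorem comp_right {a : ι → (X ⟶ Y)} {h : X ⟶ Y} (H : UWTendsto l a h) (g : Y ⟶ Z) :
    UWTendsto l (fun i => a i ≫ g) (h ≫ g) := fun W u w ω hω => by
  simpa using H W u (g ≫ w) ω hω

theorem comp_left {a : ι → (Y ⟶ Z)} {h : Y ⟶ Z} (H : UWTendsto l a h) (g : X ⟶ Y) :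
    UWTendsto l (fun i => g ≫ a i) (g ≫ h) := fun W u w ω hω => by
  simpa using H W (u ≫ g) w ω hω

theorem sum {κ : Type*} (s : Finset κ) {a : κ → ι → (X ⟶ Y)} {h : κ → (X ⟶ Y)}
    (H : ∀ k ∈ s, UWTendsto l (a k) (h k)) :
    UWTendsto l (fun i => ∑ k ∈ s, a k i) (∑ k ∈ s, h k) := fun W u w ω hω => by
  have := tendsto_finsetSum s fun k hk => H k hk W u w ω hω
  convert this using 1
  · funext i
    rw [Preadditive.sum_comp, Preadditive.comp_sum, fun_sum]
  · rw [Preadditive.sum_comp, Preadditive.comp_sum, fun_sum]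

theorem const_sub {a : ι → (X ⟶ Y)} {h : X ⟶ Y}
    (H : UWTendsto l a h) (b : X ⟶ Y) : UWTendsto l (fun i => b - a i) (b - h) :=
  fun W u w ω hω => by
    simpa only [Preadditive.sub_comp, Preadditive.comp_sub, fun_sub] using
      (H W u w ω hω).const_sub _

theorem sub_const {a : ι → (X ⟶ Y)} {h : X ⟶ Y}
    (H : UWTendsto l a h) (b : X ⟶ Y) : UWTendsto l (fun i => a i - b) (h - b) :=
  fun W u w ω hω => by
    simpa only [Preadditive.sub_comp, Preadditive.comp_sub, fun_sub] using
      (H W u w ω hω).sub_const _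

end UWTendsto

theorem hasUWSum_iff {X Y : C} {ι : Type*} {a : ι → (X ⟶ Y)} {h : X ⟶ Y} :
    HasUWSum a h ↔ UWTendsto atTop (fun s : Finset ι => ∑ i ∈ s, a i) h := by
  refine forall_congr' fun W => forall_congr' fun u => forall_congr' fun w =>
    forall_congr' fun ω => imp_congr_right fun _ => ?_
  rw [HasSum, SummationFilter.unconditional_filter]
  refine iff_of_eq (congrArg (Tendsto · _ _) (funext fun s => ?_))
  rw [Preadditive.sum_comp, Preadditive.comp_sum, fun_sum]

/-- The polarization identity, which reduces convergence of a net to that of its quadratic forms. -/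
theorem polarization {W N : C} (ω : End W →ₗ[ℂ] ℂ) (b : N ⟶ N) (x y : W ⟶ N) :
    ω (x ≫ b ≫ y†) =
      (ω ((x + y) ≫ b ≫ (x + y)†) - ω ((x - y) ≫ b ≫ (x - y)†)
        + Complex.I * ω ((x + Complex.I • y) ≫ b ≫ (x + Complex.I • y)†)
        - Complex.I * ω ((x - Complex.I • y) ≫ b ≫ (x - Complex.I • y)†)) / 4 := by
  have a1 : ∀ x y : W ⟶ N, ω ((x + y) ≫ b ≫ (x + y)†) =
      ω (x ≫ b ≫ x†) + ω (x ≫ b ≫ y†) + (ω (y ≫ b ≫ x†) + ω (y ≫ b ≫ y†)) := by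
    intro x y
    rw [← fun_add, ← fun_add, ← fun_add]
    congr 1
    simp only [StarCategory.dag_add, Preadditive.add_comp, Preadditive.comp_add]
    abel
  have a2 : ∀ x y : W ⟶ N, ω ((x - y) ≫ b ≫ (x - y)†) =
      ω (x ≫ b ≫ x†) - ω (x ≫ b ≫ y†) - (ω (y ≫ b ≫ x†) - ω (y ≫ b ≫ y†)) := by
    intro x y
    rw [← fun_sub, ← fun_sub, ← fun_sub]
    congr 1
    simp only [dag_sub, Preadditive.sub_comp, Preadditive.comp_sub]
    abel
  have a3 : ∀ x : W ⟶ N, ω (x ≫ b ≫ (Complex.I • y)†) = -Complex.I * ω (x ≫ b ≫ y†) := by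
    intro x
    rw [StarCategory.dag_smul, Linear.comp_smul, Linear.comp_smul, fun_smul, Complex.conj_I]
  have a4 : ∀ y' : N ⟶ W, ω ((Complex.I • y) ≫ b ≫ y') = Complex.I * ω (y ≫ b ≫ y') := by
    intro y'
    rw [Linear.smul_comp, fun_smul]
  rw [a1, a2, a1, a2]
  rw [a3, a4, a3, a4]
  linear_combination (norm := ring_nf) (ω (x ≫ b ≫ y†) / 2 - ω (y ≫ b ≫ x†) / 2) * Complex.I_sq

end Limits

section Additive
variable {M : Type u} [Category.{v} M] [Preadditive M] [Linear ℂ M] [StarCategory M]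
  [IsWStarAdditive M]

theorem UWTendsto.pos {ι : Type*} {l : Filter ι} [l.NeBot] {X : M} {a : ι → (X ⟶ X)} {h : X ⟶ X}
    (H : UWTendsto l a h) (ha : ∀ᶠ i in l, Pos (a i)) : Pos h := by
  refine pos_of_normal fun ω hω => ?_
  have := H X (𝟙 X) (𝟙 X) ω hω
  simp only [Category.id_comp, Category.comp_id] at this
  exact ge_of_tendsto this (ha.mono fun i hi => normal_nonneg hω hi)

theorem Pos.antisymm {X : M} {a b : X ⟶ X} (h : Pos (a - b)) (h' : Pos (b - a)) : a = b :=
  sub_eq_zero.1 (h.eq_zero (by rwa [neg_sub]))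

section Net
variable {ι : Type*} [Preorder ι] [IsDirectedOrder ι] [Nonempty ι] {Z : M} {c : ι → (Z ⟶ Z)}

/-- A monotone net of positive endomorphisms converges ultraweakly to its supremum. -/
theorem isSup_uwTendsto (hc : ∀ i j, i ≤ j → Pos (c j - c i)) (h0 : ∀ i, Pos (c i)) {a : Z ⟶ Z}
    (ha : IsSup (A := End Z) (Set.range c) a) : UWTendsto atTop c a := by
  intro W u w ω hω
  have key : ∀ x : W ⟶ Z, Tendsto (fun J => ω (x ≫ c J ≫ x†)) atTop (𝓝 (ω (x ≫ a ≫ x†))) := by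
    intro x
    exact hω.tendsto (c := fun J => (x ≫ c J ≫ x† : W ⟶ W))
      (fun I J h => by
        have := (hc I J h).conj x
        rw [Preadditive.sub_comp, Preadditive.comp_sub] at this
        exact this)
      (fun J => (h0 J).conj x) (isSup_conj hc h0 ha x)
  have key2 : ∀ x y : W ⟶ Z, Tendsto (fun J => ω (x ≫ c J ≫ y†)) atTop (𝓝 (ω (x ≫ a ≫ y†))) := by
    intro x y
    rw [polarization ω a x y]
    exact (((((key _).sub (key _)).add ((key _).const_mul _)).sub
      ((key _).const_mul _)).div_const 4).congr fun J => (polarization _ _ _ _).symm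
  simpa using key2 u (w†)

theorem isSup_of_uwTendsto (hc : ∀ i j, i ≤ j → Pos (c j - c i)) {a : Z ⟶ Z}
    (ha : UWTendsto atTop c a) : IsSup (A := End Z) (Set.range c) a := by
  refine ⟨?_, ?_⟩
  · rintro _ ⟨i, rfl⟩
    refine (ha.sub_const (c i)).pos ?_
    filter_upwards [eventually_ge_atTop i] with j hj using hc i j hj
  · intro b hb
    exact (ha.const_sub b).pos (Eventually.of_forall fun i => hb _ ⟨i, rfl⟩)

theorem exists_uwTendsto (hc : ∀ i j, i ≤ j → Pos (c j - c i)) (h0 : ∀ i, Pos (c i)) {b : Z ⟶ Z}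
    (hb : ∀ i, Pos (b - c i)) : ∃ a : Z ⟶ Z, UWTendsto atTop c a := by
  obtain ⟨a, ha⟩ := (IsWStarAdditive.wstar Z).exists_sup (fun i => (c i : End Z)) hc h0 b hb
  exact ⟨a, isSup_uwTendsto hc h0 ha⟩

end Net

/-- A set of endomorphisms with its order, as an index set of the net of its elements. -/
abbrev posPreorder {A : Type*} [Ring A] [StarRing A]
    (hadd : ∀ a b : A, IsPos a → IsPos b → IsPos (a + b)) (S : Set A) : Preorder S where
  le s t := IsPos ((t : A) - (s : A))
  le_refl s := ⟨0, by simp⟩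
  le_trans s t u h1 h2 := by
    have := hadd _ _ h2 h1
    rwa [sub_add_sub_cancel] at this

theorem isDirectedOrder_posPreorder {A : Type*} [Ring A] [StarRing A]
    (hadd : ∀ a b : A, IsPos a → IsPos b → IsPos (a + b)) {S : Set A}
    (hdir : DirectedOn (fun s t => IsPos (t - s)) S) :
    let _ := posPreorder hadd S
    IsDirectedOrder S := by
  intro _
  exact ⟨fun s t => by
    obtain ⟨u, hu, h1, h2⟩ := hdir s s.2 t t.2
    exact ⟨⟨u, hu⟩, h1, h2⟩⟩

/-- Suprema of directed sets of positive endomorphisms are preserved by `s ↦ v s v*`, for an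
arbitrary morphism `v`. -/
theorem isSup_conj_set {X Z : M} {S : Set (End Z)} (hne : S.Nonempty)
    (hdir : DirectedOn (fun s t => IsPos (t - s)) S) (hpos : ∀ s ∈ S, IsPos s) {a : End Z}
    (ha : IsSup S a) (v : X ⟶ Z) :
    IsSup (A := End X) ((fun s : Z ⟶ Z => v ≫ s ≫ v†) '' S) (v ≫ (a : Z ⟶ Z) ≫ v†) := by
  have hadd : ∀ a b : End Z, IsPos a → IsPos b → IsPos (a + b) :=
    fun _ _ => (IsWStarAdditive.wstar Z).isPos_add
  let _ := posPreorder hadd S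
  have : IsDirectedOrder S := isDirectedOrder_posPreorder hadd hdir
  have : Nonempty S := hne.to_subtype
  have := isSup_conj (c := fun s : S => (s : End Z)) (fun i j h => h) (fun i => hpos i i.2)
    (a := a) (by rwa [Subtype.range_coe]) v
  have e : ((fun s : Z ⟶ Z => v ≫ s ≫ v†) '' S) =
      Set.range fun i : S => v ≫ ((i : End Z) : Z ⟶ Z) ≫ v† := by
    ext t
    simp only [Set.mem_image, Set.mem_range, Subtype.exists, exists_prop]
    rfl
  rw [e]
  exact this

/-! ### Norm bounds -/

theorem normLE_zero_iff {X Y : M} {f : X ⟶ Y} : NormLE f 0 ↔ f = 0 := by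
  constructor
  · intro h
    apply eq_zero_of_comp_dag
    refine (pos_comp_dag f).eq_zero ?_
    simpa using h.2
  · rintro rfl
    exact ⟨le_rfl, by simpa using pos_zero X⟩

theorem NormLE.add_le {X Y : M} {f g : X ⟶ Y} {r s : ℝ} (hf : NormLE f r) (hg : NormLE g s) :
    NormLE (f + g) (r + s) := by
  rcases hf.1.eq_or_lt with h | hr
  · subst h
    rw [normLE_zero_iff.1 hf]; simpa using hg
  rcases hg.1.eq_or_lt with h | hs
  · subst h
    rw [normLE_zero_iff.1 hg]; simpa using hf
  refine ⟨by positivity, ?_⟩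
  -- `(r + s)² - |f + g|²` is the sum of `(1 + s / r) (r² - |f|²)`, `(1 + r / s) (s² - |g|²)` and
  -- `|√(s / r) f - √(r / s) g|²`, where the last term is scaled to avoid square roots
  have h1 := hf.2.smul (r := (r + s) / r) (by positivity)
  have h2 := hg.2.smul (r := (r + s) / s) (by positivity)
  have h3 := (pos_comp_dag ((s : ℂ) • f - (r : ℂ) • g)).smul (r := (r * s)⁻¹) (by positivity)
  have h4 := (h1.add h2).add h3
  have hr' : (r : ℂ) ≠ 0 := by exact_mod_cast hr.ne'
  have hs' : (s : ℂ) ≠ 0 := by exact_mod_cast hs.ne'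
  convert h4 using 1
  simp only [Preadditive.comp_sub, Preadditive.sub_comp, Preadditive.comp_add, Preadditive.add_comp,
    smul_sub, smul_smul, StarCategory.dag_add, dag_sub, StarCategory.dag_smul, Linear.comp_smul,
    Linear.smul_comp, Complex.conj_ofReal]
  push_cast
  match_scalars <;> field_simp <;> ring

theorem NormLE.of_forall_lt {X Y : M} {f : X ⟶ Y} {r : ℝ} (hr : 0 ≤ r)
    (h : ∀ s, r < s → NormLE f s) : NormLE f r := by
  refine ⟨hr, pos_of_normal fun ω hω => ?_⟩
  rw [fun_sub, fun_smul]
  have h1 : Tendsto (fun s : ℝ => ((s ^ 2 : ℝ) : ℂ) * ω (𝟙 X) - ω (f ≫ f†)) (𝓝[>] r)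
      (𝓝 (((r ^ 2 : ℝ) : ℂ) * ω (𝟙 X) - ω (f ≫ f†))) := by
    have : Continuous fun s : ℝ => ((s ^ 2 : ℝ) : ℂ) * ω (𝟙 X) - ω (f ≫ f†) := by fun_prop
    exact this.continuousWithinAt
  refine ge_of_tendsto h1 ?_
  filter_upwards [self_mem_nhdsWithin] with s hs
  have := normal_nonneg hω (h s hs).2
  rwa [fun_sub, fun_smul] at this

/-- A self-adjoint endomorphism of norm at most `r` is at most `r`. -/
theorem NormLE.pos_sub {X : M} {a : X ⟶ X} (ha : a† = a) {r : ℝ} (h : NormLE a r) :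
    Pos ((r : ℂ) • 𝟙 X - a) := by
  rcases h.1.eq_or_lt with h0 | hr
  · subst h0
    rw [normLE_zero_iff.1 h]; simpa using pos_zero X
  have h1 := pos_comp_dag ((r : ℂ) • 𝟙 X - a)
  have h2 := (h1.add h.2).smul (r := (2 * r)⁻¹) (by positivity)
  have hr' : (r : ℂ) ≠ 0 := by exact_mod_cast hr.ne'
  convert h2 using 1
  simp only [Preadditive.comp_sub, Preadditive.sub_comp, smul_sub, smul_smul, dag_sub,
    StarCategory.dag_smul, Linear.comp_smul, Linear.smul_comp, Complex.conj_ofReal, ha, dag_id,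
    Category.comp_id, Category.id_comp, smul_add]
  push_cast
  match_scalars <;> field_simp <;> ring

/-- A positive endomorphism below `r` has norm at most `r`. -/
theorem NormLE.of_pos {X : M} {a : X ⟶ X} (ha : Pos a) {r : ℝ} (hr : 0 ≤ r)
    (h : Pos ((r : ℂ) • 𝟙 X - a)) : NormLE a r := by
  refine ⟨hr, ?_⟩
  rcases hr.eq_or_lt with h0 | hr0
  · subst h0
    have : a = 0 := ha.eq_zero (by simpa using h)
    subst this
    simpa using pos_zero X
  have h1 := h.smul hr
  -- `r a - a² = r⁻¹ (a (r - a) a + (r - a) a (r - a))`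
  have h2 : Pos ((r : ℂ) • a - a ≫ a) := by
    have h3 := ((h.conj a).add (ha.conj ((r : ℂ) • 𝟙 X - a))).smul (inv_nonneg.2 hr)
    have hr' : (r : ℂ) ≠ 0 := by exact_mod_cast hr0.ne'
    convert h3 using 1
    simp only [Preadditive.comp_sub, Preadditive.sub_comp, smul_sub, smul_smul, dag_sub,
      StarCategory.dag_smul, Linear.comp_smul, Linear.smul_comp, Complex.conj_ofReal, ha.dag_eq,
      dag_id, Category.comp_id, Category.id_comp, smul_add]
    push_cast
    match_scalars <;> field_simp <;> ring
  have h3 := h1.add h2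
  rw [ha.dag_eq]
  convert h3 using 1
  rw [smul_sub, smul_smul]
  push_cast
  rw [sq]; abel

end Additive

/-! ### Functors, suprema and ultraweak limits -/

section Functors

theorem isPos_image_iff {A B : Type*} [Ring A] [StarRing A] [Ring B] [StarRing B]
    {f : A → B} (hf : Function.Bijective f) (hstar : ∀ a, f (star a * a) = star (f a) * f a)
    {a : A} : IsPos (f a) ↔ IsPos a := by
  constructor
  · rintro ⟨b, hb⟩
    obtain ⟨b, rfl⟩ := hf.2 b
    exact ⟨b, hf.1 (by rw [hb, hstar])⟩
  · rintro ⟨b, rfl⟩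
    exact ⟨f b, hstar b⟩

theorem isSup_image_iff {A B : Type*} [Ring A] [StarRing A] [Ring B] [StarRing B]
    {f : A → B} (hf : Function.Bijective f) (hsub : ∀ a b, f (a - b) = f a - f b)
    (hstar : ∀ a, f (star a * a) = star (f a) * f a) {S : Set A} {a : A} :
    IsSup (f '' S) (f a) ↔ IsSup S a := by
  refine and_congr ?_ ?_
  · simp only [Set.forall_mem_image, ← hsub, isPos_image_iff hf hstar]
  · rw [hf.2.forall]
    simp only [Set.forall_mem_image, ← hsub, isPos_image_iff hf hstar]

universe u₁ u₂
variable {C : Type u₁} [Category.{v} C] [Preadditive C] [Linear ℂ C] [StarCategory C]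
variable {D : Type u₂} [Category.{v} D] [Preadditive D] [Linear ℂ D] [StarCategory D]
variable {F : C ⥤ D}

theorem IsStarFunctor.map_pos (hF : IsStarFunctor F) {X : C} {a : X ⟶ X} (ha : Pos a) :
    Pos (F.map a) := by
  obtain ⟨b, rfl⟩ := pos_iff.1 ha
  exact pos_iff.2 ⟨F.map b, by rw [F.map_comp, hF.map_dag]⟩

theorem IsStarFunctor.map_pos_iff (hF : IsStarFunctor F) [F.Full] [F.Faithful] {X : C}
    {a : X ⟶ X} : Pos (F.map a) ↔ Pos a := by
  refine ⟨fun h => ?_, hF.map_pos⟩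
  obtain ⟨b, hb⟩ := pos_iff.1 h
  obtain ⟨b, rfl⟩ := F.map_surjective b
  exact pos_iff.2 ⟨b, F.map_injective (by rw [hb, F.map_comp, hF.map_dag])⟩

theorem IsStarFunctor.isSup_map_iff (hF : IsStarFunctor F) [F.Full] [F.Faithful] {X : C}
    {S : Set (End X)} {a : End X} :
    IsSup (A := End (F.obj X)) ((fun s : X ⟶ X => F.map s) '' S) (F.map (a : X ⟶ X)) ↔
      IsSup S a := by
  refine isSup_image_iff (A := End X) (B := End (F.obj X)) (f := fun s : X ⟶ X => F.map s)
    ⟨F.map_injective, F.map_surjective⟩ (fun a b => hF.map_sub _ _) fun a => ?_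
  change F.map ((a : X ⟶ X) ≫ (a : X ⟶ X)†) = F.map (a : X ⟶ X) ≫ (F.map (a : X ⟶ X))†
  rw [F.map_comp, hF.map_dag]

namespace IsStarFunctor

theorem matMap_add (hF : IsStarFunctor F) {X Y : Mat_ C} (f g : X ⟶ Y) :
    matMap F (f + g) = matMap F f + matMap F g := by
  ext i j
  exact hF.map_add _ _

theorem matMap_smul (hF : IsStarFunctor F) {X Y : Mat_ C} (c : ℂ) (f : X ⟶ Y) :
    matMap F (c • f) = c • matMap F f := by
  ext i j
  exact hF.map_smul _ _

theorem matMap_id (hF : IsStarFunctor F) (X : Mat_ C) : matMap F (𝟙 X) = 𝟙 (matObj F X) := by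
  classical
  refine Mat_.hom_ext (M := matObj F X) (N := matObj F X) _ _ fun i j => ?_
  by_cases h : i = j
  · subst h
    exact ((congrArg F.map (Mat_.id_apply_self X i)).trans (F.map_id _)).trans
      (Mat_.id_apply_self (matObj F X) i).symm
  · exact ((congrArg F.map (Mat_.id_apply_of_ne X i j h)).trans (hF.map_zero _ _)).trans
      (Mat_.id_apply_of_ne (matObj F X) i j h).symm

theorem matMap_pos (hF : IsStarFunctor F) {X : Mat_ C} {a : X ⟶ X} (ha : Pos a) :
    Pos (matMap F a) := by
  obtain ⟨b, rfl⟩ := pos_iff.1 ha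
  exact pos_iff.2 ⟨matMap F b, by rw [hF.matMap_comp, hF.matMap_dag]⟩

theorem matMap_normLE (hF : IsStarFunctor F) {X Y : Mat_ C} {f : X ⟶ Y} {r : ℝ}
    (h : NormLE f r) : NormLE (matMap F f) r := by
  refine ⟨h.1, ?_⟩
  have := hF.matMap_pos h.2
  rwa [hF.matMap_sub, hF.matMap_smul, hF.matMap_id, hF.matMap_comp, hF.matMap_dag] at this

/-- `matMap F` preserves directed sets of positive endomorphisms. -/
theorem directedOn_endMap (hF : IsStarFunctor F) {X : Mat_ C} {S : Set (End X)}
    (hdir : DirectedOn (fun s t => IsPos (t - s)) S) :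
    DirectedOn (fun s t => IsPos (t - s)) (endMap F X '' S) := by
  rintro _ ⟨s, hs, rfl⟩ _ ⟨t, ht, rfl⟩
  obtain ⟨w, hw, h1, h2⟩ := hdir s hs t ht
  refine ⟨_, ⟨w, hw, rfl⟩, ?_, ?_⟩
  · have := hF.matMap_pos h1
    rwa [show matMap F (w - s) = _ from hF.matMap_sub w s] at this
  · have := hF.matMap_pos h2
    rwa [show matMap F (w - t) = _ from hF.matMap_sub w t] at this

end IsStarFunctor

theorem directedOn_conj {M : Type u} [Category.{v} M] [Preadditive M] [Linear ℂ M]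
    [StarCategory M] [IsWStarAdditive M] {X Z : M} (v : X ⟶ Z) {S : Set (End Z)}
    (hdir : DirectedOn (fun s t => IsPos (t - s)) S) :
    DirectedOn (fun s t : End X => IsPos (t - s)) ((fun s : Z ⟶ Z => v ≫ s ≫ v†) '' S) := by
  rintro _ ⟨s, hs, rfl⟩ _ ⟨t, ht, rfl⟩
  obtain ⟨w, hw, h1, h2⟩ := hdir s hs t ht
  refine ⟨_, ⟨w, hw, rfl⟩, ?_, ?_⟩
  · have := Pos.conj h1 v
    rwa [Preadditive.sub_comp, Preadditive.comp_sub] at this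
  · have := Pos.conj h2 v
    rwa [Preadditive.sub_comp, Preadditive.comp_sub] at this

variable [WStarCategory D]

/-- A W*-functor is ultraweakly continuous, as it pulls the normal functionals
`b ↦ ω (v b v*)` back to normal functionals. -/
theorem IsWStarFunctor.uwTendsto [WStarCategory C] (hF : IsWStarFunctor F) {X Y : Mat_ C}
    {ι : Type*} {l : Filter ι} {a : ι → (X ⟶ Y)} {h : X ⟶ Y} (H : UWTendsto l a h) :
    UWTendsto l (fun i => matMap F (a i)) (matMap F h) := by
  intro W u w ω hω
  have hs := hF.toIsStarFunctor
  obtain ⟨Z, p, q, hp, hq, -, -⟩ := IsWStarAdditive.sum X Y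
  let φ : (W ⟶ matObj F Z) → (End Z →ₗ[ℂ] ℂ) := fun v =>
    { toFun := fun b => ω (v ≫ matMap F b ≫ v†)
      map_add' := fun b c => by
        change ω (v ≫ matMap F ((b : Z ⟶ Z) + c) ≫ v†) = _
        rw [hs.matMap_add, Preadditive.add_comp, Preadditive.comp_add, fun_add]
      map_smul' := fun r b => by
        change ω (v ≫ matMap F (r • (b : Z ⟶ Z)) ≫ v†) = _
        rw [hs.matMap_smul, Linear.smul_comp, Linear.comp_smul, fun_smul]
        rfl }
  have hφ : ∀ v, IsNormalFunctional (φ v) := by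
    intro v
    refine ⟨fun b hb => hω.pos _ (Pos.conj (hs.matMap_pos hb) v), ?_⟩
    intro S hne hdir hpos b hb
    have h1 := hF.normal Z S hne hdir hpos b hb
    have hpos1 : ∀ s ∈ endMap F Z '' S, IsPos s := by
      rintro _ ⟨s, hs', rfl⟩
      exact hs.matMap_pos (hpos s hs')
    have h2 := isSup_conj_set (hne.image _) (hs.directedOn_endMap hdir) hpos1 h1 v
    have h3 := hω.sups _ ((hne.image _).image _)
      (directedOn_conj v (hs.directedOn_endMap hdir)) (by
        rintro _ ⟨s, hs', rfl⟩
        exact Pos.conj (hpos1 s hs') v) _ h2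
    rw [Set.image_image, Set.image_image] at h3
    exact h3
  have key : ∀ v, Tendsto (fun i => ω (v ≫ matMap F (p† ≫ a i ≫ q) ≫ v†)) l
      (𝓝 (ω (v ≫ matMap F (p† ≫ h ≫ q) ≫ v†))) := fun v => H Z (p†) q (φ v) (hφ v)
  have key2 : ∀ x y, Tendsto (fun i => ω (x ≫ matMap F (p† ≫ a i ≫ q) ≫ y†)) l
      (𝓝 (ω (x ≫ matMap F (p† ≫ h ≫ q) ≫ y†))) := by
    intro x y
    rw [polarization ω _ x y]
    exact (((((key _).sub (key _)).add ((key _).const_mul _)).sub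
      ((key _).const_mul _)).div_const 4).congr fun J => (polarization _ _ _ _).symm
  have := key2 (u ≫ matMap F p) (w† ≫ matMap F q)
  have e : ∀ b : X ⟶ Y, (u ≫ matMap F p) ≫ matMap F (p† ≫ b ≫ q) ≫ (w† ≫ matMap F q)† =
      u ≫ matMap F b ≫ w := by
    intro b
    have e1 : matMap F p ≫ matMap F (p† ≫ b ≫ q) ≫ (matMap F q)† = matMap F b := by
      rw [← hs.matMap_dag, ← hs.matMap_comp, ← hs.matMap_comp]
      congr 1
      have : p ≫ (p† ≫ b ≫ q) ≫ q† = (p ≫ p†) ≫ b ≫ (q ≫ q†) := by simp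
      rw [this, hp, hq]; simp
    rw [StarCategory.dag_comp, StarCategory.dag_dag, ← e1]
    simp only [Category.assoc]
  simpa only [e] using this

theorem IsWStarFunctor.hasUWSum [WStarCategory C] (hF : IsWStarFunctor F) {X Y : Mat_ C}
    {ι : Type*} {a : ι → (X ⟶ Y)} {h : X ⟶ Y} (H : HasUWSum a h) :
    HasUWSum (fun i => matMap F (a i)) (matMap F h) := by
  rw [hasUWSum_iff] at H ⊢
  convert hF.uwTendsto H using 2 with s
  classical
  induction s using Finset.induction_on with
  | empty => ext i j; exact (hF.map_zero _ _).symm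
  | insert b s hb ih =>
    rw [Finset.sum_insert hb, Finset.sum_insert hb, hF.matMap_add, ih]

end Functors

/-! ### Bounds of matrices -/

section Bounds
variable {C : Type u} [Category.{v} C] [Preadditive C] [Linear ℂ C] [StarCategory C]
variable {ι κ μ : Type*} {X : ι → C} {Y : κ → C} {Z : μ → C}

/-- The finite blocks of a matrix of morphisms are bounded in norm by `r`. -/
def IsBoundedBy (f : ∀ i j, X i ⟶ Y j) (r : ℝ) : Prop :=
  ∀ (α β : Type) [Fintype α] [Fintype β] (p : α ↪ ι) (q : β ↪ κ), NormLE (block f p q) r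

theorem exists_finEnum {J : Finset κ} {j : κ} (hj : j ∈ J) : ∃ b, finEnum J b = j :=
  ⟨J.equivFin ⟨j, hj⟩, by simp [finEnum]⟩

theorem map_finEnum (J : Finset κ) : Finset.univ.map (finEnum J) = J := by
  ext j
  simp only [Finset.mem_map, Finset.mem_univ, true_and]
  refine ⟨?_, exists_finEnum⟩
  rintro ⟨b, rfl⟩
  simp [finEnum]

theorem block_pt_comp_apply (f : ∀ i j, X i ⟶ Y j) (g : ∀ j k, Y j ⟶ Z k) {α γ : Type} [Fintype α]
    [Fintype γ] (p : α → ι) (j : κ) (s : γ → μ) (a : α) (c : γ) :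
    (block f p (ptEmb j) ≫ block g (ptEmb j) s) a c = f (p a) j ≫ g j (s c) := by
  rw [Mat_.comp_apply]
  exact Fintype.sum_unique (fun _ : PUnit => f (p a) j ≫ g j (s c))

theorem block_comp_block (f : ∀ i j, X i ⟶ Y j) (g : ∀ j k, Y j ⟶ Z k) {α β γ : Type} [Fintype α]
    [Fintype β] [Fintype γ] (p : α → ι) (q : β ↪ κ) (s : γ → μ) :
    block f p q ≫ block g q s =
      ∑ j ∈ Finset.univ.map q, block f p (ptEmb j) ≫ block g (ptEmb j) s := by
  ext a c
  rw [mat_sum_apply, Finset.sum_map, Mat_.comp_apply]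
  refine Finset.sum_congr rfl fun b _ => ?_
  exact (block_pt_comp_apply f g p (q b) s a c).symm

theorem block_dag (f : ∀ i j, X i ⟶ Y j) {α β : Type} [Fintype α] [Fintype β] (p : α → ι)
    (q : β → κ) : block (fun j i => (f i j)†) q p = (block f p q)† := rfl

theorem UWTendsto.of_entries {A B : Mat_ C} {ν : Type*} {l : Filter ν} {a : ν → (A ⟶ B)} {b : A ⟶ B}
    (H : ∀ i j, UWTendsto l (fun n => (Mat_.embedding C).map (a n i j))
      ((Mat_.embedding C).map (b i j))) : UWTendsto l a b := by
  rw [mat_decomp b, show a = fun n => _ from funext fun n => mat_decomp (a n)]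
  exact UWTendsto.sum _ fun i _ => UWTendsto.sum _ fun k _ =>
    ((H i k).comp_right _).comp_left _

theorem HasUWSum.of_entries {A B : Mat_ C} {ν : Type*} {a : ν → (A ⟶ B)} {b : A ⟶ B}
    (H : ∀ i j, HasUWSum (fun n => (Mat_.embedding C).map (a n i j))
      ((Mat_.embedding C).map (b i j))) : HasUWSum a b := by
  rw [mat_decomp b, show a = fun n => _ from funext fun n => mat_decomp (a n)]
  exact HasUWSum.sum _ fun i _ => HasUWSum.sum _ fun k _ =>
    ((H i k).comp_right _).comp_left _

variable [WStarCategory C]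

theorem block_id {α : Type} [Fintype α] (p : α ↪ ι) : block (idMatrix X) p p = 𝟙 _ := by
  classical
  ext a b
  by_cases h : a = b
  · subst h
    exact (idMatrix_self X _).trans (Mat_.id_apply_self (Mat_.mk α fun a => X (p a)) a).symm
  · exact (idMatrix_ne X (fun h' => h (p.injective h'))).trans
      (Mat_.id_apply_of_ne (Mat_.mk α fun a => X (p a)) a b h).symm

/-- A block is a corner of every larger block. -/
theorem block_id_comp (f : ∀ i j, X i ⟶ Y j) {α β γ : Type} [Fintype α] [Fintype β] [Fintype γ]
    (p : α → ι) (s : β ↪ ι) (q : γ → κ) (h : ∀ a, ∃ b, s b = p a) :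
    block (idMatrix X) p s ≫ block f s q = block f p q := by
  classical
  ext a c
  obtain ⟨b, hb⟩ := h a
  rw [Mat_.comp_apply, Finset.sum_eq_single b]
  · change idMatrix X (p a) (s b) ≫ f (s b) (q c) = f (p a) (q c)
    rw [hb, idMatrix_self, Category.id_comp]
  · intro b' _ hb'
    have : p a ≠ s b' := fun h' => hb' (s.injective (h'.symm.trans hb.symm))
    rw [block_apply, idMatrix_ne X this, Limits.zero_comp]
  · simp

theorem block_eq_corner (f : ∀ i j, X i ⟶ X j) {α β γ : Type} [Fintype α] [Fintype β] [Fintype γ]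
    (p : α → ι) (s : β ↪ ι) (q : γ → ι) (hp : ∀ a, ∃ b, s b = p a) (hq : ∀ a, ∃ b, s b = q a) :
    block f p q = block (idMatrix X) p s ≫ block f s s ≫ (block (idMatrix X) q s)† := by
  rw [← StarCategory.dag_dag (block f s s), ← StarCategory.dag_comp, ← block_dag f,
    block_id_comp _ _ _ _ hq, block_dag, StarCategory.dag_dag, block_id_comp _ _ _ _ hp]

namespace IsBoundedBy
variable {f g : ∀ i j, X i ⟶ Y j} {r s : ℝ}

theorem nonneg (hf : IsBoundedBy f r) : 0 ≤ r :=
  (hf PEmpty PEmpty Function.Embedding.ofIsEmpty Function.Embedding.ofIsEmpty).1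

theorem isBoundedMatrix (hf : IsBoundedBy f r) : IsBoundedMatrix f := ⟨r, hf⟩

theorem add (hf : IsBoundedBy f r) (hg : IsBoundedBy g s) :
    IsBoundedBy (fun i j => f i j + g i j) (r + s) :=
  fun α β _ _ p q => (hf α β p q).add_le (hg α β p q)

theorem smul (hf : IsBoundedBy f r) (c : ℂ) : IsBoundedBy (fun i j => c • f i j) (‖c‖ * r) :=
  fun α β _ _ p q => (hf α β p q).smul c

theorem dag (hf : IsBoundedBy f r) : IsBoundedBy (fun j i => (f i j)†) r :=
  fun α β _ _ p q => (hf β α q p).dag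

theorem entry (hf : IsBoundedBy f r) (i : ι) (j : κ) :
    NormLE ((Mat_.embedding C).map (f i j)) r :=
  hf PUnit PUnit (ptEmb i) (ptEmb j)

theorem eq_zero (hf : IsBoundedBy f 0) (i : ι) (j : κ) : f i j = 0 :=
  (Mat_.embedding C).map_injective (normLE_zero_iff.1 (hf.entry i j))

theorem of_forall_lt (hr : 0 ≤ r) (h : ∀ s, r < s → IsBoundedBy f s) : IsBoundedBy f r :=
  fun α β _ _ p q => .of_forall_lt hr fun s hs => h s hs α β p q

theorem zero : IsBoundedBy (fun i j => (0 : X i ⟶ Y j)) 0 :=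
  fun _ _ _ _ _ _ => normLE_zero_iff.2 rfl

/-- For the bound of a square matrix it suffices to consider the principal blocks. -/
theorem of_principal {f : ∀ i j, X i ⟶ X j}
    (h : ∀ (α : Type) [Fintype α] (p : α ↪ ι), NormLE (block f p p) r) : IsBoundedBy f r := by
  classical
  intro α β _ _ p q
  let J : Finset ι := Finset.univ.map p ∪ Finset.univ.map q
  have hp : ∀ a, ∃ b, finEnum J b = p a := fun a => exists_finEnum (by simp [J])
  have hq : ∀ a, ∃ b, finEnum J b = q a := fun a => exists_finEnum (by simp [J])
  have key : ∀ {γ : Type} [Fintype γ] (q : γ ↪ ι), (∀ a, ∃ b, finEnum J b = q a) →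
      NormLE (block (idMatrix X) q (finEnum J)) 1 := by
    intro γ _ q hq
    refine ⟨zero_le_one, ?_⟩
    have e : (block (idMatrix X) q (finEnum J))† = block (idMatrix X) (finEnum J) q := by
      rw [← block_dag]
      congr 1
      funext i j
      exact idMatrix_dag X j i
    rw [e, block_id_comp _ _ _ _ hq, block_id]
    simpa using pos_zero _
  rw [block_eq_corner f p (finEnum J) q hp hq]
  simpa using (key p hp).comp ((h _ (finEnum J)).comp (key q hq).dag)

theorem id (X : ι → C) : IsBoundedBy (idMatrix X) 1 :=
  .of_principal fun α _ p => by
    rw [block_id]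
    exact ⟨zero_le_one, by simpa using pos_zero _⟩

end IsBoundedBy

namespace IsMatrixProduct
variable {f : ∀ i j, X i ⟶ Y j} {g : ∀ j k, Y j ⟶ Z k} {h : ∀ i k, X i ⟶ Z k}

theorem hasUWSum_block (H : IsMatrixProduct f g h) {α β : Type} [Fintype α] [Fintype β]
    (p : α → ι) (q : β → μ) :
    HasUWSum (fun j => block f p (ptEmb j) ≫ block g (ptEmb j) q) (block h p q) := by
  refine HasUWSum.of_entries fun a b => ?_
  simp only [block_pt_comp_apply]
  exact H (p a) (q b)

theorem isBoundedBy (H : IsMatrixProduct f g h) {r s : ℝ} (hf : IsBoundedBy f r)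
    (hg : IsBoundedBy g s) : IsBoundedBy h (r * s) := by
  intro α β _ _ p q
  refine normLE_of_uwSum (H.hasUWSum_block p q) fun J => ?_
  have := block_comp_block f g p (finEnum J) q
  rw [map_finEnum] at this
  rw [← this]
  exact (hf _ _ p (finEnum J)).comp (hg _ _ (finEnum J) q)

/-- The blocks of `f f*` dominate the products of the blocks of `f`. -/
theorem pos_block_sub {h : ∀ i k, X i ⟶ X k} (H : IsMatrixProduct f (fun j i => (f i j)†) h)
    {α β : Type} [Fintype α] [Fintype β] (p : α → ι) (q : β ↪ κ) :
    Pos (block h p p - block f p q ≫ (block f p q)†) := by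
  classical
  refine ((hasUWSum_iff.1 (H.hasUWSum_block p p)).sub_const _).pos ?_
  filter_upwards [eventually_ge_atTop (Finset.univ.map q)] with J hJ
  rw [← block_dag, block_comp_block, ← Finset.sum_sdiff hJ, add_sub_cancel_right]
  exact pos_sum _ _ fun j _ => pos_comp_dag (block f p (ptEmb j))

theorem pos_block {h : ∀ i k, X i ⟶ X k} (H : IsMatrixProduct f (fun j i => (f i j)†) h)
    {α : Type} [Fintype α] (p : α → ι) : Pos (block h p p) := by
  have := H.pos_block_sub p (Function.Embedding.ofIsEmpty (α := PEmpty))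
  have e : block f p (Function.Embedding.ofIsEmpty (α := PEmpty)) = 0 := by
    ext a b; exact b.elim
  rw [e] at this
  simpa using this

/-- The C*-identity for matrices. -/
theorem isBoundedBy_of_mul_dag {h : ∀ i k, X i ⟶ X k}
    (H : IsMatrixProduct f (fun j i => (f i j)†) h) {r : ℝ} (hr : 0 ≤ r)
    (hh : IsBoundedBy h (r ^ 2)) : IsBoundedBy f r := by
  intro α β _ _ p q
  refine ⟨hr, ?_⟩
  have h1 := (hh α α p p).pos_sub (H.pos_block p).dag_eq
  have := h1.add (H.pos_block_sub p q)
  rwa [sub_add_sub_cancel] at this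

end IsMatrixProduct

theorem normLE_sum {M : Type u} [Category.{v} M] [Preadditive M] [Linear ℂ M] [StarCategory M]
    [IsWStarAdditive M] {A B : M} {ν : Type*} (s : Finset ν) {a : ν → (A ⟶ B)} {t : ν → ℝ}
    (h : ∀ n ∈ s, NormLE (a n) (t n)) : NormLE (∑ n ∈ s, a n) (∑ n ∈ s, t n) := by
  classical
  induction s using Finset.induction_on with
  | empty => simpa using normLE_zero_iff.2 rfl
  | insert n s hn ih =>
    rw [Finset.sum_insert hn, Finset.sum_insert hn]
    exact (h n (by simp)).add_le (ih fun m hm => h m (by simp [hm]))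

/-- A series of morphisms with summable norms converges ultraweakly: its terms are the products
of the entries of the bounded row `t⁻¹ᐟ² a` and the bounded column `t¹ᐟ²`. -/
theorem exists_hasUWSum_of_summable {M : Type u} [Category.{v} M] [Preadditive M] [Linear ℂ M]
    [StarCategory M] [IsWStarAdditive M] {A B : M} {ν : Type*} {a : ν → (A ⟶ B)} {t : ν → ℝ}
    (ht : Summable t) (h : ∀ n, NormLE (a n) (t n)) : ∃ b, HasUWSum a b := by
  have ht0 : ∀ n, 0 ≤ t n := fun n => (h n).1
  have hsum : ∀ (W : M) (J : Finset ν),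
      Pos (((∑' n, t n : ℝ) : ℂ) • 𝟙 W - ∑ n ∈ J, (t n : ℂ) • 𝟙 W) := by
    intro W J
    have h1 : 0 ≤ ∑' n, t n - ∑ n ∈ J, t n := sub_nonneg.2 (ht.sum_le_tsum _ fun n _ => ht0 n)
    have := (pos_one W).smul h1
    rwa [Complex.ofReal_sub, sub_smul, Complex.ofReal_sum, Finset.sum_smul] at this
  obtain ⟨b, hb⟩ := exists_uwSum (Y := fun _ => B)
    (fun n => (((√(t n))⁻¹ : ℝ) : ℂ) • a n) (fun n => ((√(t n) : ℝ) : ℂ) • 𝟙 B)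
    (r := ∑' n, t n) (s := ∑' n, t n) (fun J => by
      have h1 : Pos (∑ n ∈ J, ((t n : ℂ) • 𝟙 A -
          ((((√(t n))⁻¹ : ℝ) : ℂ) • a n) ≫ ((((√(t n))⁻¹ : ℝ) : ℂ) • a n)†)) := by
        refine pos_sum _ _ fun n _ => ?_
        have h2 := (h n).2.smul (inv_nonneg.2 (ht0 n))
        rw [StarCategory.dag_smul, Linear.smul_comp, Linear.comp_smul, smul_smul,
          Complex.conj_ofReal, ← Complex.ofReal_mul, ← mul_inv, Real.mul_self_sqrt (ht0 n)]
        convert h2 using 1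
        rw [smul_sub, smul_smul, ← Complex.ofReal_mul]
        congr 3
        rcases (ht0 n).eq_or_lt with h0 | h0
        · rw [← h0]; simp
        · field_simp
      have := (hsum A J).add h1
      rwa [Finset.sum_sub_distrib, sub_add_sub_cancel] at this) (fun J => by
      have e : ∀ n, (((√(t n) : ℝ) : ℂ) • 𝟙 B)† ≫ (((√(t n) : ℝ) : ℂ) • 𝟙 B) =
          (t n : ℂ) • 𝟙 B := by
        intro n
        rw [StarCategory.dag_smul, Linear.smul_comp, Linear.comp_smul, smul_smul,
          Complex.conj_ofReal, ← Complex.ofReal_mul, Real.mul_self_sqrt (ht0 n), dag_id,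
          Category.comp_id]
      simp only [e]
      exact hsum B J)
  refine ⟨b, ?_⟩
  convert hb using 2 with n
  rw [Linear.smul_comp, Linear.comp_smul, Category.comp_id, smul_smul, ← Complex.ofReal_mul]
  rcases (ht0 n).eq_or_lt with h0 | h0
  · have := h n
    rw [← h0] at this
    rw [normLE_zero_iff.1 this, smul_zero]
  · rw [inv_mul_cancel₀ (Real.sqrt_pos.2 h0).ne']; simp

/-- Completeness of the spaces of bounded matrices. -/
theorem exists_sum_of_isBoundedBy {f : ℕ → ∀ i j, X i ⟶ Y j} {t : ℕ → ℝ} (ht : Summable t)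
    (hf : ∀ n, IsBoundedBy (f n) (t n)) : ∃ h : ∀ i j, X i ⟶ Y j,
      ∀ n, IsBoundedBy (fun i j => h i j - ∑ m ∈ Finset.range n, f m i j) (∑' m, t (m + n)) := by
  have : ∀ i j, ∃ h : X i ⟶ Y j, HasUWSum (fun n => (Mat_.embedding C).map (f n i j))
      ((Mat_.embedding C).map h) := by
    intro i j
    obtain ⟨h, hh⟩ := exists_hasUWSum_of_summable ht fun n => (hf n).entry i j
    obtain ⟨h', rfl⟩ := (Mat_.embedding C).map_surjective h
    exact ⟨h', hh⟩
  choose h hh using this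
  refine ⟨h, fun n α β _ _ p q => ?_⟩
  have h1 : HasUWSum (fun m => block (f m) p q) (block h p q) :=
    .of_entries fun a b => hh (p a) (q b)
  have h2 : HasUWSum (fun m => block (f (m + n)) p q)
      (block (fun i j => h i j - ∑ m ∈ Finset.range n, f m i j) p q) := by
    have e : block (fun i j => h i j - ∑ m ∈ Finset.range n, f m i j) p q =
        block h p q - ∑ m ∈ Finset.range n, block (f m) p q := by
      refine (sub_eq_of_eq_add ?_).symm
      ext i j
      rw [Mat_.add_apply, mat_sum_apply]
      exact (sub_add_cancel _ _).symm
    intro W u w ω hω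
    have := h1 W u w ω hω
    rw [e, Preadditive.sub_comp, Preadditive.comp_sub, fun_sub, Preadditive.sum_comp,
      Preadditive.comp_sum, fun_sum]
    exact (hasSum_nat_add_iff' n).2 this
  refine normLE_of_uwSum h2 fun J => ?_
  refine (normLE_sum J fun m _ => hf (m + n) α β p q).mono ?_
  exact ((summable_nat_add_iff n).2 ht).sum_le_tsum _ fun m _ => (hf (m + n)).nonneg

end Bounds

/-! ### Endomorphisms in the direct sum completion form C*-algebras -/

namespace DirectSumCompletion
variable {C : Type u} [Category.{v} C] [Preadditive C] [Linear ℂ C] [StarCategory C]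
  [WStarCategory C]

/-- The matrix of a morphism. -/
def entries {X Y : DirectSumCompletion C} (f : X ⟶ Y) : ∀ i j, X.X i ⟶ Y.X j := f.1

theorem entries_bounded {X Y : DirectSumCompletion C} (f : X ⟶ Y) : IsBoundedMatrix (entries f) :=
  f.2

theorem hom_ext {X Y : DirectSumCompletion C} {f g : X ⟶ Y}
    (h : ∀ i j, entries f i j = entries g i j) : f = g :=
  Subtype.ext (by funext i j; exact h i j)

/-- The morphism of a bounded matrix. -/
def ofMatrix {X Y : DirectSumCompletion C} (f : ∀ i j, X.X i ⟶ Y.X j) (hf : IsBoundedMatrix f) :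
    X ⟶ Y := ⟨f, hf⟩

theorem entries_id (X : DirectSumCompletion C) : entries (𝟙 X) = idMatrix X.X := rfl

theorem entries_comp {X Y Z : DirectSumCompletion C} (f : X ⟶ Y) (g : Y ⟶ Z) :
    IsMatrixProduct (entries f) (entries g) (entries (f ≫ g)) := mul_spec f g

theorem entries_comp_eq {X Y Z : DirectSumCompletion C} {f : X ⟶ Y} {g : Y ⟶ Z}
    {h : ∀ i j, X.X i ⟶ Z.X j} (H : IsMatrixProduct (entries f) (entries g) h) :
    entries (f ≫ g) = h := (entries_comp f g).unique H

theorem entries_dag {X Y : DirectSumCompletion C} (f : X ⟶ Y) :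
    entries (f†) = fun i j => (entries f j i)† := rfl

theorem entries_sum {X Y : DirectSumCompletion C} {κ : Type*} (s : Finset κ) (f : κ → (X ⟶ Y))
    (i : X.ι) (j : Y.ι) : entries (∑ k ∈ s, f k) i j = ∑ k ∈ s, entries (f k) i j := by
  classical
  induction s using Finset.induction_on with
  | empty => rfl
  | insert a s ha ih =>
    rw [Finset.sum_insert ha, Finset.sum_insert ha, ← ih]
    rfl

theorem block_sub {X Y : DirectSumCompletion C} (f g : X ⟶ Y) {α β : Type} [Fintype α]
    [Fintype β] (p : α → X.ι) (q : β → Y.ι) :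
    block (entries (f - g)) p q = block (entries f) p q - block (entries g) p q := by
  refine (sub_eq_of_eq_add ?_).symm
  ext i j
  exact (sub_add_cancel _ _).symm

theorem pos_block {X : DirectSumCompletion C} {a : X ⟶ X} (h : Pos a) {α : Type} [Fintype α]
    (p : α → X.ι) : Pos (block (entries a) p p) := by
  obtain ⟨b, rfl⟩ := pos_iff.1 h
  exact (entries_comp b (b†)).pos_block p

theorem pos_block_sub {X : DirectSumCompletion C} {a b : End X} (h : IsPos (b - a)) {α : Type}
    [Fintype α] (p : α → X.ι) :
    Pos (block (entries (b : X ⟶ X)) p p - block (entries (a : X ⟶ X)) p p) :=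
  Eq.mp (congrArg Pos (block_sub (X := X) (Y := X) b a p p)) (pos_block h p)

section CStar
variable (X : DirectSumCompletion C)

/-- The norm of a bounded matrix: its least bound. -/
noncomputable def matNorm (f : End X) : ℝ := sInf {r | IsBoundedBy (entries (f : X ⟶ X)) r}

variable {X}

theorem isBoundedBy_matNorm (f : End X) : IsBoundedBy (entries (f : X ⟶ X)) (matNorm X f) := by
  have hne : {r | IsBoundedBy (entries (f : X ⟶ X)) r}.Nonempty := entries_bounded (f : X ⟶ X)
  refine .of_forall_lt (le_csInf hne fun r hr => hr.nonneg) fun s hs => ?_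
  obtain ⟨r, hr, hrs⟩ := exists_lt_of_csInf_lt hne hs
  exact fun α β _ _ p q => (hr α β p q).mono hrs.le

theorem matNorm_le_iff {f : End X} {r : ℝ} :
    matNorm X f ≤ r ↔ IsBoundedBy (entries (f : X ⟶ X)) r :=
  ⟨fun h α β _ _ p q => (isBoundedBy_matNorm f α β p q).mono h,
    fun h => csInf_le ⟨0, fun _ hr => hr.nonneg⟩ h⟩

theorem matNorm_nonneg (f : End X) : 0 ≤ matNorm X f := (isBoundedBy_matNorm f).nonneg

/-- The endomorphisms of a formal direct sum, as a C*-algebra. -/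
noncomputable abbrev cstarAlgebra (X : DirectSumCompletion C) : CStarAlgebra (End X) :=
  let N : AddGroupNorm (End X) :=
    { toFun := matNorm X
      map_zero' := le_antisymm (matNorm_le_iff.2 .zero) (matNorm_nonneg _)
      add_le' := fun f g => matNorm_le_iff.2 ((isBoundedBy_matNorm f).add (isBoundedBy_matNorm g))
      neg' := fun f => by
        have key : ∀ f : End X, matNorm X (-f) ≤ matNorm X f := fun f => by
          have := (isBoundedBy_matNorm f).smul (-1)
          simp only [neg_smul, one_smul, norm_neg, norm_one, one_mul] at this
          exact matNorm_le_iff.2 this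
        exact le_antisymm (key f) (by simpa using key (-f))
      eq_zero_of_map_eq_zero' := fun f hf => by
        have := isBoundedBy_matNorm f
        rw [hf] at this
        exact hom_ext this.eq_zero }
  let _ : NormedAddCommGroup (End X) := N.toNormedAddCommGroup
  let _ : NormedRing (End X) :=
    { (inferInstance : Ring (End X)), (inferInstance : NormedAddCommGroup (End X)) with
      norm_mul_le := fun f g => by
        change matNorm X _ ≤ matNorm X f * matNorm X g
        -- the product of `End X` is composition in the reverse order
        rw [mul_comm]
        exact matNorm_le_iff.2 ((entries_comp (g : X ⟶ X) f).isBoundedBy (isBoundedBy_matNorm g)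
          (isBoundedBy_matNorm f)) }
  let _ : NormedAlgebra ℂ (End X) :=
    { (inferInstance : Algebra ℂ (End X)) with
      norm_smul_le := fun c f => matNorm_le_iff.2 ((isBoundedBy_matNorm f).smul c) }
  have : CStarRing (End X) := ⟨fun f => by
    change matNorm X f * matNorm X f ≤ matNorm X ((f : X ⟶ X) ≫ (f : X ⟶ X)†)
    have h0 := matNorm_nonneg (X := X) ((f : X ⟶ X) ≫ (f : X ⟶ X)†)
    have h1 := isBoundedBy_matNorm (X := X) ((f : X ⟶ X) ≫ (f : X ⟶ X)†)
    rw [← Real.sq_sqrt h0] at h1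
    have h2 := matNorm_le_iff.2 ((entries_comp (f : X ⟶ X) ((f : X ⟶ X)†)).isBoundedBy_of_mul_dag
      (Real.sqrt_nonneg _) h1)
    rw [← sq, ← Real.le_sqrt (matNorm_nonneg f)]
    · exact h2
    · exact h0⟩
  have : CompleteSpace (End X) := by
    refine NormedAddCommGroup.completeSpace_of_summable_imp_tendsto fun u hu => ?_
    obtain ⟨h, hh⟩ := exists_sum_of_isBoundedBy (f := fun n => entries (u n : X ⟶ X)) hu
      fun n => isBoundedBy_matNorm (u n)
    have hb : IsBoundedMatrix h := by
      have := (hh 0).isBoundedMatrix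
      simpa using this
    let H : End X := ofMatrix (X := X) (Y := X) h hb
    refine ⟨H, ?_⟩
    rw [tendsto_iff_norm_sub_tendsto_zero]
    refine squeeze_zero (fun _ => norm_nonneg _) (fun n => ?_)
      (tendsto_sum_nat_add fun m => matNorm X (u m))
    rw [norm_sub_rev]
    refine matNorm_le_iff.2 ?_
    have e : entries ((H - ∑ i ∈ Finset.range n, u i : End X) : X ⟶ X) =
        fun i j => h i j - ∑ m ∈ Finset.range n, entries (u m : X ⟶ X) i j := by
      funext i j
      exact congrArg (h i j - ·) (entries_sum _ _ i j)
    rw [e]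
    exact hh n
  CStarAlgebra.mk

/-- A bounded matrix is positive as soon as all its finite principal blocks are, because in the
C*-algebra of bounded matrices positivity of a self-adjoint element `a` means
`‖‖a‖ - a‖ ≤ ‖a‖`, and norms are computed on blocks. -/
theorem isPos_of_blocks {a : End X} (h : ∀ (α : Type) [Fintype α] (p : α ↪ X.ι),
    Pos (block (entries (a : X ⟶ X)) p p)) : IsPos a := by
  classical
  let _ := cstarAlgebra X
  let _ := CStarAlgebra.spectralOrder (End X)
  have := CStarAlgebra.spectralOrderedRing (End X)
  have ha : IsSelfAdjoint a := by
    refine hom_ext fun i j => ?_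
    let J : Finset X.ι := {i, j}
    obtain ⟨α, hα⟩ := exists_finEnum (J := J) (j := i) (by simp [J])
    obtain ⟨β, hβ⟩ := exists_finEnum (J := J) (j := j) (by simp [J])
    have := congrFun (congrFun (h _ (finEnum J)).dag_eq α) β
    change (entries (a : X ⟶ X) (finEnum J β) (finEnum J α))† =
      entries (a : X ⟶ X) (finEnum J α) (finEnum J β) at this
    rw [hα, hβ] at this
    exact this
  have hs : SpectrumRestricts a ContinuousMap.realToNNReal := by
    refine (SpectrumRestricts.nnreal_iff_nnnorm ha le_rfl).2 ?_
    change ‖_‖ ≤ ‖a‖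
    refine matNorm_le_iff.2 (.of_principal fun α _ p => ?_)
    have e : block (entries ((algebraMap ℝ (End X) ‖a‖₊ - a : End X) : X ⟶ X)) p p =
        ((matNorm X a : ℝ) : ℂ) • 𝟙 _ - block (entries (a : X ⟶ X)) p p := by
      rw [← block_id p]
      exact block_sub (X := X) (Y := X) (((matNorm X a : ℝ) : ℂ) • 𝟙 X) a p p
    rw [e]
    have hb := isBoundedBy_matNorm (X := X) a α α p p
    refine NormLE.of_pos (r := matNorm X a) (hb.pos_sub (h α p).dag_eq) hb.1 ?_
    rw [sub_sub_cancel]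
    exact h α p
  have h0 : 0 ≤ a := by
    rw [SpectrumRestricts.nnreal_iff] at hs
    exact (StarOrderedRing.nonneg_iff_spectrum_nonneg (R := ℝ) a ha).2 hs
  exact CStarAlgebra.nonneg_iff_eq_star_mul_self.1 h0

theorem isPos_add {a b : End X} (ha : IsPos a) (hb : IsPos b) : IsPos (a + b) :=
  isPos_of_blocks fun _ _ p => (pos_block ha p).add (pos_block hb p)

end CStar

end DirectSumCompletion

/-! ### Formal direct sums are orthogonal direct sums -/

section General
variable {C : Type u} [Category.{v} C] [Preadditive C] [Linear ℂ C] [StarCategory C]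

theorem inc_comp_sum {ι : Type*} {c : ι → C} {x : C} {inc : ∀ i, c i ⟶ x}
    (h1 : ∀ i, inc i ≫ (inc i)† = 𝟙 (c i)) (h2 : ∀ i j, i ≠ j → inc i ≫ (inc j)† = 0)
    {s : Finset ι} {i : ι} (hi : i ∈ s) : inc i ≫ ∑ i ∈ s, (inc i)† ≫ inc i = inc i := by
  rw [Preadditive.comp_sum, Finset.sum_eq_single i]
  · rw [reassoc_of% (h1 i)]
  · intro j _ hj
    rw [← Category.assoc (inc i), h2 i j (Ne.symm hj), Limits.zero_comp]
  · exact fun h => (h hi).elim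

/-- Finite sums of range projections of orthogonal isometries are projections. -/
theorem sum_isProjection {ι : Type*} {c : ι → C} {x : C} {inc : ∀ i, c i ⟶ x}
    (h1 : ∀ i, inc i ≫ (inc i)† = 𝟙 (c i)) (h2 : ∀ i j, i ≠ j → inc i ≫ (inc j)† = 0)
    (s : Finset ι) : (∑ i ∈ s, (inc i)† ≫ inc i)† = ∑ i ∈ s, (inc i)† ≫ inc i ∧
      (∑ i ∈ s, (inc i)† ≫ inc i) ≫ (∑ i ∈ s, (inc i)† ≫ inc i) = ∑ i ∈ s, (inc i)† ≫ inc i := by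
  refine ⟨by simp [dag_sum], ?_⟩
  rw [Preadditive.sum_comp]
  refine Finset.sum_congr rfl fun i hi => ?_
  rw [Category.assoc, inc_comp_sum h1 h2 hi]

theorem pos_one_sub_sum {ι : Type*} {c : ι → C} {x : C} {inc : ∀ i, c i ⟶ x}
    (h1 : ∀ i, inc i ≫ (inc i)† = 𝟙 (c i)) (h2 : ∀ i j, i ≠ j → inc i ≫ (inc j)† = 0)
    (s : Finset ι) : Pos (𝟙 x - ∑ i ∈ s, (inc i)† ≫ inc i) := by
  obtain ⟨e1, e2⟩ := sum_isProjection h1 h2 s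
  exact pos_iff.2 ⟨𝟙 x - ∑ i ∈ s, (inc i)† ≫ inc i, by
    simp only [dag_sub, dag_id, e1, Preadditive.sub_comp, Preadditive.comp_sub, Category.id_comp,
      Category.comp_id, e2]
    abel⟩

end General

namespace DirectSumCompletion
variable {C : Type u} [Category.{v} C] [Preadditive C] [Linear ℂ C] [StarCategory C]
  [WStarCategory C]

/-- The inclusion of the partial sum over a subset of the index set. -/
noncomputable def subInc (Y : DirectSumCompletion C) {K : Type v} (e : K ↪ Y.ι) :
    (⟨K, fun k => Y.X (e k)⟩ : DirectSumCompletion C) ⟶ Y :=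
  ofMatrix (X := ⟨K, fun k => Y.X (e k)⟩) (fun k j => idMatrix Y.X (e k) j) (by
    obtain ⟨r, hr⟩ := idMatrix_bounded Y.X
    exact ⟨r, fun α β _ _ p q => hr α β (p.trans e) q⟩)

theorem entries_subInc_comp {Y Z : DirectSumCompletion C} {K : Type v} (e : K ↪ Y.ι) (f : Y ⟶ Z) :
    entries (subInc Y e ≫ f) = fun k j => entries f (e k) j :=
  entries_comp_eq fun k j => idMatrix_mul (entries f) (e k) j

/-- The inclusion of a summand of a formal direct sum. -/
noncomputable def inc (Y : DirectSumCompletion C) (i : Y.ι) : (inclusion C).obj (Y.X i) ⟶ Y :=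
  subInc Y (K := PUnit) ⟨fun _ => i, fun _ _ _ => rfl⟩

theorem entries_inc_comp {Y Z : DirectSumCompletion C} (i : Y.ι) (f : Y ⟶ Z) :
    entries (inc Y i ≫ f) = fun _ j => entries f i j := entries_subInc_comp _ f

/-- A morphism out of a formal direct sum is determined by its restrictions to the terms. -/
theorem hom_ext_inc {Y Z : DirectSumCompletion C} {f g : Y ⟶ Z}
    (h : ∀ i, inc Y i ≫ f = inc Y i ≫ g) : f = g :=
  hom_ext fun i j => by
    have := congrArg entries (h i)
    rw [entries_inc_comp, entries_inc_comp] at this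
    exact congrFun (congrFun this PUnit.unit) j

theorem inc_comp_inc_dag {Y Z : DirectSumCompletion C} (f : Y ⟶ Z) (i : Y.ι) (j : Z.ι) :
    inc Y i ≫ f ≫ (inc Z j)† = (inclusion C).map (entries f i j) := by
  have h : f ≫ (inc Z j)† = (inc Z j ≫ f†)† := by simp
  refine hom_ext fun _ _ => ?_
  rw [entries_inc_comp, h, entries_dag, entries_inc_comp]
  exact StarCategory.dag_dag _

theorem inc_isometry (Y : DirectSumCompletion C) (i : Y.ι) : inc Y i ≫ (inc Y i)† = 𝟙 _ := by
  have := inc_comp_inc_dag (𝟙 Y) i i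
  rw [Category.id_comp, entries_id, idMatrix_self] at this
  exact this.trans ((inclusion C).map_id _)

theorem inc_orthogonal (Y : DirectSumCompletion C) (i j : Y.ι) (h : i ≠ j) :
    inc Y i ≫ (inc Y j)† = 0 := by
  have := inc_comp_inc_dag (𝟙 Y) i j
  rw [Category.id_comp, entries_id, idMatrix_ne _ h] at this
  exact this

theorem isOrthogonalDirectSum_inc (Y : DirectSumCompletion C) :
    IsOrthogonalDirectSum (fun i => (inclusion C).obj (Y.X i)) Y (inc Y) where
  isometry := inc_isometry Y
  orthogonal := inc_orthogonal Y
  sum_eq := by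
    refine ⟨?_, ?_⟩
    · rintro _ ⟨s, rfl⟩
      exact pos_one_sub_sum (inc_isometry Y) (inc_orthogonal Y) s
    · intro (b : Y ⟶ Y) hb
      refine isPos_of_blocks fun α _ p => ?_
      have h1 : Pos (b - ∑ i ∈ Finset.univ.map p, (inc Y i)† ≫ inc Y i) :=
        hb _ ⟨Finset.univ.map p, rfl⟩
      have h2 := pos_block_sub h1 p
      refine Eq.mp (congrArg Pos ?_) h2
      refine Eq.trans ?_ (block_sub b (𝟙 Y) p p).symm
      congr 1
      ext a c
      have h3 := congrArg entries (inc_comp_sum (inc_isometry Y) (inc_orthogonal Y)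
        (s := Finset.univ.map p) (i := p a) (by simp))
      rw [entries_inc_comp] at h3
      have h4 := congrArg entries (Category.comp_id (inc Y (p a)))
      rw [entries_inc_comp] at h4
      exact congrFun (congrFun (h3.trans h4.symm) PUnit.unit) (p c)

/-! ### Suprema in the direct sum completion are computed on finite blocks -/

/-- The entries of a bounded increasing net converge ultraweakly, and their limits form a bounded
matrix. Its blocks are the suprema of the blocks, and it is the supremum of the net. -/
theorem isSup_block {X : DirectSumCompletion C} {S : Set (End X)} (hne : S.Nonempty)
    (hdir : DirectedOn (fun s t => IsPos (t - s)) S) (hpos : ∀ s ∈ S, IsPos s) {a : X ⟶ X}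
    (ha : IsSup (A := End X) S a) {α : Type} [Fintype α] (p : α ↪ X.ι) :
    IsSup (A := End (Mat_.mk α fun i => X.X (p i)))
      ((fun s : X ⟶ X => block (entries s) p p) '' S) (block (entries a) p p) := by
  classical
  have hadd : ∀ a b : End X, IsPos a → IsPos b → IsPos (a + b) := fun _ _ => isPos_add
  let _ := posPreorder hadd S
  have : IsDirectedOrder S := isDirectedOrder_posPreorder hadd hdir
  have : Nonempty S := hne.to_subtype
  let m : S → (X ⟶ X) := fun s => (s : End X)
  have hm0 : ∀ s, Pos (m s) := fun s => hpos s s.2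
  have hma : ∀ s, Pos (a - m s) := fun s => ha.1 s s.2
  have hm : ∀ {α : Type} [Fintype α] (p : α → X.ι) (s t : S), s ≤ t →
      Pos (block (entries (m t)) p p - block (entries (m s)) p p) := fun p s t hst =>
    pos_block_sub hst p
  have hma' : ∀ {α : Type} [Fintype α] (p : α → X.ι) (s : S),
      Pos (block (entries a) p p - block (entries (m s)) p p) := fun p s =>
    pos_block_sub (hma s) p
  have hlim : ∀ i j, ∃ h : X.X i ⟶ X.X j,
      UWTendsto atTop (fun s => (Mat_.embedding C).map (entries (m s) i j))
        ((Mat_.embedding C).map h) := by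
    intro i j
    let J : Finset X.ι := {i, j}
    obtain ⟨b, hb⟩ := exists_uwTendsto (c := fun s => block (entries (m s)) (finEnum J) (finEnum J))
      (hm _) (fun s => pos_block (hm0 s) _) (hma' _)
    have hb2 := (hb.comp_right ((block (idMatrix X.X) (ptEmb j) (finEnum J))†)).comp_left
      (block (idMatrix X.X) (ptEmb i) (finEnum J))
    have e : ∀ s, block (idMatrix X.X) (ptEmb i) (finEnum J) ≫
        block (entries (m s)) (finEnum J) (finEnum J) ≫
        (block (idMatrix X.X) (ptEmb j) (finEnum J))† =
        (Mat_.embedding C).map (entries (m s) i j) := fun s =>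
      (block_eq_corner (entries (m s)) (ptEmb i) (finEnum J) (ptEmb j)
        (fun _ => exists_finEnum (j := i) (by simp [J]))
        fun _ => exists_finEnum (j := j) (by simp [J])).symm
    simp only [e] at hb2
    obtain ⟨h, hh⟩ := (Mat_.embedding C).map_surjective (X := X.X i) (Y := X.X j) _
    exact ⟨h, hh ▸ hb2⟩
  choose h hh using hlim
  have hblock : ∀ {α : Type} [Fintype α] (p : α → X.ι),
      UWTendsto atTop (fun s => block (entries (m s)) p p) (block h p p) :=
    fun p => .of_entries fun i j => hh (p i) (p j)
  have hle : ∀ {α : Type} [Fintype α] (p : α → X.ι),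
      Pos (block (entries a) p p - block h p p) := fun p =>
    ((hblock p).const_sub _).pos (Eventually.of_forall fun s => hma' p s)
  have hbd : IsBoundedMatrix h := by
    obtain ⟨r, hr⟩ := entries_bounded a
    refine ⟨r, IsBoundedBy.of_principal fun α _ p => ?_⟩
    have h1 : Pos (block h p p) :=
      (hblock p).pos (Eventually.of_forall fun s => pos_block (hm0 s) p)
    refine .of_pos h1 (hr α α p p).1 ?_
    have h2 : Pos (block (entries a) p p) := by
      have := (hle p).add h1
      rwa [sub_add_cancel] at this
    have := ((hr α α p p).pos_sub h2.dag_eq).add (hle p)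
    rwa [sub_add_sub_cancel] at this
  -- the entrywise limit is an upper bound, so that it dominates the supremum
  let b : X ⟶ X := ofMatrix h hbd
  have hba : Pos (b - a) := ha.2 b fun s hs => isPos_of_blocks fun α _ p => by
    refine Eq.mp (congrArg Pos (block_sub (X := X) (Y := X) b s p p).symm) ?_
    refine ((hblock p).sub_const _).pos ?_
    filter_upwards [eventually_ge_atTop (⟨s, hs⟩ : S)] with t ht using hm p _ t ht
  have heq : block (entries a) p p = block h p p :=
    (hle p).antisymm (pos_block_sub hba p)
  have := isSup_of_uwTendsto (hm p) (heq ▸ hblock p)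
  have e : ((fun s : X ⟶ X => block (entries s) p p) '' S) =
      Set.range fun s => block (entries (m s)) p p := by
    ext t
    simp only [Set.mem_image, Set.mem_range, Subtype.exists, m, exists_prop]
    rfl
  rw [e]
  exact this

end DirectSumCompletion

/-! ### Normality of functors out of categories with finite sums -/

section Unitary
universe u₁ u₂
variable {C : Type u₁} [Category.{v} C] [Preadditive C] [Linear ℂ C] [StarCategory C]
variable {D : Type u₂} [Category.{v} D] [Preadditive D] [Linear ℂ D] [StarCategory D]
variable {X Y : C} {u : X ⟶ Y}

theorem bijective_conj (h1 : u ≫ u† = 𝟙 X) (h2 : u† ≫ u = 𝟙 Y) :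
    Function.Bijective fun t : End Y => (u ≫ (t : Y ⟶ Y) ≫ u† : End X) := by
  have e : ∀ t : Y ⟶ Y, u† ≫ (u ≫ t ≫ u†) ≫ u = t := by
    intro t
    have : u† ≫ (u ≫ t ≫ u†) ≫ u = (u† ≫ u) ≫ t ≫ (u† ≫ u) := by simp
    rw [this, h2]; simp
  have e' : ∀ t : X ⟶ X, u ≫ (u† ≫ t ≫ u) ≫ u† = t := by
    intro t
    have : u ≫ (u† ≫ t ≫ u) ≫ u† = (u ≫ u†) ≫ t ≫ (u ≫ u†) := by simp
    rw [this, h1]; simp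
  refine ⟨fun s t hst => ?_, fun t => ⟨u† ≫ (t : X ⟶ X) ≫ u, e' t⟩⟩
  have := congrArg (fun r : X ⟶ X => u† ≫ r ≫ u) hst
  simp only [e] at this
  exact this

theorem conj_star_mul (h2 : u† ≫ u = 𝟙 Y) (t : Y ⟶ Y) :
    u ≫ (t ≫ t†) ≫ u† = (u ≫ t ≫ u†) ≫ (u ≫ t ≫ u†)† := by
  have : (u ≫ t ≫ u†) ≫ (u ≫ t ≫ u†)† = u ≫ t ≫ (u† ≫ u) ≫ t† ≫ u† := by simp
  rw [this, h2]; simp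

theorem isSup_conj_iff (h1 : u ≫ u† = 𝟙 X) (h2 : u† ≫ u = 𝟙 Y) {S : Set (End Y)} {a : Y ⟶ Y} :
    IsSup (A := End X) ((fun s : Y ⟶ Y => u ≫ s ≫ u†) '' S) (u ≫ a ≫ u†) ↔
      IsSup (A := End Y) S a :=
  isSup_image_iff (A := End Y) (B := End X) (f := fun s : Y ⟶ Y => u ≫ s ≫ u†)
    (bijective_conj h1 h2)
    (fun s t => by
      change u ≫ ((s : Y ⟶ Y) - (t : Y ⟶ Y)) ≫ u† = _
      rw [Preadditive.sub_comp, Preadditive.comp_sub])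
    fun t => conj_star_mul h2 t

theorem isPos_conj_iff (h1 : u ≫ u† = 𝟙 X) (h2 : u† ≫ u = 𝟙 Y) {a : Y ⟶ Y} :
    Pos (u ≫ a ≫ u†) ↔ Pos a :=
  isPos_image_iff (A := End Y) (B := End X) (f := fun s : Y ⟶ Y => u ≫ s ≫ u†)
    (bijective_conj h1 h2) fun t => conj_star_mul h2 t

/-- If every formal finite sum of objects of `C` is represented by an object of `C`, normality of
a functor has to be verified on the endomorphisms of single objects only. -/
theorem IsStarFunctor.isWStarFunctor_of_sums {G : C ⥤ D} (hG : IsStarFunctor G)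
    (hsum : ∀ X : Mat_ C, ∃ (Y : C) (u : X ⟶ (Mat_.embedding C).obj Y),
      u ≫ u† = 𝟙 X ∧ u† ≫ u = 𝟙 _)
    (hn : ∀ Y : C, PreservesSups (A := End Y) (B := End (G.obj Y)) fun f : Y ⟶ Y => G.map f) :
    IsWStarFunctor G where
  toIsStarFunctor := hG
  normal X := by
    obtain ⟨Y, u, h1, h2⟩ := hsum X
    intro S hne hdir hpos a ha
    let χ : End Y → End X := fun t : Y ⟶ Y => u ≫ (Mat_.embedding C).map t ≫ u†
    have hemb := isStarFunctor_embedding (C := C)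
    have hχsub : ∀ s t, χ s - χ t = χ (s - t) := by
      intro s t
      change _ = u ≫ (Mat_.embedding C).map ((s : Y ⟶ Y) - (t : Y ⟶ Y)) ≫ u†
      rw [hemb.map_sub, Preadditive.sub_comp, Preadditive.comp_sub]
    have hχpos : ∀ t, IsPos (χ t) ↔ IsPos t := fun t =>
      (isPos_conj_iff h1 h2).trans hemb.map_pos_iff
    have hχsup : ∀ S a, IsSup (χ '' S) (χ a) ↔ IsSup S a := by
      intro S a
      have := (isSup_conj_iff h1 h2 (S := (fun s : Y ⟶ Y => (Mat_.embedding C).map s) '' S)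
        (a := (Mat_.embedding C).map (a : Y ⟶ Y))).trans hemb.isSup_map_iff
      rw [Set.image_image] at this
      exact this
    have hχsurj : Function.Surjective χ := by
      intro t
      obtain ⟨s, hs⟩ := (bijective_conj h1 h2).2 t
      obtain ⟨s', rfl⟩ := (Mat_.embedding C).map_surjective (X := Y) (Y := Y) s
      exact ⟨s', hs⟩
    obtain ⟨a, rfl⟩ := hχsurj a
    obtain ⟨S, rfl⟩ : ∃ S', S = χ '' S' := ⟨χ ⁻¹' S, (Set.image_preimage_eq S hχsurj).symm⟩
    have h3 := hn Y S (Set.image_nonempty.1 hne) (by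
      intro s hs t ht
      obtain ⟨_, ⟨w, hw, rfl⟩, h1, h2⟩ := hdir _ ⟨s, hs, rfl⟩ _ ⟨t, ht, rfl⟩
      rw [hχsub, hχpos] at h1 h2
      exact ⟨w, hw, h1, h2⟩) (fun s hs => (hχpos s).1 (hpos _ ⟨s, hs, rfl⟩)) a ((hχsup _ _).1 ha)
    let U : matObj G X ⟶ (Mat_.embedding D).obj (G.obj Y) := matMap G u
    have hU1 : U ≫ U† = 𝟙 _ := by
      have := congrArg (matMap G) h1
      rwa [hG.matMap_comp, hG.matMap_dag, hG.matMap_id] at this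
    have hU2 : U† ≫ U = 𝟙 _ := by
      have := congrArg (matMap G) h2
      rwa [hG.matMap_comp, hG.matMap_dag, hG.matMap_id] at this
    have h4 := (isSup_conj_iff hU1 hU2).2 ((isStarFunctor_embedding (C := D)).isSup_map_iff.2 h3)
    rw [Set.image_image, Set.image_image] at h4
    have e : ∀ t : End Y, endMap G X (χ t) =
        U ≫ (Mat_.embedding D).map (G.map (t : Y ⟶ Y)) ≫ U† := by
      intro t
      change matMap G (u ≫ (Mat_.embedding C).map (t : Y ⟶ Y) ≫ u†) = _
      rw [hG.matMap_comp, hG.matMap_comp, hG.matMap_dag]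
      rfl
    rw [Set.image_image, e]
    simp only [e]
    exact h4

end Unitary

namespace DirectSumCompletion
variable {C : Type u} [Category.{v} C] [Preadditive C] [Linear ℂ C] [StarCategory C]
  [WStarCategory C]

/-- A formal finite sum of formal direct sums is represented by their concatenation. -/
theorem exists_unitary (X : Mat_ (DirectSumCompletion C)) :
    ∃ (Y : DirectSumCompletion C) (u : X ⟶ (Mat_.embedding (DirectSumCompletion C)).obj Y),
      u ≫ u† = 𝟙 X ∧ u† ≫ u = 𝟙 _ := by
  classical
  let Y : DirectSumCompletion C := ⟨Σ k : X.ι, (X.X k).ι, fun i => (X.X i.1).X i.2⟩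
  let e : ∀ k : X.ι, X.X k ⟶ Y := fun k => subInc Y (Function.Embedding.sigmaMk k)
  have he : ∀ k l, e k ≫ (e l)† = (𝟙 X : X ⟶ X) k l := by
    intro k l
    have h1 : entries (e k ≫ (e l)†) = fun a b => entries ((e l)†) ⟨k, a⟩ b :=
      entries_subInc_comp (Y := Y) (Function.Embedding.sigmaMk k) ((e l)†)
    refine hom_ext fun a b => ?_
    rw [h1, entries_dag]
    change (idMatrix Y.X ⟨l, b⟩ ⟨k, a⟩)† = _
    rw [idMatrix_dag]
    by_cases hkl : k = l
    · subst hkl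
      rw [Mat_.id_apply_self, entries_id]
      by_cases hab : a = b
      · subst hab
        rw [idMatrix_self, idMatrix_self]
      · rw [idMatrix_ne _ hab, idMatrix_ne]
        rintro ⟨⟩
        exact hab rfl
    · rw [Mat_.id_apply_of_ne _ _ _ hkl, idMatrix_ne]
      · rfl
      · intro h
        exact hkl (congrArg Sigma.fst h)
  refine ⟨Y, matOf fun k _ => e k, ?_, ?_⟩
  · ext k l
    rw [← he, Mat_.comp_apply]
    exact Fintype.sum_unique (fun _ : PUnit => e k ≫ (e l)†)
  · have h1 : ∑ k, (e k)† ≫ e k = 𝟙 Y := by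
      refine hom_ext_inc fun i => ?_
      obtain ⟨k, a⟩ := i
      have h2 : inc Y ⟨k, a⟩ = inc (X.X k) a ≫ e k := by
        refine hom_ext fun b j => ?_
        rw [entries_inc_comp]
        rfl
      rw [h2, Category.comp_id, Category.assoc, Preadditive.comp_sum, Finset.sum_eq_single k]
      · rw [← Category.assoc (e k), he, Mat_.id_apply_self, Category.id_comp]
      · intro l _ hl
        rw [← Category.assoc (e k), he, Mat_.id_apply_of_ne _ _ _ (Ne.symm hl), Limits.zero_comp]
      · simp
    refine Mat_.hom_ext (M := (Mat_.embedding (DirectSumCompletion C)).obj Y)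
      (N := (Mat_.embedding (DirectSumCompletion C)).obj Y) _ _ fun i j => ?_
    refine (Mat_.comp_apply _ _ i j).trans (h1.trans ?_)
    exact (Mat_.id_apply_self ((Mat_.embedding (DirectSumCompletion C)).obj Y) i).symm

/-! ### Functoriality of the direct sum completion -/

section Map
variable {D : Type w} [Category.{v} D] [Preadditive D] [Linear ℂ D] [StarCategory D]
  [WStarCategory D] {F : C ⥤ D}

theorem isBoundedMatrix_map (hF : IsStarFunctor F) {ι κ : Type*} {X : ι → C} {Y : κ → C}
    {f : ∀ i j, X i ⟶ Y j} (hf : IsBoundedMatrix f) :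
    IsBoundedMatrix (X := fun i => F.obj (X i)) (Y := fun j => F.obj (Y j))
      fun i j => F.map (f i j) := by
  obtain ⟨r, hr⟩ := hf
  exact ⟨r, fun α β _ _ p q => hF.matMap_normLE (hr α β p q)⟩

/-- The entrywise extension of a functor to the direct sum completions. -/
noncomputable def mapFunctor (F : C ⥤ D) (hF : IsWStarFunctor F) :
    DirectSumCompletion C ⥤ DirectSumCompletion D where
  obj X := ⟨X.ι, fun i => F.obj (X.X i)⟩
  map {X Y} f := ofMatrix (X := ⟨X.ι, fun i => F.obj (X.X i)⟩) (fun i j => F.map (entries f i j))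
    (isBoundedMatrix_map hF.toIsStarFunctor (entries_bounded f))
  map_id X := by
    refine hom_ext fun i j => ?_
    change F.map (idMatrix X.X i j) = idMatrix (fun i => F.obj (X.X i)) i j
    by_cases h : i = j
    · subst h
      rw [idMatrix_self, idMatrix_self, F.map_id]
    · rw [idMatrix_ne _ h, idMatrix_ne _ h, hF.map_zero]
  map_comp {X Y Z} f g := by
    symm
    refine Subtype.ext (entries_comp_eq fun i k => ?_)
    have := hF.hasUWSum (entries_comp f g i k)
    refine Eq.mp (congrArg (HasUWSum · _) (funext fun j => ?_)) this
    exact congrArg (Mat_.embedding D).map (F.map_comp (entries f i j) (entries g j k))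

theorem mapFunctor_isStarFunctor (hF : IsWStarFunctor F) : IsStarFunctor (mapFunctor F hF) where
  map_add _ _ := hom_ext fun _ _ => hF.map_add _ _
  map_smul _ _ := hom_ext fun _ _ => hF.map_smul _ _
  map_dag _ := hom_ext fun _ _ => hF.map_dag _

theorem mapFunctor_isWStarFunctor (hF : IsWStarFunctor F) : IsWStarFunctor (mapFunctor F hF) := by
  refine (mapFunctor_isStarFunctor hF).isWStarFunctor_of_sums exists_unitary fun Y => ?_
  intro S hne hdir hpos a ha
  have hs := mapFunctor_isStarFunctor hF
  refine ⟨?_, ?_⟩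
  · rintro _ ⟨s, hs', rfl⟩
    have := hs.map_pos (ha.1 s hs')
    rwa [hs.map_sub] at this
  · intro b hb
    refine isPos_of_blocks fun α _ p => ?_
    let Z : Mat_ C := Mat_.mk α fun i => Y.X (p i)
    have h1 := isSup_block hne hdir hpos ha p
    have h2 := hF.normal Z _ (hne.image _) (by
      rintro _ ⟨s, hs, rfl⟩ _ ⟨t, ht, rfl⟩
      obtain ⟨w, hw, h1, h2⟩ := hdir s hs t ht
      exact ⟨_, ⟨w, hw, rfl⟩, pos_block_sub h1 p, pos_block_sub h2 p⟩) (by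
      rintro _ ⟨s, hs, rfl⟩
      exact pos_block (hpos s hs) p) _ h1
    refine Eq.mp (congrArg Pos (block_sub _ _ p p).symm) (h2.2 _ ?_)
    rintro _ ⟨_, ⟨s, hs, rfl⟩, rfl⟩
    exact pos_block_sub (hb _ ⟨s, hs, rfl⟩) p

end Map

end DirectSumCompletion

/-! ### Orthogonal direct sums in a W*-category -/

theorem NormLE.of_isometry {C : Type u} [Category.{v} C] [Preadditive C] [Linear ℂ C]
    [StarCategory C] {X Y : C} {f : X ⟶ Y} (h : f ≫ f† = 𝟙 X) : NormLE f 1 :=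
  ⟨zero_le_one, by simpa [h] using pos_zero X⟩

section Preservation
universe u₁ u₂
variable {C : Type u₁} [Category.{v} C] [Preadditive C] [Linear ℂ C] [StarCategory C]
variable {D : Type u₂} [Category.{v} D] [Preadditive D] [Linear ℂ D] [StarCategory D]

/-- A W*-functor is normal on the endomorphisms of single objects. -/
theorem IsWStarFunctor.preservesSups {F : C ⥤ D} (hF : IsWStarFunctor F) (x : C) :
    PreservesSups (A := End x) (B := End (F.obj x)) fun f : x ⟶ x => F.map f := by
  intro S hne hdir hpos a ha
  have hC := isStarFunctor_embedding (C := C)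
  have h1 := hF.normal ((Mat_.embedding C).obj x) _ (hne.image _) (by
    rintro _ ⟨s, hs, rfl⟩ _ ⟨t, ht, rfl⟩
    obtain ⟨w, hw, h1, h2⟩ := hdir s hs t ht
    refine ⟨_, ⟨w, hw, rfl⟩, ?_, ?_⟩
    · have := hC.map_pos h1
      rwa [hC.map_sub] at this
    · have := hC.map_pos h2
      rwa [hC.map_sub] at this) (by
    rintro _ ⟨s, hs, rfl⟩
    exact hC.map_pos (hpos s hs)) _ (hC.isSup_map_iff.2 ha)
  rw [Set.image_image] at h1
  refine (isStarFunctor_embedding (C := D)).isSup_map_iff.1 ?_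
  rw [Set.image_image]
  exact h1

/-- A W*-functor preserves orthogonal direct sums. -/
theorem IsOrthogonalDirectSum.map {F : C ⥤ D} (hF : IsWStarFunctor F) {ι : Type*} {c : ι → C}
    {x : C} {inc : ∀ i, c i ⟶ x} (h : IsOrthogonalDirectSum c x inc) :
    IsOrthogonalDirectSum (fun i => F.obj (c i)) (F.obj x) fun i => F.map (inc i) where
  isometry i := by rw [← hF.map_dag, ← F.map_comp, h.isometry, F.map_id]
  orthogonal i j hij := by
    rw [← hF.map_dag, ← F.map_comp, h.orthogonal i j hij, hF.map_zero]
  sum_eq := by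
    classical
    have hp : ∀ s : Finset ι, Pos (∑ i ∈ s, (inc i)† ≫ inc i) := by
      intro s
      obtain ⟨e1, e2⟩ := sum_isProjection h.isometry h.orthogonal s
      exact pos_iff.2 ⟨_, by rw [e1, e2]⟩
    have hm : ∀ s t : Finset ι, s ⊆ t →
        Pos (∑ i ∈ t, (inc i)† ≫ inc i - ∑ i ∈ s, (inc i)† ≫ inc i) := by
      intro s t hst
      rw [← Finset.sum_sdiff hst, add_sub_cancel_right]
      exact hp _
    have h1 := hF.preservesSups x _ (Set.range_nonempty _) (by
      rintro _ ⟨s, rfl⟩ _ ⟨t, rfl⟩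
      exact ⟨_, ⟨s ∪ t, rfl⟩, hm _ _ Finset.subset_union_left, hm _ _ Finset.subset_union_right⟩)
      (by rintro _ ⟨s, rfl⟩; exact hp s) _ h.sum_eq
    rw [← Set.range_comp] at h1
    refine Eq.mp (congrArg₂ (IsSup (A := End (F.obj x))) (congrArg Set.range (funext fun s => ?_))
      (F.map_id x)) h1
    change F.map (∑ i ∈ s, (inc i)† ≫ inc i) = _
    rw [hF.map_sum]
    exact Finset.sum_congr rfl fun i _ => by rw [F.map_comp, hF.map_dag]

end Preservation

namespace IsOrthogonalDirectSum
variable {D : Type u} [Category.{v} D] [Preadditive D] [Linear ℂ D] [StarCategory D]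
  [WStarCategory D]
variable {ι κ : Type*} {c : ι → D} {x : D} {inc : ∀ i, c i ⟶ x} {d : κ → D} {y : D}
  {inc' : ∀ i, d i ⟶ y}

theorem hasUWSum (h : IsOrthogonalDirectSum c x inc) :
    HasUWSum (fun i => (Mat_.embedding D).map ((inc i)† ≫ inc i))
      (𝟙 ((Mat_.embedding D).obj x)) := by
  classical
  have hE := isStarFunctor_embedding (C := D)
  rw [hasUWSum_iff]
  have hp : ∀ s : Finset ι, Pos (∑ i ∈ s, (Mat_.embedding D).map ((inc i)† ≫ inc i)) := by
    intro s
    refine pos_sum _ _ fun i _ => ?_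
    have := pos_comp_dag ((Mat_.embedding D).map ((inc i)†))
    rwa [← hE.map_dag, StarCategory.dag_dag, ← Functor.map_comp] at this
  refine isSup_uwTendsto (fun s t hst => ?_) hp ?_
  · rw [← Finset.sum_sdiff (show s ⊆ t from hst), add_sub_cancel_right]
    exact hp _
  · have := hE.isSup_map_iff.2 h.sum_eq
    rw [← Set.range_comp] at this
    refine Eq.mp (congrArg₂ (IsSup (A := End ((Mat_.embedding D).obj x)))
      (congrArg Set.range (funext fun s => ?_)) ((Mat_.embedding D).map_id x)) this
    exact hE.map_sum _ _

/-- A morphism out of an orthogonal direct sum is determined by its restrictions to the terms. -/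
theorem hom_ext (h : IsOrthogonalDirectSum c x inc) {z : D} {f g : x ⟶ z}
    (H : ∀ i, inc i ≫ f = inc i ≫ g) : f = g := by
  apply (Mat_.embedding D).map_injective
  have h1 := h.hasUWSum.comp_right ((Mat_.embedding D).map f)
  have h2 := h.hasUWSum.comp_right ((Mat_.embedding D).map g)
  simp only [← Functor.map_comp, Category.assoc, H, Category.id_comp] at h1 h2
  exact h1.unique h2

/-- A morphism between orthogonal direct sums is determined by its matrix. -/
theorem hom_ext₂ (h : IsOrthogonalDirectSum c x inc) (h' : IsOrthogonalDirectSum d y inc')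
    {f g : x ⟶ y} (H : ∀ i j, inc i ≫ f ≫ (inc' j)† = inc i ≫ g ≫ (inc' j)†) : f = g := by
  refine h.hom_ext fun i => ?_
  rw [← StarCategory.dag_dag (inc i ≫ f), ← StarCategory.dag_dag (inc i ≫ g)]
  congr 1
  refine h'.hom_ext fun j => ?_
  have := congrArg StarCategory.dag (H i j)
  simpa using this

/-- The column of the inclusions is isometric. -/
theorem isMatrixProduct_inc (h : IsOrthogonalDirectSum c x inc) :
    IsMatrixProduct (Y := fun _ : PUnit.{v + 1} => x) (fun i _ => inc i) (fun _ i => (inc i)†)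
      (idMatrix c) := by
  intro i j
  have e : idMatrix c i j = inc i ≫ (inc j)† := by
    by_cases hij : i = j
    · subst hij
      rw [idMatrix_self, h.isometry]
    · rw [idMatrix_ne _ hij, h.orthogonal i j hij]
  rw [e]
  exact HasUWSum.single PUnit.unit
    (a := fun _ : PUnit.{v + 1} => (Mat_.embedding D).map (inc i ≫ (inc j)†))
    fun _ hj => (hj rfl).elim

theorem isBoundedBy_inc (h : IsOrthogonalDirectSum c x inc) :
    IsBoundedBy (Y := fun _ : PUnit.{v + 1} => x) (fun i _ => inc i) 1 :=
  h.isMatrixProduct_inc.isBoundedBy_of_mul_dag zero_le_one (by simpa using IsBoundedBy.id c)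

/-- The matrix of a morphism between orthogonal direct sums is bounded. -/
theorem isBoundedMatrix (h : IsOrthogonalDirectSum c x inc) (h' : IsOrthogonalDirectSum d y inc')
    (f : x ⟶ y) : IsBoundedMatrix fun i j => inc i ≫ f ≫ (inc' j)† := by
  have h1 : IsMatrixProduct (Y := fun _ : PUnit.{v + 1} => x) (Z := fun _ : PUnit.{v + 1} => y)
      (fun i _ => inc i) (fun _ _ => f) (fun i _ => inc i ≫ f) := fun i _ =>
    HasUWSum.single PUnit.unit
      (a := fun _ : PUnit.{v + 1} => (Mat_.embedding D).map (inc i ≫ f))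
      fun _ hj => (hj rfl).elim
  have h2 : IsMatrixProduct (Y := fun _ : PUnit.{v + 1} => y)
      (fun i _ => inc i ≫ f) (fun _ j => (inc' j)†) (fun i j => inc i ≫ f ≫ (inc' j)†) :=
    fun i j => by
      have h3 := HasUWSum.single PUnit.unit
        (a := fun _ : PUnit.{v + 1} => (Mat_.embedding D).map ((inc i ≫ f) ≫ (inc' j)†))
        fun _ hj => (hj rfl).elim
      simpa only [Category.assoc] using h3
  exact h2.bounded (h1.bounded h.isBoundedBy_inc.isBoundedMatrix (isBoundedMatrix_single f))
    h'.isBoundedBy_inc.dag.isBoundedMatrix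

/-- Every bounded matrix is the matrix of a morphism between the orthogonal direct sums, namely of
its product with the row and the column of the inclusions. -/
theorem exists_hom (h : IsOrthogonalDirectSum c x inc) (h' : IsOrthogonalDirectSum d y inc')
    {g : ∀ i j, c i ⟶ d j} (hg : IsBoundedMatrix g) :
    ∃ f : x ⟶ y, ∀ i j, inc i ≫ f ≫ (inc' j)† = g i j := by
  obtain ⟨P, hP⟩ := hg.exists_product h'.isBoundedBy_inc.isBoundedMatrix
  have hPb := hP.bounded hg h'.isBoundedBy_inc.isBoundedMatrix
  obtain ⟨f, hf⟩ := IsBoundedMatrix.exists_product (h.isBoundedBy_inc.dag).isBoundedMatrix hPb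
  let o : PUnit.{v + 1} := PUnit.unit
  have h1 : ∀ i, inc i ≫ f o o = P i o := by
    intro i
    apply (Mat_.embedding D).map_injective
    have h2 := (hf o o).comp_left ((Mat_.embedding D).map (inc i))
    simp only [← Functor.map_comp] at h2
    have h3 := HasUWSum.single i
      (a := fun k => (Mat_.embedding D).map (inc i ≫ (inc k)† ≫ P k o)) fun k hk => by
        rw [← Category.assoc, h.orthogonal i k (Ne.symm hk), Limits.zero_comp, Functor.map_zero]
    rw [← Category.assoc (inc i), h.isometry, Category.id_comp] at h3
    exact h2.unique h3
  refine ⟨f o o, fun i j => ?_⟩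
  rw [← Category.assoc, h1]
  apply (Mat_.embedding D).map_injective
  have h2 := (hP i o).comp_right ((Mat_.embedding D).map ((inc' j)†))
  simp only [← Functor.map_comp, Category.assoc] at h2
  have h3 := HasUWSum.single j
    (a := fun k => (Mat_.embedding D).map (g i k ≫ inc' k ≫ (inc' j)†)) fun k hk => by
      rw [h'.orthogonal k j hk, Limits.comp_zero, Functor.map_zero]
  rw [h'.isometry, Category.comp_id] at h3
  exact h2.unique h3

end IsOrthogonalDirectSum

/-! ### Summation of formal direct sums -/

section Summation
variable {D : Type u} [Category.{v} D] [Preadditive D] [Linear ℂ D] [StarCategory D]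
  [WStarCategory D]

open DirectSumCompletion (entries ofMatrix)

/-- A choice of an orthogonal direct sum of the terms of a formal direct sum. -/
noncomputable def sumObj (hD : AdmitsAllDirectSums D) (Y : DirectSumCompletion D) : D :=
  (hD Y.ι Y.X).choose

/-- The inclusions of the terms into the chosen orthogonal direct sum. -/
noncomputable def sumInc (hD : AdmitsAllDirectSums D) (Y : DirectSumCompletion D) (i : Y.ι) :
    Y.X i ⟶ sumObj hD Y :=
  (hD Y.ι Y.X).choose_spec.choose i

theorem sumInc_spec (hD : AdmitsAllDirectSums D) (Y : DirectSumCompletion D) :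
    IsOrthogonalDirectSum Y.X (sumObj hD Y) (sumInc hD Y) :=
  (hD Y.ι Y.X).choose_spec.choose_spec

/-- The morphism between chosen orthogonal direct sums with a given matrix. -/
noncomputable def sumMap (hD : AdmitsAllDirectSums D) {Y Z : DirectSumCompletion D} (f : Y ⟶ Z) :
    sumObj hD Y ⟶ sumObj hD Z :=
  ((sumInc_spec hD Y).exists_hom (sumInc_spec hD Z)
    (DirectSumCompletion.entries_bounded f)).choose

theorem sumMap_spec (hD : AdmitsAllDirectSums D) {Y Z : DirectSumCompletion D} (f : Y ⟶ Z)
    (i : Y.ι) (j : Z.ι) :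
    sumInc hD Y i ≫ sumMap hD f ≫ (sumInc hD Z j)† = entries f i j :=
  ((sumInc_spec hD Y).exists_hom (sumInc_spec hD Z)
    (DirectSumCompletion.entries_bounded f)).choose_spec i j

theorem sumMap_eq (hD : AdmitsAllDirectSums D) {Y Z : DirectSumCompletion D} {f : Y ⟶ Z}
    {g : sumObj hD Y ⟶ sumObj hD Z}
    (h : ∀ i j, sumInc hD Y i ≫ g ≫ (sumInc hD Z j)† = entries f i j) : sumMap hD f = g :=
  (sumInc_spec hD Y).hom_ext₂ (sumInc_spec hD Z) fun i j => by rw [sumMap_spec, h]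

/-- Summation of formal direct sums, as a functor. -/
noncomputable def sumFunctor (hD : AdmitsAllDirectSums D) : DirectSumCompletion D ⥤ D where
  obj Y := sumObj hD Y
  map f := sumMap hD f
  map_id Y := sumMap_eq hD fun i j => by
    rw [Category.id_comp, DirectSumCompletion.entries_id]
    by_cases h : i = j
    · subst h
      rw [(sumInc_spec hD Y).isometry, idMatrix_self]
    · rw [(sumInc_spec hD Y).orthogonal i j h, idMatrix_ne _ h]
  map_comp {X Y Z} f g := sumMap_eq hD fun i k => by
    apply (Mat_.embedding D).map_injective
    have h1 := ((sumInc_spec hD Y).hasUWSum.comp_left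
      ((Mat_.embedding D).map (sumInc hD X i ≫ sumMap hD f))).comp_right
      ((Mat_.embedding D).map (sumMap hD g ≫ (sumInc hD Z k)†))
    rw [Category.comp_id] at h1
    have h2 := DirectSumCompletion.entries_comp f g i k
    refine HasUWSum.unique (a := fun j => (Mat_.embedding D).map (entries f i j ≫ entries g j k))
      ?_ h2
    simp only [← sumMap_spec hD]
    simpa only [← Functor.map_comp, Category.assoc] using h1

theorem sumFunctor_isStarFunctor (hD : AdmitsAllDirectSums D) : IsStarFunctor (sumFunctor hD) where
  map_add f g := sumMap_eq hD fun i j => by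
    change _ ≫ (sumMap hD f + sumMap hD g) ≫ _ = _
    rw [Preadditive.add_comp, Preadditive.comp_add, sumMap_spec, sumMap_spec]
    rfl
  map_smul c f := sumMap_eq hD fun i j => by
    change _ ≫ (c • sumMap hD f) ≫ _ = _
    rw [Linear.smul_comp, Linear.comp_smul, sumMap_spec]
    rfl
  map_dag {X Y} f := sumMap_eq hD fun i j => by
    change _ ≫ (sumMap hD f)† ≫ _ = (entries f j i)†
    rw [← sumMap_spec hD f j i]
    simp

instance (hD : AdmitsAllDirectSums D) : (sumFunctor hD).Full where
  map_surjective {X Y} g := by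
    have hb := (sumInc_spec hD X).isBoundedMatrix (sumInc_spec hD Y) g
    exact ⟨ofMatrix _ hb, sumMap_eq hD fun i j => rfl⟩

instance (hD : AdmitsAllDirectSums D) : (sumFunctor hD).Faithful where
  map_injective {X Y} f g h := DirectSumCompletion.hom_ext fun i j => by
    rw [← sumMap_spec hD f, ← sumMap_spec hD g]
    have h' : sumMap hD f = sumMap hD g := h
    rw [h']

theorem sumFunctor_isWStarFunctor (hD : AdmitsAllDirectSums D) :
    IsWStarFunctor (sumFunctor hD) :=
  (sumFunctor_isStarFunctor hD).isWStarFunctor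

end Summation

/-! ### Diagonal morphisms between orthogonal direct sums -/

section Diagonal
variable {M : Type u} [Category.{v} M] [Preadditive M] [Linear ℂ M] [StarCategory M]
  [IsWStarAdditive M]

/-- A diagonal endomorphism is at most `r` if its entries are. -/
theorem pos_sub_sum_conj {ι : Type*} {c : ι → M} {x : M} {p : ∀ i, c i ⟶ x}
    (h1 : ∀ i, p i ≫ (p i)† = 𝟙 (c i)) (h2 : ∀ i j, i ≠ j → p i ≫ (p j)† = 0)
    {b : ∀ i, c i ⟶ c i} {r : ℝ} (hr : 0 ≤ r) (hb : ∀ i, Pos ((r : ℂ) • 𝟙 (c i) - b i))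
    (s : Finset ι) : Pos ((r : ℂ) • 𝟙 x - ∑ i ∈ s, (p i)† ≫ b i ≫ p i) := by
  have h3 := (pos_one_sub_sum h1 h2 s).smul hr
  have h4 : Pos (∑ i ∈ s, (p i)† ≫ ((r : ℂ) • 𝟙 (c i) - b i) ≫ p i) :=
    pos_sum _ _ fun i _ => by simpa using (hb i).conj ((p i)†)
  convert h3.add h4 using 1
  simp only [Preadditive.sub_comp, Preadditive.comp_sub, Linear.smul_comp, Linear.comp_smul,
    Category.id_comp, Finset.sum_sub_distrib, ← Finset.smul_sum, smul_sub]
  abel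

/-- The diagonal morphism of a uniformly bounded family is the ultraweak sum of `pᵢ* βᵢ qᵢ`. The
sum converges and has the same bound since the finite partial sums `t` satisfy `t t* ≤ r²` by the
orthogonality of the `qᵢ`. -/
theorem exists_diagonal {ι : Type*} {c d : ι → M} {x y : M} {p : ∀ i, c i ⟶ x} {q : ∀ i, d i ⟶ y}
    (p1 : ∀ i, p i ≫ (p i)† = 𝟙 (c i)) (p2 : ∀ i j, i ≠ j → p i ≫ (p j)† = 0)
    (q1 : ∀ i, q i ≫ (q i)† = 𝟙 (d i)) (q2 : ∀ i j, i ≠ j → q i ≫ (q j)† = 0)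
    {β : ∀ i, c i ⟶ d i} {r : ℝ} (hr : 0 ≤ r) (hβ : ∀ i, NormLE (β i) r) :
    ∃ α : x ⟶ y, NormLE α r ∧ ∀ i, p i ≫ α = β i ≫ q i := by
  classical
  obtain ⟨α, hα⟩ := exists_uwSum (fun i => (p i)†) (fun i => β i ≫ q i) (r := 1) (s := r ^ 2)
    (fun s => by simpa using pos_one_sub_sum p1 p2 s)
    (fun s => by simpa using pos_sub_sum_conj q1 q2 (sq_nonneg r) (fun i => (hβ i).dag.2) s)
  refine ⟨α, normLE_of_uwSum hα fun s => ⟨hr, ?_⟩, fun i => ?_⟩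
  · have h := pos_sub_sum_conj p1 p2 (sq_nonneg r) (fun i => (hβ i).2) s
    convert h using 2
    rw [Preadditive.sum_comp]
    refine Finset.sum_congr rfl fun i hi => ?_
    rw [dag_sum, Preadditive.comp_sum, Finset.sum_eq_single i]
    · have : ((p i)† ≫ β i ≫ q i) ≫ ((p i)† ≫ β i ≫ q i)† =
          (p i)† ≫ β i ≫ (q i ≫ (q i)†) ≫ (β i)† ≫ p i := by simp
      rw [this, q1]; simp
    · intro j _ hj
      have : ((p i)† ≫ β i ≫ q i) ≫ ((p j)† ≫ β j ≫ q j)† =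
          (p i)† ≫ β i ≫ (q i ≫ (q j)†) ≫ (β j)† ≫ p j := by simp
      rw [this, q2 i j (Ne.symm hj)]; simp
    · exact fun h => (h hi).elim
  · have h1 := hα.comp_left (p i)
    have h2 := HasUWSum.single i (a := fun j => p i ≫ (p j)† ≫ β j ≫ q j) fun j hj => by
      rw [← Category.assoc, p2 i j (Ne.symm hj), Limits.zero_comp]
    rw [← Category.assoc (p i), p1, Category.id_comp] at h2
    exact h1.unique h2

end Diagonal

section
variable {D : Type u} [Category.{v} D] [Preadditive D] [Linear ℂ D] [StarCategory D]
  [WStarCategory D]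

/-- A uniformly bounded family of morphisms induces a morphism of the orthogonal direct sums. -/
theorem IsOrthogonalDirectSum.exists_diagonal {ι : Type*} {c d : ι → D} {x y : D}
    {p : ∀ i, c i ⟶ x} {q : ∀ i, d i ⟶ y} (hp : IsOrthogonalDirectSum c x p)
    (hq : IsOrthogonalDirectSum d y q) {β : ∀ i, c i ⟶ d i} {r : ℝ} (hr : 0 ≤ r)
    (hβ : ∀ i, NormLE (β i) r) :
    ∃ α : x ⟶ y, NormLE α r ∧ (∀ i, p i ≫ α = β i ≫ q i) ∧
      ∀ i, α ≫ (q i)† = (p i)† ≫ β i := by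
  have hE := isStarFunctor_embedding (C := D)
  let E := Mat_.embedding D
  have m1 : ∀ {a b : D} {f : a ⟶ b}, f ≫ f† = 𝟙 a → E.map f ≫ (E.map f)† = 𝟙 (E.obj a) := by
    intro a b f h
    rw [← hE.map_dag, ← E.map_comp, h, E.map_id]
  have m2 : ∀ {a b c : D} {f : a ⟶ b} {g : c ⟶ b}, f ≫ g† = 0 → E.map f ≫ (E.map g)† = 0 := by
    intro a b c f g h
    rw [← hE.map_dag, ← E.map_comp, h, hE.map_zero]
  obtain ⟨α', h1, h2⟩ := WStar.exists_diagonal (fun i => m1 (hp.isometry i))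
    (fun i j h => m2 (hp.orthogonal i j h)) (fun i => m1 (hq.isometry i))
    (fun i j h => m2 (hq.orthogonal i j h)) hr (fun i => (hβ i).map hE)
  obtain ⟨α, rfl⟩ := E.map_surjective α'
  have h3 : ∀ i, p i ≫ α = β i ≫ q i := fun i => E.map_injective (by simpa using h2 i)
  refine ⟨α, .of_map hE h1, h3, fun j => hp.hom_ext fun i => ?_⟩
  rw [← Category.assoc, h3, Category.assoc, ← Category.assoc (p i)]
  by_cases h : i = j
  · subst h
    rw [hq.isometry, hp.isometry, Category.comp_id, Category.id_comp]
  · rw [hq.orthogonal i j h, hp.orthogonal i j h, Limits.comp_zero, Limits.zero_comp]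

end

/-! ### The universal property of the direct sum completion -/

section Universal
universe u₁ u₂
variable {C : Type u₁} [Category.{v} C] [Preadditive C] [Linear ℂ C] [StarCategory C]
variable {D : Type u₂} [Category.{v} D] [Preadditive D] [Linear ℂ D] [StarCategory D]
  [WStarCategory D]

/-- A natural family of unitary morphisms is an isomorphism of functors of W*-categories. -/
def Func.isoOfUnitary {F G : Func C D} (η : ∀ c, F.functor.obj c ⟶ G.functor.obj c)
    (h1 : ∀ c, η c ≫ (η c)† = 𝟙 _) (h2 : ∀ c, (η c)† ≫ η c = 𝟙 _)
    (hη : ∀ {c d : C} (f : c ⟶ d), F.functor.map f ≫ η d = η c ≫ G.functor.map f) : F ≅ G where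
  hom := ⟨{ app := η, naturality := fun _ _ f => hη f }, 1, fun c => .of_isometry (h1 c)⟩
  inv := ⟨{ app := fun c => (η c)†
            naturality := fun c d f => by
              have h := congrArg (fun g => (η c)† ≫ g ≫ (η d)†) (hη f)
              simp only [Category.assoc, h1, Category.comp_id] at h
              rw [h, ← Category.assoc, h2, Category.id_comp] },
    1, fun c => .of_isometry (by rw [StarCategory.dag_dag]; exact h2 c)⟩
  hom_inv_id := Subtype.ext (NatTrans.ext (funext h1))
  inv_hom_id := Subtype.ext (NatTrans.ext (funext h2))

variable [WStarCategory C]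
namespace DirectSumCompletion

theorem inc_inclusion (x : C) : inc ((inclusion C).obj x) PUnit.unit = 𝟙 ((inclusion C).obj x) :=
  hom_ext fun _ _ => rfl

theorem isOrthogonalDirectSum_map_inc (F : Func (DirectSumCompletion C) D)
    (Y : DirectSumCompletion C) :
    IsOrthogonalDirectSum (fun i => F.functor.obj ((inclusion C).obj (Y.X i))) (F.functor.obj Y)
      fun i => F.functor.map (inc Y i) :=
  (isOrthogonalDirectSum_inc Y).map F.isWStarFunctor

instance restriction_faithful :
    (restriction D (inclusion C) inclusion_isWStarFunctor).Faithful where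
  map_injective {F G} α α' h := by
    refine Subtype.ext (NatTrans.ext (funext fun Y => ?_))
    refine (isOrthogonalDirectSum_map_inc F Y).hom_ext fun i => ?_
    rw [α.1.naturality, α'.1.naturality]
    congr 1
    exact congrArg (fun β => β.1.app (Y.X i)) h

instance restriction_full :
    (restriction D (inclusion C) inclusion_isWStarFunctor).Full where
  map_surjective {F G} β := by
    obtain ⟨r, hr⟩ := β.2
    let J := inclusion C
    let b : ∀ x, F.functor.obj (J.obj x) ⟶ G.functor.obj (J.obj x) := fun x => β.1.app x
    have hb : ∀ {x y : C} (f : x ⟶ y), F.functor.map (J.map f) ≫ b y =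
        b x ≫ G.functor.map (J.map f) := fun f => β.1.naturality f
    -- `0 ≤ r` is only known if `C` has an object, whence the absolute value
    have hr' : ∀ x, NormLE (b x) |r| := fun x => by
      rw [abs_of_nonneg (hr x).1]; exact hr x
    choose α hα h1 h2 using fun Y : DirectSumCompletion C =>
      (isOrthogonalDirectSum_map_inc F Y).exists_diagonal (isOrthogonalDirectSum_map_inc G Y)
        (β := fun i => b (Y.X i)) (abs_nonneg r) fun i => hr' (Y.X i)
    refine ⟨⟨{ app := α, naturality := fun Y Z f => ?_ }, |r|, hα⟩,
      Subtype.ext (NatTrans.ext (funext fun x => ?_))⟩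
    · refine (isOrthogonalDirectSum_map_inc F Y).hom_ext₂ (isOrthogonalDirectSum_map_inc G Z)
        fun i j => ?_
      have h3 : F.functor.map (inc Y i) ≫ F.functor.map f ≫ (F.functor.map (inc Z j))† =
          F.functor.map (J.map (entries f i j)) := by
        rw [← F.isWStarFunctor.map_dag, ← Functor.map_comp, ← Functor.map_comp, inc_comp_inc_dag]
      have h4 : G.functor.map (inc Y i) ≫ G.functor.map f ≫ (G.functor.map (inc Z j))† =
          G.functor.map (J.map (entries f i j)) := by
        rw [← G.isWStarFunctor.map_dag, ← Functor.map_comp, ← Functor.map_comp, inc_comp_inc_dag]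
      have h5 := congrArg (· ≫ b (Z.X j)) h3
      have h6 := congrArg (b (Y.X i) ≫ ·) h4
      simp only [Category.assoc, ← h2] at h5
      simp only [← Category.assoc, ← h1] at h6
      simp only [Category.assoc] at h6 ⊢
      exact h5.trans ((hb _).trans h6.symm)
    · let p : J.obj x ⟶ J.obj x := inc (J.obj x) PUnit.unit
      have hp : p = 𝟙 _ := inc_inclusion x
      have h : F.functor.map p ≫ α (J.obj x) = b x ≫ G.functor.map p := h1 (J.obj x) PUnit.unit
      rw [hp, CategoryTheory.Functor.map_id, CategoryTheory.Functor.map_id, Category.id_comp,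
        Category.comp_id] at h
      exact h

theorem restriction_essSurj (hD : AdmitsAllDirectSums D) :
    (restriction D (inclusion C) inclusion_isWStarFunctor).EssSurj where
  mem_essImage F := by
    let F' : Func (DirectSumCompletion C) D :=
      ⟨mapFunctor F.functor F.isWStarFunctor ⋙ sumFunctor hD,
        (mapFunctor_isWStarFunctor F.isWStarFunctor).comp (sumFunctor_isWStarFunctor hD)⟩
    let Y : C → DirectSumCompletion D := fun x =>
      (mapFunctor F.functor F.isWStarFunctor).obj ((inclusion C).obj x)
    let η : ∀ x, F.functor.obj x ⟶ sumObj hD (Y x) := fun x => sumInc hD (Y x) PUnit.unit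
    have h1 : ∀ x, η x ≫ (η x)† = 𝟙 _ := fun x => (sumInc_spec hD (Y x)).isometry PUnit.unit
    have h2 : ∀ x, (η x)† ≫ η x = 𝟙 _ := fun x => (sumInc_spec hD (Y x)).hom_ext fun i => by
      change η x ≫ (η x)† ≫ η x = η x ≫ 𝟙 _
      rw [← Category.assoc, h1, Category.id_comp, Category.comp_id]
    refine ⟨F', ⟨(Func.isoOfUnitary (F := F)
      (G := (restriction D (inclusion C) inclusion_isWStarFunctor).obj F') η h1 h2
      fun {x y} f => ?_).symm⟩⟩
    have h3 : η x ≫ sumMap hD ((mapFunctor F.functor F.isWStarFunctor).map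
        ((inclusion C).map f)) ≫ (η y)† = F.functor.map f := sumMap_spec hD _ _ _
    change F.functor.map f ≫ η y = η x ≫ sumMap hD _
    rw [← h3, Category.assoc, Category.assoc, h2, Category.comp_id]

theorem restriction_isEquivalence (hD : AdmitsAllDirectSums D) :
    (restriction D (inclusion C) inclusion_isWStarFunctor).IsEquivalence :=
  have := restriction_essSurj (C := C) hD
  { }

end DirectSumCompletion

end Universal

/-! ### Diagonal matrices -/

section Diag
variable {C : Type u} [Category.{v} C] [Preadditive C] [Linear ℂ C] [StarCategory C]

open Classical in
/-- The diagonal matrix of a family of morphisms. -/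
noncomputable def diag {X : Mat_ C} {Y : X.ι → C} (f : ∀ i, X.X i ⟶ Y i) :
    X ⟶ Mat_.mk X.ι Y :=
  matOf fun i j => (𝟙 X : X ⟶ X) i j ≫ f j

variable {X Z : Mat_ C} {Y : X.ι → C} (f : ∀ i, X.X i ⟶ Y i)

theorem comp_diag_apply (g : Z ⟶ X) (i : Z.ι) (j : X.ι) : (g ≫ diag f) i j = g i j ≫ f j := by
  classical
  have h : ∑ k, g i k ≫ (𝟙 X : X ⟶ X) k j = g i j :=
    (Mat_.comp_apply g (𝟙 X) i j).symm.trans (congrFun (congrFun (Category.comp_id g) i) j)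
  refine (Mat_.comp_apply (M := Z) (N := X) (K := Mat_.mk X.ι Y) g (diag f) i j).trans ?_
  rw [← h, Preadditive.sum_comp]
  exact Finset.sum_congr rfl fun k _ => (Category.assoc _ _ _).symm

theorem diag_comp_apply (g : Mat_.mk X.ι Y ⟶ Z) (i : X.ι) (j : Z.ι) :
    (diag f ≫ g) i j = f i ≫ g i j := by
  classical
  refine (Mat_.comp_apply _ _ i j).trans ((Finset.sum_eq_single i ?_ ?_).trans ?_)
  · intro k _ hk
    change ((𝟙 X : X ⟶ X) i k ≫ f k) ≫ g k j = 0
    rw [Mat_.id_apply_of_ne _ _ _ (Ne.symm hk), Limits.zero_comp, Limits.zero_comp]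
  · exact fun h => (h (Finset.mem_univ (α := X.ι) i)).elim
  · change ((𝟙 X : X ⟶ X) i i ≫ f i) ≫ g i j = _
    rw [Mat_.id_apply_self, Category.id_comp]

theorem diag_conj_apply (g : Mat_.mk X.ι Y ⟶ Mat_.mk X.ι Y) (i j : X.ι) :
    (diag f ≫ g ≫ (diag f)†) i j = f i ≫ g i j ≫ (f j)† := by
  rw [diag_comp_apply]
  have h : g ≫ (diag f)† = (diag f ≫ g†)† := by simp
  rw [h, mat_dag_apply, diag_comp_apply]
  simp

theorem diag_dag_conj_apply (g : X ⟶ X) (i j : X.ι) :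
    ((diag f)† ≫ g ≫ diag f) i j = (f i)† ≫ g i j ≫ f j := by
  have h : (diag f)† ≫ g ≫ diag f = ((g ≫ diag f)† ≫ diag f)† := by simp
  rw [h, mat_dag_apply, comp_diag_apply, mat_dag_apply, comp_diag_apply]
  simp

end Diag

/-! ### The universal property of the idempotent completion -/

section
universe u₁ u₂
variable {C : Type u₁} [Category.{v} C] [Preadditive C] [Linear ℂ C] [StarCategory C]
variable {D : Type u₂} [Category.{v} D] [Preadditive D] [Linear ℂ D] [StarCategory D]

theorem IsStarFunctor.bijective_endMap {F : C ⥤ D} [F.Full] [F.Faithful] (X : Mat_ C) :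
    Function.Bijective (endMap F X) := by
  refine ⟨fun f g h => ?_, fun g => ?_⟩
  · refine Mat_.hom_ext (M := X) (N := X) _ _ fun i j => F.map_injective ?_
    exact congrFun (congrFun h i) j
  · refine ⟨matOf fun i j => F.preimage (X := X.X i) (Y := X.X j) (g i j), ?_⟩
    refine Mat_.hom_ext (M := matObj F X) (N := matObj F X) _ _ fun i j => ?_
    exact F.map_preimage _

theorem NormLE.dag' [WStarCategory D] {X Y : D} {f : X ⟶ Y} {r : ℝ} (h : NormLE f r) :
    NormLE f† r :=
  .of_map isStarFunctor_embedding (h.map isStarFunctor_embedding).dag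

namespace IdempotentCompletion

/-- The isometry from `(x, p)` to `(x, 1)` with range projection `p`. -/
def inc (P : IdempotentCompletion C) : P ⟶ (inclusion C).obj P.X :=
  ⟨P.p, mem_homs P.idem (Category.comp_id _)⟩

theorem inc_isometry (P : IdempotentCompletion C) : inc P ≫ (inc P)† = 𝟙 P :=
  Subtype.ext (by
    change P.p ≫ P.p† = P.p
    rw [P.dag_eq, P.idem])

theorem inc_dag_comp_comp_inc {P Q : IdempotentCompletion C} (f : P ⟶ Q) :
    (inc P)† ≫ f ≫ inc Q = (inclusion C).map (val f) :=
  Subtype.ext (by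
    change P.p† ≫ f.1 ≫ Q.p = f.1
    rw [P.dag_eq, comp_p f.2, p_comp f.2])

theorem comp_inc {P Q : IdempotentCompletion C} (f : P ⟶ Q) :
    f ≫ inc Q = inc P ≫ (inclusion C).map (val f) := by
  rw [← inc_dag_comp_comp_inc, ← Category.assoc (inc P), inc_isometry, Category.id_comp]

theorem map_val_comp_inc_dag {P Q : IdempotentCompletion C} (f : P ⟶ Q) :
    (inclusion C).map (val f) ≫ (inc Q)† = (inc P)† ≫ f := by
  rw [← inc_dag_comp_comp_inc, Category.assoc, Category.assoc, inc_isometry, Category.comp_id]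

section Splitting
variable {F : C ⥤ D}

/-- A choice of a splitting of the projection `F p`. -/
noncomputable def splitObj (hF : IsStarFunctor F) (hD : IsIdempotentComplete D)
    (P : IdempotentCompletion C) : D :=
  (hD (F.obj P.X) (F.map P.p) (by rw [← F.map_comp, P.idem])
    (by rw [← hF.map_dag, P.dag_eq])).choose

/-- The isometry onto the range of the projection `F p`. -/
noncomputable def splitInc (hF : IsStarFunctor F) (hD : IsIdempotentComplete D)
    (P : IdempotentCompletion C) : splitObj hF hD P ⟶ F.obj P.X :=
  (hD (F.obj P.X) (F.map P.p) (by rw [← F.map_comp, P.idem])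
    (by rw [← hF.map_dag, P.dag_eq])).choose_spec.choose

variable (hF : IsStarFunctor F) (hD : IsIdempotentComplete D)

theorem splitInc_dag_comp (P : IdempotentCompletion C) :
    (splitInc hF hD P)† ≫ splitInc hF hD P = F.map P.p :=
  (hD (F.obj P.X) (F.map P.p) (by rw [← F.map_comp, P.idem])
    (by rw [← hF.map_dag, P.dag_eq])).choose_spec.choose_spec.1

theorem splitInc_isometry (P : IdempotentCompletion C) :
    splitInc hF hD P ≫ (splitInc hF hD P)† = 𝟙 _ :=
  (hD (F.obj P.X) (F.map P.p) (by rw [← F.map_comp, P.idem])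
    (by rw [← hF.map_dag, P.dag_eq])).choose_spec.choose_spec.2

/-- The extension of a functor to the idempotent completion, by splittings in the target. -/
noncomputable def lift : IdempotentCompletion C ⥤ D where
  obj P := splitObj hF hD P
  map {P Q} f := splitInc hF hD P ≫ F.map (val f) ≫ (splitInc hF hD Q)†
  map_id P := by
    change _ ≫ F.map P.p ≫ _ = _
    rw [← splitInc_dag_comp hF hD, Category.assoc, splitInc_isometry, Category.comp_id,
      splitInc_isometry]
  map_comp {P Q R} f g := by
    have h : (splitInc hF hD P ≫ F.map (val f) ≫ (splitInc hF hD Q)†) ≫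
        splitInc hF hD Q ≫ F.map (val g) ≫ (splitInc hF hD R)† =
        splitInc hF hD P ≫ F.map (val f) ≫ ((splitInc hF hD Q)† ≫ splitInc hF hD Q) ≫
          F.map (val g) ≫ (splitInc hF hD R)† := by simp
    rw [h, splitInc_dag_comp, ← Category.assoc (F.map Q.p), ← F.map_comp,
      show Q.p ≫ val g = val g from p_comp g.2, ← Category.assoc (F.map (val f)), ← F.map_comp]
    rfl

theorem lift_isStarFunctor : IsStarFunctor (lift hF hD) where
  map_add {P Q} f g := by
    have h : splitInc hF hD P ≫ F.map (val f + val g) ≫ (splitInc hF hD Q)† =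
        splitInc hF hD P ≫ F.map (val f) ≫ (splitInc hF hD Q)† +
          splitInc hF hD P ≫ F.map (val g) ≫ (splitInc hF hD Q)† := by
      rw [hF.map_add, Preadditive.add_comp, Preadditive.comp_add]
    exact h
  map_smul {P Q} c f := by
    have h : splitInc hF hD P ≫ F.map (c • val f) ≫ (splitInc hF hD Q)† =
        c • (splitInc hF hD P ≫ F.map (val f) ≫ (splitInc hF hD Q)†) := by
      rw [hF.map_smul, Linear.smul_comp, Linear.comp_smul]
    exact h
  map_dag {P Q} f := by
    have h : splitInc hF hD Q ≫ F.map ((val f)†) ≫ (splitInc hF hD P)† =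
        (splitInc hF hD P ≫ F.map (val f) ≫ (splitInc hF hD Q)†)† := by
      rw [hF.map_dag]
      simp
    exact h

variable [WStarCategory C] [WStarCategory D]

/-- On the endomorphisms of a formal sum of objects `(xᵢ, pᵢ)`, the extension is the composite of
the inclusion of the corner `p A p` in the endomorphism algebra `A` of the sum of the `xᵢ`, the
map induced by `F`, and the conjugation by the sum of the isometries `splitInc`. All three
preserve suprema. -/
theorem lift_isWStarFunctor {F : C ⥤ D} (hF : IsWStarFunctor F) (hD : IsIdempotentComplete D) :
    IsWStarFunctor (lift hF.toIsStarFunctor hD) where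
  toIsStarFunctor := lift_isStarFunctor _ hD
  normal X := by
    intro S hne hdir hpos a ha
    have hI := inclusion_isStarFunctor (C := C)
    let X' : Mat_ C := ⟨X.ι, fun i => (X.X i).X⟩
    let φ : End X → End X' := fun s => matOf (X := X') (Y := X') fun i j => val (s i j)
    let v : X ⟶ matObj (inclusion C) X' := diag fun i => inc (X.X i)
    let V : matObj (lift hF.toIsStarFunctor hD) X ⟶ matObj F X' :=
      diag (X := matObj (lift hF.toIsStarFunctor hD) X)
        fun i => splitInc hF.toIsStarFunctor hD (X.X i)
    have h1 : ∀ s : X ⟶ X, v† ≫ s ≫ v = endMap (inclusion C) X' (φ s) := fun s => by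
      refine Mat_.hom_ext (M := matObj (inclusion C) X') (N := matObj (inclusion C) X') _ _
        fun i j => ?_
      exact (diag_dag_conj_apply _ s i j).trans (inc_dag_comp_comp_inc _)
    have h2 : ∀ s : X ⟶ X, V ≫ matMap F (φ s) ≫ V† =
        endMap (lift hF.toIsStarFunctor hD) X s := fun s => by
      refine Mat_.hom_ext (M := matObj (lift hF.toIsStarFunctor hD) X)
        (N := matObj (lift hF.toIsStarFunctor hD) X) _ _ fun i j => ?_
      exact diag_conj_apply (X := matObj (lift hF.toIsStarFunctor hD) X) _ _ i j
    have hφ : ∀ s, IsPos s → IsPos (φ s) := fun s hs => by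
      refine (isPos_image_iff (IsStarFunctor.bijective_endMap (F := inclusion C) X')
        hI.matMap_star_mul).1 ?_
      rw [← h1]
      have := Pos.conj hs (v†)
      rw [StarCategory.dag_dag] at this
      exact this
    have h3 : IsSup (φ '' S) (φ a) := by
      refine (isSup_image_iff (IsStarFunctor.bijective_endMap (F := inclusion C) X')
        hI.matMap_sub hI.matMap_star_mul).1 ?_
      have := isSup_conj_set hne hdir hpos ha (v†)
      rw [StarCategory.dag_dag] at this
      simp only [h1] at this
      rw [Set.image_image]
      exact this
    have hdir' : DirectedOn (fun s t => IsPos (t - s)) (φ '' S) := by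
      rintro _ ⟨s, hs, rfl⟩ _ ⟨t, ht, rfl⟩
      obtain ⟨w, hw, h4, h5⟩ := hdir s hs t ht
      exact ⟨_, ⟨w, hw, rfl⟩, hφ _ h4, hφ _ h5⟩
    have hpos' : ∀ s ∈ φ '' S, IsPos s := by
      rintro _ ⟨s, hs, rfl⟩
      exact hφ s (hpos s hs)
    have h4 := isSup_conj_set ((hne.image _).image _) (hF.directedOn_endMap hdir') (by
      rintro _ ⟨s, hs, rfl⟩
      exact hF.matMap_pos (hpos' s hs)) (hF.normal X' _ (hne.image _) hdir' hpos' _ h3) V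
    rw [Set.image_image, Set.image_image] at h4
    rw [← h2]
    simp only [← h2]
    exact h4

end Splitting

variable [WStarCategory D]

theorem inclusion_isWStarFunctor : IsWStarFunctor (inclusion C) :=
  inclusion_isStarFunctor.isWStarFunctor

instance restriction_faithful :
    (restriction D (inclusion C) inclusion_isWStarFunctor).Faithful where
  map_injective {F G} α α' h := by
    refine Subtype.ext (NatTrans.ext (funext fun P => ?_))
    -- a transformation is determined at `(x, p)` by its value at `(x, 1)`
    have h1 : ∀ α : F ⟶ G, α.1.app P = F.functor.map (inc P) ≫
        α.1.app ((inclusion C).obj P.X) ≫ G.functor.map ((inc P)†) := fun α => by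
      rw [← Category.assoc, α.1.naturality, Category.assoc, ← Functor.map_comp, inc_isometry,
        CategoryTheory.Functor.map_id, Category.comp_id]
    rw [h1 α, h1 α']
    congr 2
    exact congrArg (fun β => β.1.app P.X) h

instance restriction_full :
    (restriction D (inclusion C) inclusion_isWStarFunctor).Full where
  map_surjective {F G} β := by
    obtain ⟨r, hr⟩ := β.2
    let J := inclusion C
    let b : ∀ x, F.functor.obj (J.obj x) ⟶ G.functor.obj (J.obj x) := fun x => β.1.app x
    have hb : ∀ {x y : C} (f : x ⟶ y), F.functor.map (J.map f) ≫ b y =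
        b x ≫ G.functor.map (J.map f) := fun f => β.1.naturality f
    have hi : ∀ P : IdempotentCompletion C, NormLE (inc P) 1 := fun P =>
      .of_isometry (inc_isometry P)
    refine ⟨⟨{ app := fun P => F.functor.map (inc P) ≫ b P.X ≫ G.functor.map ((inc P)†)
               naturality := fun P Q f => ?_ }, 1 * (r * 1), fun P => ?_⟩,
      Subtype.ext (NatTrans.ext (funext fun x => ?_))⟩
    · rw [← Category.assoc, ← Functor.map_comp, comp_inc, Functor.map_comp, Category.assoc,
        ← Category.assoc _ (b Q.X)]
      erw [hb]
      rw [Category.assoc, ← Functor.map_comp]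
      erw [map_val_comp_inc_dag]
      rw [Functor.map_comp]
      simp only [Category.assoc]
    · refine ((hi P).map F.isWStarFunctor.toIsStarFunctor).comp' D (.comp' D (hr P.X) ?_)
      rw [G.isWStarFunctor.map_dag]
      exact ((hi P).map G.isWStarFunctor.toIsStarFunctor).dag'
    · change F.functor.map (𝟙 (J.obj x)) ≫ b x ≫ G.functor.map ((𝟙 (J.obj x))†) = b x
      rw [dag_id, CategoryTheory.Functor.map_id, CategoryTheory.Functor.map_id, Category.id_comp,
        Category.comp_id]

theorem restriction_essSurj [WStarCategory C] (hD : IsIdempotentComplete D) :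
    (restriction D (inclusion C) inclusion_isWStarFunctor).EssSurj where
  mem_essImage F := by
    have hs := F.isWStarFunctor.toIsStarFunctor
    let F' : Func (IdempotentCompletion C) D :=
      ⟨lift hs hD, lift_isWStarFunctor F.isWStarFunctor hD⟩
    let η : ∀ x, (lift hs hD).obj ((inclusion C).obj x) ⟶ F.functor.obj x := fun x =>
      splitInc hs hD ((inclusion C).obj x)
    have h1 : ∀ x, (η x)† ≫ η x = 𝟙 _ := fun x =>
      (splitInc_dag_comp hs hD ((inclusion C).obj x)).trans (F.functor.map_id x)
    refine ⟨F', ⟨Func.isoOfUnitary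
      (F := (restriction D (inclusion C) inclusion_isWStarFunctor).obj F') (G := F) η
      (fun x => splitInc_isometry hs hD ((inclusion C).obj x)) h1 fun {x y} f => ?_⟩⟩
    change (η x ≫ F.functor.map f ≫ (η y)†) ≫ η y = _
    rw [Category.assoc, Category.assoc, h1, Category.comp_id]
    rfl

theorem restriction_isEquivalence [WStarCategory C] (hD : IsIdempotentComplete D) :
    (restriction D (inclusion C) inclusion_isWStarFunctor).IsEquivalence :=
  have := restriction_essSurj (C := C) hD
  { }

end IdempotentCompletion

theorem CauchyCompletion.restriction_isEquivalence [WStarCategory C] [WStarCategory D]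
    (hD : IsCauchyComplete D) :
    (restriction D (CauchyCompletion.inclusion C) inclusion_isWStarFunctor).IsEquivalence := by
  have h1 := DirectSumCompletion.restriction_isEquivalence (C := IdempotentCompletion C) hD.1
  have h2 := IdempotentCompletion.restriction_isEquivalence (C := C) hD.2
  exact Functor.isEquivalence_trans
    (restriction D (DirectSumCompletion.inclusion (IdempotentCompletion C))
      DirectSumCompletion.inclusion_isWStarFunctor)
    (restriction D (IdempotentCompletion.inclusion C)
      IdempotentCompletion.inclusion_isWStarFunctor)

end

end WStar

theorem mainTheorem9
    {C : Type u} [CategoryTheory.Category.{v} C] [CategoryTheory.Preadditive C]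
    [CategoryTheory.Linear ℂ C] [WStar.StarCategory C] [WStar.WStarCategory C]
    {D : Type w} [CategoryTheory.Category.{v} D] [CategoryTheory.Preadditive D]
    [CategoryTheory.Linear ℂ D] [WStar.StarCategory D] [WStar.WStarCategory D] :
    (WStar.AdmitsAllDirectSums D →
      (WStar.restriction D (WStar.DirectSumCompletion.inclusion C)
        WStar.DirectSumCompletion.inclusion_isWStarFunctor).IsEquivalence) ∧
    (WStar.IsCauchyComplete D →
      (WStar.restriction D (WStar.CauchyCompletion.inclusion C)
        WStar.CauchyCompletion.inclusion_isWStarFunctor).IsEquivalence) :=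
  ⟨WStar.DirectSumCompletion.restriction_isEquivalence,
    WStar.CauchyCompletion.restriction_isEquivalence⟩
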